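/- Let $\mathcal M$ be an o-minimal expansion of a (nontrivial) ordered group and let $G$ be an abelian group definable in $\mathcal M$; "definable" means definable in $\mathcal M$ with parameters, and all topological notions in $G$ refer to the group topology, i.e. the unique topology making $G$ a topological group and a definable manifold with a finite definable atlas. For $X,Y\subseteq G$ and $a\in G$ write $X=_aY$ (respectively $X\subseteq_aY$) if $X\cap U=Y\cap U$ (respectively $X\cap U\subseteq Y\cap U$) for some open $U\ni a$. A definable set $X\subseteq G$ is $G$-linear if $X-g=_0X-h$ for all $g,h\in X$. Two $G$-linear sets $X,Y$ are $G$-equivalent if $X-g=_0Y-h$ for all $g\in X$, $h\in Y$. A definable $Y\subseteq G$ is a $G$-subset of a $G$-linear set $X$ if $Y-h\subseteq_0X-g$ for all $h\in Y$, $g\in X$. Let $\mathcal N$ be an $|M|^+$-saturated elementary extension of $\mathcal M$, let $\nu_g$ ($g\in G$) be the intersection in $G(\mathcal N)$ of all $\mathcal M$-definable open neighbourhoods of $g$, put $\nu_g(X)=\nu_g\cap X(\mathcal N)$, and for $G$-linear $X$ let $\nu(X)=\nu_x(X)-x$ for some (all) $x\in X$ (with $\nu(\emptyset)=\emptyset$).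 **A.** Let $X,Y\subseteq G$ be $G$-linear. (i) $X+Y$ is $G$-linear, and $\nu(X+Y)=\nu(X)+\nu(Y)$. In particular, if $X$ and $Y$ are $G$-equivalent, then $X+Y$ is $G$-equivalent to both of them. (ii) If $X$ and $Y$ are $G$-equivalent, then $X\cup Y$ is $G$-linear and $G$-equivalent to $X$ and to $Y$. **B.** Assume moreover that $\mathcal M$ is $\omega$-saturated, and let $X$ be a $G$-linear set with $0\in X$. For a cardinal $\kappa$, a $\kappa$-presentation of a subgroup $\mathcal H\le G$ is a directed family $\{X_i:i\in I\}$ of definable sets with $|I|<\kappa$ and $\mathcal H=\bigcup_{i\in I} X_i$; the dimension of $\mathcal H$ with respect to it is $\max_i\dim X_i$, and its $\nu_0(\mathcal H)$ is $\nu_0\cap\bigcup_iX_i(\mathcal N)$. The group $\mathcal H$ is locally-definable if it has a $\kappa$-presentation, where $\kappa$ is uncountable. (1) The subgroup $\langle X\rangle$ generated by $X$ is locally-definable (for every $\kappa>\aleph_0$), and its germ at $0$ is that of $X$, that is, $\langle X\rangle=_0X$. Every definable subset of $\langle X\rangle$ has dimension at most $\dim X$. For every $\kappa>\aleph_0$ there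 is a $\kappa$-presentation of $\langle X\rangle$ with respect to which $\dim\langle X\rangle=\dim X$ and $\nu_0(\langle X\rangle)=\nu(X)$; and if $\mathcal M$ is $\kappa$-saturated ($\kappa$ any cardinal), both equalities hold with respect to every $\kappa$-presentation of $\langle X\rangle$. (2) Let $Y$ be a $G$-subset of $X$ with $0\in Y$. Then the subgroup $\langle Y\rangle$ generated by $Y$ is locally-definable (for every $\kappa>\aleph_0$), its germ at $0$ is contained in that of $X$, that is, $\langle Y\rangle\subseteq_0X$, and every definable subset of $\langle Y\rangle$ has dimension at most $\dim X$. With respect to every presentation of $\langle Y\rangle$, $\dim\langle Y\rangle\le\dim X$ and $\nu_0(\langle Y\rangle)\subseteq\nu(X)$. -/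

import Mathlib

open FirstOrder Set
open scoped Pointwise Cardinal

universe u v w

/-- `M`, with its ordered group structure, is an o-minimal expansion of an ordered group:
the order and the addition are definable without parameters, and every subset of `M` that is
definable with parameters is a finite union of points and open intervals with endpoints in
`M ∪ {-∞, +∞}`. -/
structure OMinimalGroupExpansion (L : FirstOrder.Language.{u, v}) (M : Type w) [L.Structure M]
    [AddCommGroup M] [LinearOrder M] : Prop where
  definable_lt : (∅ : Set M).Definable L {t : Fin 2 → M | t 0 < t 1}
  definable_add : (∅ : Set M).Definable L {t : Fin 3 → M | t 0 + t 1 = t 2}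
  ominimal : ∀ S : Set M, (univ : Set M).Definable₁ L S →
    ∃ F : Set (Set M), F.Finite ∧ S = ⋃₀ F ∧
      ∀ I ∈ F, (∃ a, I = {a}) ∨ (∃ a b, I = Ioo a b) ∨ (∃ a, I = Iio a) ∨ (∃ a, I = Ioi a) ∨
        I = univ

/-- `κ`-saturation: over a parameter set of size `< κ`, every finitely satisfiable family of
definable conditions in finitely many variables is satisfiable. -/
def IsSaturated (L : FirstOrder.Language.{u, v}) (N : Type w) [L.Structure N] (κ : Cardinal.{w}) : Prop :=
  ∀ A : Set N, #A < κ → ∀ (m : ℕ) (F : Set (Set (Fin m → N))),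
    (∀ S ∈ F, A.Definable L S) → (∀ T ⊆ F, T.Finite → (⋂₀ T).Nonempty) → (⋂₀ F).Nonempty

/-- The o-minimal dimension of a definable set `S ⊆ Mⁿ`: the largest `d` such that the projection
of `S` to some `d` coordinates has nonempty interior in `M^d`; it is `⊥` for the empty set. -/
noncomputable def ominDim {M : Type w} [TopologicalSpace M] {n : ℕ} (S : Set (Fin n → M)) :
    WithBot ℕ∞ :=
  ⨆ (d : ℕ) (_ : ∃ σ : Fin d ↪ Fin n, (interior ((fun t : Fin n → M => t ∘ σ) '' S)).Nonempty),
    ((d : ℕ∞) : WithBot ℕ∞)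

/-- The interpretation `S(N)`, in an elementary extension `f : M ↪ₑ[L] N`, of a set `S` which is
definable in `M` with parameters: the set defined in `N` by a formula (with parameters from `M`)
that defines `S` in `M`. By elementarity all such formulas give the same set. -/
def extension {L : FirstOrder.Language.{u, v}} {M N : Type w} [L.Structure M] [L.Structure N]
    (f : M ↪ₑ[L] N) {α : Type} (S : Set (α → M)) : Set (α → N) :=
  {y | ∃ φ : L.Formula (M ⊕ α), S = {t | φ.Realize (Sum.elim id t)} ∧ φ.Realize (Sum.elim f y)}

/-- The abelian group `G` is a definable group in `M`: via `coord` it is a definable subset of `Mⁿ`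
with definable addition. Its topology is the group topology: `G` is a topological group, and a
definable manifold with finitely many definable charts, each a homeomorphism of an open subset of
`G` with an open subset of some fixed `M^d`. (There is exactly one such topology.) -/
structure DefinableGroup (L : FirstOrder.Language.{u, v}) (M : Type w) [L.Structure M] [TopologicalSpace M]
    (G : Type w) [AddCommGroup G] [TopologicalSpace G] (n : ℕ) where
  coord : G → (Fin n → M)
  coord_injective : Function.Injective coord
  definable_carrier : (univ : Set M).Definable L (range coord)
  definable_add : (univ : Set M).Definable L
    {t : Fin 3 × Fin n → M | ∃ a b : G, t = fun p => ![coord a, coord b, coord (a + b)] p.1 p.2}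
  isTopologicalAddGroup : IsTopologicalAddGroup G
  exists_atlas : ∃ (d k : ℕ) (φ : Fin k → OpenPartialHomeomorph G (Fin d → M)),
    (∀ g, ∃ i, g ∈ (φ i).source) ∧
    ∀ i, (univ : Set M).Definable L
      {t : Fin n ⊕ Fin d → M | ∃ g ∈ (φ i).source, t = Sum.elim (coord g) (φ i g)}

/-- `X =_a Y`: the sets `X` and `Y` have the same germ at `a`. -/
def GermEq {G : Type w} [TopologicalSpace G] (a : G) (X Y : Set G) : Prop :=
  ∃ U : Set G, IsOpen U ∧ a ∈ U ∧ X ∩ U = Y ∩ U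

/-- `X ⊆_a Y`: the germ of `X` at `a` is contained in the germ of `Y` at `a`. -/
def GermLE {G : Type w} [TopologicalSpace G] (a : G) (X Y : Set G) : Prop :=
  ∃ U : Set G, IsOpen U ∧ a ∈ U ∧ X ∩ U ⊆ Y ∩ U

/-- The translateBy `X - g`. -/
def translateBy {G : Type w} [AddCommGroup G] (X : Set G) (g : G) : Set G := (fun t => t - g) '' X

/-- `X` and `Y` are `G`-equivalent: `X - g =_0 Y - h` for all `g ∈ X` and `h ∈ Y`. -/
def GEquivalent {G : Type w} [AddCommGroup G] [TopologicalSpace G] (X Y : Set G) : Prop :=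
  ∀ g ∈ X, ∀ h ∈ Y, GermEq 0 (translateBy X g) (translateBy Y h)

namespace DefinableGroup

variable {L : FirstOrder.Language.{u, v}} {M : Type w} [L.Structure M] [TopologicalSpace M]
  {G : Type w} [AddCommGroup G] [TopologicalSpace G] {n : ℕ} (D : DefinableGroup L M G n)

/-- `X` is a definable (with parameters) subset of `G`. -/
def IsDefinable (X : Set G) : Prop := (univ : Set M).Definable L (D.coord '' X)

/-- The dimension of a definable subset of `G`. -/
noncomputable def dim (X : Set G) : WithBot ℕ∞ := ominDim (D.coord '' X)

/-- `X` is a `G`-linear set. -/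
def GLinear (X : Set G) : Prop :=
  D.IsDefinable X ∧ ∀ g ∈ X, ∀ h ∈ X, GermEq 0 (translateBy X g) (translateBy X h)

/-- `Y` is a `G`-subset of the (`G`-linear) set `X`. -/
def IsGSubset (Y X : Set G) : Prop :=
  D.IsDefinable Y ∧ ∀ h ∈ Y, ∀ g ∈ X, GermLE 0 (translateBy Y h) (translateBy X g)

/-- `𝒳` exhibits the subgroup `H` of `G` as a directed union of fewer than `κ` definable sets. -/
structure IsPresentation (κ : Cardinal.{w}) (H : AddSubgroup G) (𝒳 : Set (Set G)) : Prop where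
  card_lt : #𝒳 < κ
  definable : ∀ Z ∈ 𝒳, D.IsDefinable Z
  directed : DirectedOn (· ⊆ ·) 𝒳
  sUnion_eq : ⋃₀ 𝒳 = H

/-- `H` is a locally-definable subgroup of `G` (a directed union of `< κ` definable sets). -/
def LocallyDefinable (κ : Cardinal.{w}) (H : AddSubgroup G) : Prop :=
  ∃ 𝒳 : Set (Set G), D.IsPresentation κ H 𝒳

section Infinitesimals

variable {N : Type w} [L.Structure N] (f : M ↪ₑ[L] N)

/-- `X(N)`, for a definable subset `X` of `G`, as a subset of `G(N) ⊆ Nⁿ`. -/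
def points (X : Set G) : Set (Fin n → N) := extension f (D.coord '' X)

/-- The relation `a + b = c` in the group `G(N)`. -/
def AddRel (a b c : Fin n → N) : Prop :=
  (fun p : Fin 3 × Fin n => ![a, b, c] p.1 p.2) ∈ extension f
    {t : Fin 3 × Fin n → M |
      ∃ a b : G, t = fun p => ![D.coord a, D.coord b, D.coord (a + b)] p.1 p.2}

/-- `A + B`, for subsets `A` and `B` of `G(N)`. -/
def sumSet (A B : Set (Fin n → N)) : Set (Fin n → N) :=
  {c | ∃ a ∈ A, ∃ b ∈ B, D.AddRel f a b c}

/-- `ν_g`: the intersection in `G(N)` of all `M`-definable open neighbourhoods of `g`. -/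
def infinitesimals (g : G) : Set (Fin n → N) :=
  {y | ∀ U : Set G, IsOpen U → D.IsDefinable U → g ∈ U → y ∈ D.points f U}

/-- `ν_g(X) = ν_g ∩ X(N)`, for a definable subset `X` of `G`. -/
def nuAt (g : G) (X : Set G) : Set (Fin n → N) := D.infinitesimals f g ∩ D.points f X

/-- `ν(X) = ν_x(X) - x` for some (all) `x ∈ X`, where `X` is `G`-linear: the set of all `y` in
`G(N)` with `y + x ∈ ν_x(X)`. -/
def nu (X : Set G) : Set (Fin n → N) :=
  {y | ∃ x ∈ X, ∃ z ∈ D.nuAt f x X, D.AddRel f y (f ∘ D.coord x) z}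

/-- `ν_g(H) = ν_g ∩ H(N)`, where `H` is a locally-definable group with presentation `𝒳`, so that
`H(N)` is the union of the sets `Z(N)` with `Z ∈ 𝒳`. -/
def nuFamily (g : G) (𝒳 : Set (Set G)) : Set (Fin n → N) :=
  D.infinitesimals f g ∩ ⋃ Z ∈ 𝒳, D.points f Z

end Infinitesimals

end DefinableGroup

/-! All germs are tested with definable curves. Let W be a locally closed local subgroup germ at 0
and C a definable set. Then every germ of C, translated to 0, lies in W exactly when each definable
curve γ in C satisfies γ(s) - γ(t) ∈ W for all small t > 0 and s near t (`GermIn.curvesIn`,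
`GermIn.of_curvesIn`). One direction is continuity of definable curves near 0+. The other is a
connectedness argument: if ν(t) → 0 were a curve in C - c avoiding W, the set of s with ν(s) - ν(t)
∈ W would be clopen in an interval (0, b), hence all of it, and s → 0 would give -ν(t) ∈ W.

The curve condition is stable under sums, negatives and unions: definable choice lifts a curve in X
+ Y to curves in X and in Y, whose increments add, and a curve in X ∪ Y finally stays in X or in Y.
That the germ of a G-linear set is a locally closed local subgroup (`locSubgroup_of_homogeneous`)
uses the same connectedness argument, after local closedness at some point is moved to 0 by
homogeneity.

For two different germs, the germ of X + Y is the sum of the two germs cut down to a neighbourhood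
in which definable curves converge (`LocSubgroup.exists_add`). Convergence makes this sum closed and
makes its small elements sums of small elements. The latter, with saturation of N, gives ν(X + Y) ⊆
ν(X) + ν(Y); the other inclusion is continuity of addition.

The group ⟨Y⟩ is an increasing union of iterated differences of Y, each with germs inside X. The
neighbourhood of 0 on which the n-th of them lies in X depends on n, but all come from one family
definable over finitely many parameters, so ω-saturation yields a common one
(`eventually_mem_of_mem_closure`). The bound on dimensions follows since dimension is determined
locally and respected by definable injections (`exists_interior_image_nonempty_of_germ`), and the
statements on infinitesimals follow by transfer. If M is κ-saturated, every presentation of ⟨X⟩ has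
a member containing X (`exists_subset_of_subset_sUnion`), which forces the equalities.

The o-minimal input is derived from the one-variable axiom: definable choice from the ordered group
structure, and the two properties in `Tame`, which pass from T to T × M. They yield generic
continuity, open cells in definable sets, and the absence of definable injections from open subsets
of M^k into M^m for m < k. -/

open Filter Topology

/-! ### Encoded types and a calculus of definable predicates and functions -/

/-- An encoding of the elements of `T` as tuples of elements of `M`. -/
class Enc (M : outParam (Type w)) (T : Type w) where
  ι : Type
  finite : Finite ι
  enc : T → ι → M
  injective : Function.Injective enc

attribute [instance] Enc.finite

/-- The range of the encoding of `T` is definable over `A`. -/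
class DefType (L : FirstOrder.Language.{u, v}) {M : Type w} [L.Structure M] (A : Set M)
    (T : Type w) [Enc M T] : Prop where
  definable_range : A.Definable L (range (Enc.enc : T → _ → M))

section Calculus

variable (L : FirstOrder.Language.{u, v}) {M : Type w} [L.Structure M] (A : Set M)

/-- A predicate on an encoded type is definable over `A`. -/
@[fun_prop]
def DefP {T : Type w} [Enc M T] (p : T → Prop) : Prop :=
  A.Definable L (Enc.enc '' {t | p t})

/-- A function between encoded types has a graph definable over `A`. -/
@[fun_prop]
def DefF {T S : Type w} [Enc M T] [Enc M S] [Enc M (T × S)] (f : T → S) : Prop :=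
  DefP L A fun z : T × S => f z.1 = z.2

instance Enc.self : Enc M M := ⟨Unit, inferInstance, fun x _ => x, fun _ _ h => congrFun h ()⟩

instance Enc.pi (k : ℕ) : Enc M (Fin k → M) := ⟨Fin k, inferInstance, id, Function.injective_id⟩

instance Enc.prod {T S : Type w} [Enc M T] [Enc M S] : Enc M (T × S) where
  ι := Enc.ι T ⊕ Enc.ι S
  finite := inferInstance
  enc z := Sum.elim (Enc.enc z.1) (Enc.enc z.2)
  injective := by
    rintro ⟨a, b⟩ ⟨c, d⟩ h
    have h1 : Enc.enc a = Enc.enc c := funext fun i => congrFun h (Sum.inl i)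
    have h2 : Enc.enc b = Enc.enc d := funext fun i => congrFun h (Sum.inr i)
    exact Prod.ext (Enc.injective h1) (Enc.injective h2)

variable {L} {A}
variable {T S R : Type w} [Enc M T] [Enc M S] [Enc M R]

instance DefType.self : DefType L A M where
  definable_range := by
    change A.Definable L (range fun (x : M) (_ : Unit) => x)
    convert definable_univ (L := L) (A := A) (α := Unit)
    exact eq_univ_of_forall fun x => ⟨x (), rfl⟩

instance DefType.pi (k : ℕ) : DefType L A (Fin k → M) where
  definable_range := by
    rw [show (Enc.enc : (Fin k → M) → _ → M) = id from rfl, range_id]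
    exact definable_univ

instance DefType.prod [DefType L A T] [DefType L A S] : DefType L A (T × S) where
  definable_range := by
    have h1 := (DefType.definable_range (L := L) (A := A) (T := T)).preimage_comp
      (Sum.inl : _ → Enc.ι T ⊕ Enc.ι S)
    have h2 := (DefType.definable_range (L := L) (A := A) (T := S)).preimage_comp
      (Sum.inr : _ → Enc.ι T ⊕ Enc.ι S)
    refine (congrArg (A.Definable L) (Set.ext fun x => ?_)).mp (h1.inter h2)
    rw [Iff.comm]
    constructor
    · rintro ⟨z, rfl⟩
      exact ⟨⟨z.1, rfl⟩, ⟨z.2, rfl⟩⟩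
    · rintro ⟨⟨a, ha⟩, ⟨b, hb⟩⟩
      refine ⟨(a, b), ?_⟩
      funext i
      cases i with
      | inl i => exact congrFun ha i
      | inr i => exact congrFun hb i

/-- Maps between encoded types that select coordinates. -/
def IsCoord (r : T → S) : Prop :=
  ∃ ρ : Enc.ι S → Enc.ι T, ∀ t, Enc.enc (r t) = Enc.enc t ∘ ρ

theorem IsCoord.comp {r : T → S} {s : S → R} (hs : IsCoord s) (hr : IsCoord r) :
    IsCoord fun t => s (r t) := by
  obtain ⟨ρ, hρ⟩ := hr
  obtain ⟨σ, hσ⟩ := hs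
  exact ⟨ρ ∘ σ, fun t => by rw [hσ, hρ]; rfl⟩

theorem IsCoord.fst : IsCoord (Prod.fst : T × S → T) := ⟨Sum.inl, fun _ => rfl⟩
theorem IsCoord.snd : IsCoord (Prod.snd : T × S → S) := ⟨Sum.inr, fun _ => rfl⟩
theorem IsCoord.id : IsCoord (fun t : T => t) := ⟨_root_.id, fun _ => rfl⟩

theorem IsCoord.prodMk {r : T → S} {s : T → R} (hr : IsCoord r) (hs : IsCoord s) :
    IsCoord fun t => (r t, s t) := by
  obtain ⟨ρ, hρ⟩ := hr
  obtain ⟨σ, hσ⟩ := hs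
  refine ⟨Sum.elim ρ σ, fun t => funext fun i => ?_⟩
  cases i with
  | inl i => exact congrFun (hρ t) i
  | inr i => exact congrFun (hσ t) i

theorem IsCoord.apply {k : ℕ} (i : Fin k) : IsCoord fun t : Fin k → M => t i :=
  ⟨fun _ => i, fun _ => rfl⟩

theorem IsCoord.pi {k : ℕ} {r : T → Fin k → M} (h : ∀ i, IsCoord fun t => r t i) : IsCoord r := by
  choose ρ hρ using h
  exact ⟨fun i => ρ i (), fun t => funext fun i => congrFun (hρ i t) ()⟩

theorem DefP.congr {p q : T → Prop} (hp : DefP L A p) (h : ∀ t, q t ↔ p t) : DefP L A q := by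
  rwa [show q = p from funext fun t => propext (h t)]

theorem DefP.mono {A B : Set M} {p : T → Prop} (hp : DefP L A p) (h : A ⊆ B) : DefP L B p :=
  Definable.mono hp h

/-- Reindexing pulls back definable sets of tuples; intersecting with the range of the encoding
discards the tuples that encode nothing. -/
theorem DefP.comp_coord [DefType L A T] {p : S → Prop} (hp : DefP L A p) {r : T → S}
    (hr : IsCoord r) : DefP L A fun t => p (r t) := by
  obtain ⟨ρ, hρ⟩ := hr
  have h := (Definable.preimage_comp ρ hp).inter (DefType.definable_range (L := L) (A := A) (T := T))
  unfold DefP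
  convert h using 1
  ext x
  constructor
  · rintro ⟨t, ht, rfl⟩
    exact ⟨⟨r t, ht, hρ t⟩, t, rfl⟩
  · rintro ⟨⟨s, hs, h⟩, t, rfl⟩
    refine ⟨t, ?_, rfl⟩
    have : s = r t := Enc.injective (h.trans (hρ t).symm)
    rw [mem_ofPred_eq, ← this]
    exact hs

@[fun_prop]
theorem DefP.and {p q : T → Prop} (hp : DefP L A p) (hq : DefP L A q) :
    DefP L A fun t => p t ∧ q t := by
  unfold DefP
  convert Definable.inter hp hq using 1
  rw [← image_inter Enc.injective]; rfl

@[fun_prop]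
theorem DefP.or {p q : T → Prop} (hp : DefP L A p) (hq : DefP L A q) :
    DefP L A fun t => p t ∨ q t := by
  unfold DefP
  convert Definable.union hp hq using 1
  rw [← image_union]; rfl

@[fun_prop]
theorem DefP.not [DefType L A T] {p : T → Prop} (hp : DefP L A p) : DefP L A fun t => ¬ p t := by
  unfold DefP
  convert (DefType.definable_range (L := L) (A := A) (T := T)).sdiff hp using 1
  rw [← image_univ, ← image_sdiff Enc.injective]
  congr 1
  ext t
  simp

@[fun_prop]
theorem DefP.imp [DefType L A T] {p q : T → Prop} (hp : DefP L A p) (hq : DefP L A q) :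
    DefP L A fun t => p t → q t :=
  (hp.not.or hq).congr fun _ => imp_iff_not_or

@[fun_prop]
theorem DefP.exists {p : T → S → Prop} (hp : DefP L A fun z : T × S => p z.1 z.2) :
    DefP L A fun t => ∃ s, p t s := by
  unfold DefP
  convert Definable.image_comp hp (Sum.inl : Enc.ι T → Enc.ι T ⊕ Enc.ι S) using 1
  ext x
  constructor
  · rintro ⟨t, ⟨s, hs⟩, rfl⟩
    exact ⟨_, ⟨(t, s), hs, rfl⟩, rfl⟩
  · rintro ⟨_, ⟨z, hz, rfl⟩, rfl⟩
    exact ⟨z.1, ⟨z.2, hz⟩, rfl⟩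

@[fun_prop]
theorem DefP.forall [DefType L A T] [DefType L A S] {p : T → S → Prop}
    (hp : DefP L A fun z : T × S => p z.1 z.2) : DefP L A fun t => ∀ s, p t s :=
  (DefP.exists (p := fun t s => ¬ p t s) hp.not).not.congr fun _ => by push Not; rfl

theorem DefP.finite_exists {J : Type*} [Finite J] {p : J → T → Prop} (hp : ∀ j, DefP L A (p j)) :
    DefP L A fun t => ∃ j, p j t := by
  unfold DefP
  convert definable_iUnion_of_finite hp using 1
  rw [← image_iUnion]
  congr 1
  ext t
  simp

theorem DefP.finite_forall {J : Type*} [Finite J] [DefType L A T] {p : J → T → Prop}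
    (hp : ∀ j, DefP L A (p j)) : DefP L A fun t => ∀ j, p j t :=
  (DefP.finite_exists fun j => (hp j).not).not.congr fun _ => by push Not; rfl

@[fun_prop]
theorem DefP.const [DefType L A T] (p : Prop) : DefP L A fun _ : T => p := by
  by_cases h : p
  · unfold DefP
    convert DefType.definable_range (L := L) (A := A) (T := T)
    simp [h]
  · unfold DefP
    simp [h]

theorem IsCoord.defF [DefType L A T] [DefType L A S] {r : T → S} (hr : IsCoord r) :
    DefF L A r := by
  obtain ⟨ρ, hρ⟩ := hr
  have h1 : A.Definable L {x : Enc.ι T ⊕ Enc.ι S → M | ∀ j, x (Sum.inl (ρ j)) = x (Sum.inr j)} := by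
    have : ∀ j, A.Definable L
        {x : Enc.ι T ⊕ Enc.ι S → M | x (Sum.inl (ρ j)) = x (Sum.inr j)} := fun j =>
      ⟨(Language.var (Sum.inl (ρ j))).equal (Language.var (Sum.inr j)), by ext; simp⟩
    convert definable_iInter_of_finite this using 1
    ext x
    simp
  have h2 := h1.inter (DefType.definable_range (L := L) (A := A) (T := T × S))
  unfold DefF DefP
  refine (congrArg (A.Definable L) (Set.ext fun x => ?_)).mp h2
  rw [Iff.comm]
  constructor
  · rintro ⟨z, hz, rfl⟩
    refine ⟨fun j => ?_, z, rfl⟩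
    have := congrFun (hρ z.1) j
    rw [show r z.1 = z.2 from hz] at this
    exact this.symm
  · rintro ⟨h, z, rfl⟩
    refine ⟨z, Enc.injective ?_, rfl⟩
    rw [hρ]
    exact funext h

@[fun_prop]
theorem DefF.id [DefType L A T] : DefF L A fun t : T => t := IsCoord.id.defF

@[fun_prop]
theorem DefP.comp [DefType L A T] [DefType L A S] {p : S → Prop} {f : T → S} (hp : DefP L A p)
    (hf : DefF L A f) : DefP L A fun t => p (f t) :=
  (DefP.exists (p := fun t s => f t = s ∧ p s)
    (DefP.and hf (hp.comp_coord IsCoord.snd))).congr fun t => by simp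

@[fun_prop]
theorem DefF.comp [DefType L A T] [DefType L A S] [DefType L A R] {g : S → R} {f : T → S}
    (hg : DefF L A g) (hf : DefF L A f) : DefF L A fun t => g (f t) :=
  (DefP.exists (T := T × R) (p := fun z s => f z.1 = s ∧ g s = z.2)
    (DefP.and
      (DefP.comp_coord (T := (T × R) × S) hf
        ((IsCoord.fst.comp IsCoord.fst).prodMk IsCoord.snd))
      (DefP.comp_coord (T := (T × R) × S) hg
        (IsCoord.snd.prodMk (IsCoord.snd.comp IsCoord.fst))))).congr fun t => by simp

@[fun_prop]
theorem DefF.prodMk [DefType L A T] [DefType L A S] [DefType L A R] {f : T → S} {g : T → R}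
    (hf : DefF L A f) (hg : DefF L A g) : DefF L A fun t => (f t, g t) :=
  (DefP.and
    (DefP.comp_coord (T := T × S × R) hf (IsCoord.fst.prodMk (IsCoord.fst.comp IsCoord.snd)))
    (DefP.comp_coord (T := T × S × R) hg (IsCoord.fst.prodMk (IsCoord.snd.comp IsCoord.snd)))).congr
    fun t => by simp [Prod.ext_iff]

@[fun_prop]
theorem DefF.fst [DefType L A S] [DefType L A R] [DefType L A T] {f : T → S × R}
    (hf : DefF L A f) : DefF L A fun t => (f t).1 :=
  DefF.comp IsCoord.fst.defF hf

@[fun_prop]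
theorem DefF.snd [DefType L A S] [DefType L A R] [DefType L A T] {f : T → S × R}
    (hf : DefF L A f) : DefF L A fun t => (f t).2 :=
  DefF.comp IsCoord.snd.defF hf

@[fun_prop]
theorem DefP.eq [DefType L A T] [DefType L A S] {f g : T → S} (hf : DefF L A f)
    (hg : DefF L A g) : DefP L A fun t => f t = g t :=
  (DefP.comp (p := fun z : T × S => f z.1 = z.2) hf (DefF.id.prodMk hg))

/-- The parameter set is tracked because saturation later allows only finitely many parameters. -/
theorem DefF.const_of_mem [DefType L A T] [DefType L A S] (c : S) (hc : ∀ i, Enc.enc c i ∈ A) :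
    DefF L A fun _ : T => c := by
  have h1 : DefP L A fun s : S => s = c := by
    unfold DefP
    have : ∀ i, A.Definable L {x : Enc.ι S → M | x i = Enc.enc c i} := fun i =>
      (Definable.singleton_of_mem (L := L) (hc i)).preimage_comp (fun _ : Fin 1 => i) |> fun h => by
        convert h using 1
        ext x
        simp [funext_iff]
    convert definable_iInter_of_finite this using 1
    ext x
    simp [funext_iff]
  exact (DefP.comp_coord (T := T × S) h1 IsCoord.snd).congr fun z => eq_comm

@[fun_prop]
theorem DefF.const [DefType L univ T] [DefType L univ S] (c : S) :
    DefF L (univ : Set M) fun _ : T => c :=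
  DefF.const_of_mem c fun _ => mem_univ _

@[fun_prop]
theorem DefF.proj {k : ℕ} (i : Fin k) : DefF L A fun v : Fin k → M => v i :=
  (IsCoord.apply i).defF

theorem DefF.apply [DefType L A T] {k : ℕ} {f : T → Fin k → M} (hf : DefF L A f) (i : Fin k) :
    DefF L A fun t => f t i :=
  DefF.comp (IsCoord.apply i).defF hf

theorem DefF.pi [DefType L A T] {k : ℕ} {f : T → Fin k → M} (hf : ∀ i, DefF L A fun t => f t i) :
    DefF L A f :=
  (DefP.finite_forall (p := fun i (z : T × (Fin k → M)) => f z.1 i = z.2 i) fun i =>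
    DefP.eq ((hf i).comp IsCoord.fst.defF) ((DefF.id.snd).apply i)).congr fun z => funext_iff

end Calculus

/-! ### Definable addition and case distinctions -/

section Additive

variable {L : FirstOrder.Language.{u, v}} {M : Type w} [L.Structure M] {A : Set M}
variable {T S : Type w} [Enc M T] [Enc M S] [DefType L A T] [DefType L A S]

/-- Addition on the encoded type `S` is definable over `A`. -/
class DefAdd (L : FirstOrder.Language.{u, v}) {M : Type w} [L.Structure M] (A : Set M)
    (S : Type w) [Enc M S] [Add S] : Prop where
  defF_add : DefF L A fun z : S × S => z.1 + z.2

@[fun_prop]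
theorem DefF.add [Add S] [DefAdd L A S] {f g : T → S} (hf : DefF L A f) (hg : DefF L A g) :
    DefF L A fun t => f t + g t :=
  DefF.comp (S := S × S) DefAdd.defF_add (hf.prodMk hg)

@[fun_prop]
theorem DefF.zero [AddGroup S] [DefAdd L A S] : DefF L A fun _ : T => (0 : S) := by
  -- Zero is the only solution of s + s = s, so it needs no parameter.
  have h : DefP L A fun z : T × S => z.2 + z.2 = z.2 := by fun_prop
  exact h.congr fun z => by simp [eq_comm]

@[fun_prop]
theorem DefF.neg [AddGroup S] [DefAdd L A S] {f : T → S} (hf : DefF L A f) :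
    DefF L A fun t => - f t := by
  have h : DefP L A fun z : T × S => f z.1 + z.2 = 0 := by fun_prop
  exact h.congr fun z => by rw [neg_eq_iff_add_eq_zero]

@[fun_prop]
theorem DefF.sub [AddGroup S] [DefAdd L A S] {f g : T → S} (hf : DefF L A f) (hg : DefF L A g) :
    DefF L A fun t => f t - g t := by
  simp only [sub_eq_add_neg]
  fun_prop

@[fun_prop]
theorem DefF.ite {c : T → Prop} [∀ t, Decidable (c t)] {f g : T → S} (hc : DefP L A c) (hf : DefF L A f)
    (hg : DefF L A g) : DefF L A fun t => if c t then f t else g t := by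
  have h : DefP L A fun z : T × S => (c z.1 ∧ f z.1 = z.2) ∨ (¬ c z.1 ∧ g z.1 = z.2) := by
    fun_prop
  refine h.congr fun z => ?_
  by_cases hz : c z.1 <;> simp [hz]

end Additive

/-! ### One-variable consequences of o-minimality -/

section OMinimal

variable {L : FirstOrder.Language.{u, v}} {M : Type w} [L.Structure M]
  [AddCommGroup M] [LinearOrder M] [hM : Fact (OMinimalGroupExpansion L M)] {A : Set M}
variable {T S : Type w} [Enc M T] [Enc M S]

instance DefAdd.self : DefAdd L A M where
  defF_add := by
    have h := (hM.out.definable_add.mono (empty_subset A)).preimage_comp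
      (![Sum.inl (Sum.inl ()), Sum.inl (Sum.inr ()), Sum.inr ()] : Fin 3 → (Unit ⊕ Unit) ⊕ Unit)
    unfold DefF DefP
    refine (congrArg (A.Definable L) (Set.ext fun x => ?_)).mp h
    constructor
    · intro hx
      refine ⟨((x (Sum.inl (Sum.inl ())), x (Sum.inl (Sum.inr ()))), x (Sum.inr ())), hx, ?_⟩
      funext i
      rcases i with (i | i) | i <;> rfl
    · rintro ⟨z, hz, rfl⟩
      exact hz

theorem defP_lt : DefP L A fun z : M × M => z.1 < z.2 := by
  have h := (hM.out.definable_lt.mono (empty_subset A)).preimage_comp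
    (![Sum.inl (), Sum.inr ()] : Fin 2 → Unit ⊕ Unit)
  unfold DefP
  refine (congrArg (A.Definable L) (Set.ext fun x => ?_)).mp h
  constructor
  · intro hx
    refine ⟨(x (Sum.inl ()), x (Sum.inr ())), hx, ?_⟩
    funext i
    rcases i with i | i <;> rfl
  · rintro ⟨z, hz, rfl⟩
    exact hz

variable [DefType L A T] [DefType L A S]

@[fun_prop]
theorem DefP.lt {f g : T → M} (hf : DefF L A f) (hg : DefF L A g) : DefP L A fun t => f t < g t :=
  DefP.comp (p := fun z : M × M => z.1 < z.2) defP_lt (hf.prodMk hg)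

@[fun_prop]
theorem DefP.le {f g : T → M} (hf : DefF L A f) (hg : DefF L A g) : DefP L A fun t => f t ≤ g t :=
  (DefP.not (DefP.lt hg hf)).congr fun _ => not_lt.symm

/-- Definable subsets of the line are finite unions of pieces of five kinds, so a property stable
under binary unions only has to be checked on the pieces and on the empty union. -/
theorem ominimal_induction {P : Set M → Prop} (empty : P ∅)
    (union : ∀ X Y, P X → P Y → P (X ∪ Y)) (singleton : ∀ a, P {a}) (ioo : ∀ a b, P (Ioo a b))
    (iio : ∀ a, P (Iio a)) (ioi : ∀ a, P (Ioi a)) (univ' : P univ) {p : M → Prop}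
    (hp : DefP L univ p) : P {x | p x} := by
  obtain ⟨F, hF, hS, hI⟩ := hM.out.ominimal {x | p x} (by
    have := Definable.preimage_comp (fun _ : Unit => (0 : Fin 1)) hp
    refine (congrArg (univ.Definable L) (Set.ext fun x => ?_)).mp this
    constructor
    · rintro ⟨t, ht, h⟩
      have : t = x 0 := congrFun h ()
      simpa [← this] using ht
    · intro h
      exact ⟨x 0, h, rfl⟩)
  rw [hS]
  have key : ∀ F : Set (Set M), F.Finite → (∀ I ∈ F, P I) → P (⋃₀ F) := by
    intro F hF
    induction F, hF using Set.Finite.induction_on with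
    | empty => exact fun _ => by simpa using empty
    | @insert I F _ _ ih =>
      intro h
      rw [sUnion_insert]
      exact union _ _ (h _ (mem_insert _ _)) (ih fun J hJ => h _ (mem_insert_of_mem _ hJ))
  refine key F hF fun I hIF => ?_
  rcases hI I hIF with ⟨a, rfl⟩ | ⟨a, b, rfl⟩ | ⟨a, rfl⟩ | ⟨a, rfl⟩ | rfl
  exacts [singleton a, ioo a b, iio a, ioi a, univ']

theorem eventually_atTop_or {p : M → Prop} [Nonempty M] (hp : DefP L univ p) :
    (∃ b, ∀ x, b < x → p x) ∨ (∃ b, ∀ x, b < x → ¬ p x) := by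
  refine ominimal_induction (L := L)
    (P := fun X => (∃ b, ∀ x, b < x → x ∈ X) ∨ (∃ b, ∀ x, b < x → x ∉ X))
    ?_ ?_ ?_ ?_ ?_ ?_ ?_ hp
  · exact Or.inr ⟨Classical.arbitrary M, fun x _ => id⟩
  · rintro X Y (⟨b, hb⟩ | ⟨b, hb⟩) h
    · exact Or.inl ⟨b, fun x hx => Or.inl (hb x hx)⟩
    · rcases h with ⟨c, hc⟩ | ⟨c, hc⟩
      · exact Or.inl ⟨c, fun x hx => Or.inr (hc x hx)⟩
      · refine Or.inr ⟨max b c, fun x hx => ?_⟩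
        rw [max_lt_iff] at hx
        rintro (h | h)
        exacts [hb x hx.1 h, hc x hx.2 h]
  · exact fun a => Or.inr ⟨a, fun x hx h => hx.ne' h⟩
  · exact fun a b => Or.inr ⟨b, fun x hx h => lt_asymm h.2 hx⟩
  · exact fun b => Or.inr ⟨b, fun x hx h => lt_asymm h hx⟩
  · exact fun b => Or.inl ⟨b, fun x hx => hx⟩
  · exact Or.inl ⟨Classical.arbitrary M, fun x _ => trivial⟩

/-- A convex set that meets every interval to the right of `a` contains such an interval, and the
alternative passes to unions. -/
theorem eventually_right_or [NoMaxOrder M] {p : M → Prop} (hp : DefP L univ p) (a : M) :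
    (∃ b, a < b ∧ ∀ x, a < x → x < b → p x) ∨ (∃ b, a < b ∧ ∀ x, a < x → x < b → ¬ p x) := by
  have conn : ∀ X : Set M, X.OrdConnected →
      (∃ b, a < b ∧ ∀ x, a < x → x < b → x ∈ X) ∨ (∃ b, a < b ∧ ∀ x, a < x → x < b → x ∉ X) := by
    intro X hX
    by_cases h : ∃ b, a < b ∧ ∀ x, a < x → x < b → x ∉ X
    · exact Or.inr h
    · push Not at h
      obtain ⟨c, hc⟩ := exists_gt a
      obtain ⟨b, hab, _, hb⟩ := h c hc
      refine Or.inl ⟨b, hab, fun x hax hxb => ?_⟩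
      obtain ⟨d, _, hdx, hd⟩ := h x hax
      exact hX.out hd hb ⟨hdx.le, hxb.le⟩
  refine ominimal_induction (L := L) (P := fun X =>
      (∃ b, a < b ∧ ∀ x, a < x → x < b → x ∈ X) ∨ (∃ b, a < b ∧ ∀ x, a < x → x < b → x ∉ X))
    (conn _ ordConnected_empty) ?_ (fun a => conn _ ordConnected_singleton)
    (fun a b => conn _ ordConnected_Ioo) (fun a => conn _ ordConnected_Iio)
    (fun a => conn _ ordConnected_Ioi) (conn _ ordConnected_univ) hp
  rintro X Y (⟨b, hab, hb⟩ | ⟨b, hab, hb⟩) h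
  · exact Or.inl ⟨b, hab, fun x hx hx' => Or.inl (hb x hx hx')⟩
  · rcases h with ⟨c, hac, hc⟩ | ⟨c, hac, hc⟩
    · exact Or.inl ⟨c, hac, fun x hx hx' => Or.inr (hc x hx hx')⟩
    · refine Or.inr ⟨min b c, lt_min hab hac, fun x hx hx' => ?_⟩
      rw [lt_min_iff] at hx'
      rintro (h | h)
      exacts [hb x hx hx'.1 h, hc x hx hx'.2 h]

variable [IsOrderedAddMonoid M] [Nontrivial M]

-- The doubles form a definable unbounded set, which by o-minimality contains all large elements.
-- For large y both x + 2y and 2y are doubles, hence so is their difference.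
variable (L) in
include hM in
theorem exists_half (x : M) : ∃ y, y + y = x := by
  have hp : DefP L univ fun x : M => ∃ y, y + y = x := by fun_prop
  obtain ⟨c, hc⟩ := exists_gt (0 : M)
  have big : ∀ b : M, ∃ y, b < y + y := by
    intro b
    refine ⟨max b c, ?_⟩
    have h1 : b ≤ max b c := le_max_left _ _
    have h2 : 0 < max b c := hc.trans_le (le_max_right _ _)
    exact lt_of_le_of_lt h1 (lt_add_of_pos_left _ h2)
  rcases eventually_atTop_or hp with ⟨b, hb⟩ | ⟨b, hb⟩
  · obtain ⟨y, hy⟩ := big (b - x)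
    obtain ⟨z, hz⟩ := hb (x + (y + y)) (sub_lt_iff_lt_add'.mp hy)
    refine ⟨z - y, ?_⟩
    rw [sub_add_sub_comm, hz, add_sub_cancel_right]
  · obtain ⟨y, hy⟩ := big b
    exact absurd ⟨y, rfl⟩ (hb _ hy)

variable (L) in
include hM in
theorem denselyOrdered_of_ominimal : DenselyOrdered M where
  dense a b hab := by
    obtain ⟨y, hy⟩ := exists_half L (b - a)
    have hpos : 0 < y := by
      by_contra h
      push Not at h
      have : y + y ≤ 0 := add_nonpos h h
      rw [hy] at this
      exact absurd hab (not_lt.mpr (sub_nonpos.mp this))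
    refine ⟨a + y, lt_add_of_pos_right _ hpos, ?_⟩
    have : a + y < a + y + y := lt_add_of_pos_right _ hpos
    rwa [add_assoc, hy, add_sub_cancel] at this

variable [DenselyOrdered M]

theorem exists_isLUB_of_defP {p : M → Prop} (hp : DefP L univ p) (hne : ∃ x, p x)
    (hb : BddAbove {x | p x}) : ∃ s, IsLUB {x | p x} s := by
  have : ¬ BddAbove (univ : Set M) := not_bddAbove_univ
  have h : ∀ X : Set M, (X = ∅ ∨ ¬ BddAbove X ∨ ∃ s, IsLUB X s) ↔
      (X.Nonempty → BddAbove X → ∃ s, IsLUB X s) := by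
    intro X
    rw [← not_nonempty_iff_eq_empty]
    tauto
  have key := ominimal_induction (L := L) (P := fun X => X = ∅ ∨ ¬ BddAbove X ∨ ∃ s, IsLUB X s)
    (Or.inl rfl) ?_ (fun a => Or.inr (Or.inr ⟨a, isLUB_singleton⟩)) ?_
    (fun a => Or.inr (Or.inr ⟨a, isLUB_Iio⟩)) (fun a => Or.inr (Or.inl (not_bddAbove_Ioi a)))
    (Or.inr (Or.inl this)) hp
  · exact (h _).mp key hne hb
  · rintro X Y (rfl | hX | ⟨s, hs⟩) (rfl | hY | ⟨t, ht⟩)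
    · simp
    · simp [hY]
    · exact Or.inr (Or.inr ⟨t, by simpa using ht⟩)
    · simp [hX]
    · simp [hX, bddAbove_union]
    · simp [hX, bddAbove_union]
    · exact Or.inr (Or.inr ⟨s, by simpa using hs⟩)
    · simp [hY, bddAbove_union]
    · exact Or.inr (Or.inr ⟨_, hs.union ht⟩)
  · intro a b
    rcases lt_or_ge a b with h | h
    · exact Or.inr (Or.inr ⟨b, isLUB_Ioo h⟩)
    · exact Or.inl (Ioo_eq_empty (not_lt.mpr h))

/-- The infimum is the supremum of the lower bounds, which form a definable set. -/
theorem exists_isGLB_of_defP {p : M → Prop} (hp : DefP L univ p) (hne : ∃ x, p x)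
    (hb : BddBelow {x | p x}) : ∃ s, IsGLB {x | p x} s := by
  have hq : DefP L univ fun x : M => ∀ y, p y → x ≤ y := by fun_prop
  obtain ⟨x, hx⟩ := hne
  obtain ⟨b, hb⟩ := hb
  obtain ⟨s, hs⟩ := exists_isLUB_of_defP hq ⟨b, fun y hy => hb hy⟩ ⟨x, fun y hy => hy x hx⟩
  exact ⟨s, fun y hy => hs.2 fun z hz => hz y hy, fun z hz => hs.1 fun y hy => hz hy⟩

theorem finite_or_exists_Ioo_subset {p : M → Prop} (hp : DefP L univ p) :
    {x | p x}.Finite ∨ ∃ a b, a < b ∧ ∀ x, a < x → x < b → p x := by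
  refine ominimal_induction (L := L)
    (P := fun X => X.Finite ∨ ∃ a b, a < b ∧ ∀ x, a < x → x < b → x ∈ X) (Or.inl finite_empty)
    ?_ (fun a => Or.inl (finite_singleton a)) ?_ ?_ ?_ ?_ hp
  · rintro X Y (hX | ⟨a, b, hab, h⟩) (hY | ⟨c, d, hcd, h'⟩)
    · exact Or.inl (hX.union hY)
    · exact Or.inr ⟨c, d, hcd, fun x hx hx' => Or.inr (h' x hx hx')⟩
    · exact Or.inr ⟨a, b, hab, fun x hx hx' => Or.inl (h x hx hx')⟩
    · exact Or.inr ⟨a, b, hab, fun x hx hx' => Or.inl (h x hx hx')⟩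
  · intro a b
    rcases lt_or_ge a b with h | h
    · exact Or.inr ⟨a, b, h, fun x hx hx' => ⟨hx, hx'⟩⟩
    · exact Or.inl (by rw [Ioo_eq_empty (not_lt.mpr h)]; exact finite_empty)
  · intro b
    obtain ⟨a, ha⟩ := exists_lt b
    exact Or.inr ⟨a, b, ha, fun x _ hx => hx⟩
  · intro a
    obtain ⟨b, hb⟩ := exists_gt a
    exact Or.inr ⟨a, b, hb, fun x hx _ => hx⟩
  · obtain ⟨a, ha⟩ := exists_gt (0 : M)
    exact Or.inr ⟨0, a, ha, fun x _ _ => trivial⟩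

theorem exists_Ioo_subset_of_infinite {p : M → Prop} (hp : DefP L univ p)
    (h : {x | p x}.Infinite) : ∃ a b, a < b ∧ ∀ x, a < x → x < b → p x :=
  (finite_or_exists_Ioo_subset hp).resolve_left h

theorem infinite_of_Ioo_subset {p : M → Prop} {a b : M} (hab : a < b)
    (h : ∀ x, a < x → x < b → p x) : {x | p x}.Infinite :=
  (Ioo_infinite hab).mono fun x hx => h x hx.1 hx.2

/-- Infinity of the fibres is a definable condition. -/
@[fun_prop]
theorem DefP.infinite [DefType L univ T] {p : T → M → Prop}
    (hp : DefP L univ fun z : T × M => p z.1 z.2) :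
    DefP L univ fun t => {x | p t x}.Infinite := by
  have h : DefP L univ fun t => ∃ a b, a < b ∧ ∀ x, a < x → x < b → p t x := by fun_prop
  refine h.congr fun t => ⟨fun h => exists_Ioo_subset_of_infinite (L := L) ?_ h, ?_⟩
  · exact DefP.comp (p := fun z : T × M => p z.1 z.2) hp (f := fun x : M => (t, x)) (by fun_prop)
  · rintro ⟨a, b, hab, h⟩
    exact infinite_of_Ioo_subset hab h

end OMinimal

/-! ### Definable choice -/

section Choice

variable {L : FirstOrder.Language.{u, v}} {M : Type w} [L.Structure M]
variable {T S : Type w} [Enc M T] [Enc M S] [DefType L univ T] [DefType L univ S]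

-- Uniqueness makes the value definable by a formula; the default value where it fails makes the
-- function total.
open Classical in
theorem exists_defF_of_existsUnique [Nonempty S] {p : T → S → Prop}
    (hp : DefP L univ fun z : T × S => p z.1 z.2) :
    ∃ f : T → S, DefF L univ f ∧ ∀ t, (∃! s, p t s) → p t (f t) := by
  obtain ⟨s₀⟩ := ‹Nonempty S›
  refine ⟨fun t => if h : ∃! s, p t s then h.choose else s₀, ?_, fun t ht => ?_⟩
  · have h : DefP L univ fun z : T × S =>
        ((∃ s, p z.1 s ∧ ∀ s', p z.1 s' → s' = s) ∧ p z.1 z.2) ∨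
        (¬ (∃ s, p z.1 s ∧ ∀ s', p z.1 s' → s' = s) ∧ z.2 = s₀) := by fun_prop
    refine h.congr fun z => ?_
    change _ ↔ ((∃! s, p z.1 s) ∧ p z.1 z.2) ∨ (¬ (∃! s, p z.1 s) ∧ z.2 = s₀)
    by_cases hz : ∃! s, p z.1 s
    · simp only [hz, dite_true, true_and, not_true, false_and, or_false]
      constructor
      · intro h
        rw [← h]
        exact hz.choose_spec.1
      · intro h
        exact hz.unique hz.choose_spec.1 h
    · simp only [hz, dite_false, false_and, not_false_eq_true, true_and, false_or]
      exact eq_comm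
  · simp only [ht, dite_true]
    exact ht.choose_spec.1

variable [AddCommGroup M] [LinearOrder M] [hM : Fact (OMinimalGroupExpansion L M)]
  [IsOrderedAddMonoid M] [Nontrivial M]

/-- After folding the line at 0 the fibre is bounded below. Its infimum is chosen if it belongs to
the fibre; otherwise the fibre contains an interval starting at the infimum, and a midpoint is
chosen. -/
theorem exists_defF_choice_self {p : T → M → Prop}
    (hp : DefP L univ fun z : T × M => p z.1 z.2) :
    ∃ f : T → M, DefF L univ f ∧ ∀ t, (∃ s, p t s) → p t (f t) := by
  classical
  have := denselyOrdered_of_ominimal L (M := M)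
  obtain ⟨e, he⟩ := exists_gt (0 : M)
  let q : T → M → Prop := fun t x => 0 ≤ x ∧ (p t x ∨ p t (-x))
  have hq : DefP L univ fun z : T × M => q z.1 z.2 := by
    have : DefP L univ fun z : T × M => p z.1 (-z.2) :=
      DefP.comp (p := fun z : T × M => p z.1 z.2) hp (f := fun z : T × M => (z.1, -z.2))
        (by fun_prop)
    fun_prop
  have hqt : ∀ t, DefP L univ fun x => q t x := fun t =>
    DefP.comp (p := fun z : T × M => q z.1 z.2) hq (f := fun x : M => (t, x)) (by fun_prop)
  obtain ⟨a, ha, ha'⟩ := exists_defF_of_existsUnique (L := L) (T := T) (S := M)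
    (p := fun t x => (∀ y, q t y → x ≤ y) ∧ ∀ z, (∀ y, q t y → z ≤ y) → z ≤ x) (by fun_prop)
  -- The bound `e` ensures that the admissible lengths have a supremum even if the fibre is
  -- unbounded.
  let r : T → M → Prop := fun t h => 0 < h ∧ h ≤ e ∧ ∀ x, a t < x → x < a t + h → q t x
  have hr : DefP L univ fun z : T × M => r z.1 z.2 := by
    have : DefP L univ fun z : (T × M) × M => q z.1.1 z.2 :=
      DefP.comp (p := fun z : T × M => q z.1 z.2) hq (f := fun z : (T × M) × M => (z.1.1, z.2))
        (by fun_prop)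
    fun_prop
  have hrt : ∀ t, DefP L univ fun x => r t x := fun t =>
    DefP.comp (p := fun z : T × M => r z.1 z.2) hr (f := fun x : M => (t, x)) (by fun_prop)
  -- The point a + h/2, with h the supremum of the admissible lengths, characterized by its double.
  obtain ⟨x, hx, hx'⟩ := exists_defF_of_existsUnique (L := L) (T := T) (S := M)
    (p := fun t x => ∃ h, ((∀ y, r t y → y ≤ h) ∧ ∀ z, (∀ y, r t y → y ≤ z) → h ≤ z) ∧
      x + x = a t + a t + h) (by fun_prop)
  let g : T → M := fun t => if q t (a t) then a t else x t
  have hg : DefF L univ g := by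
    have : DefP L univ fun t => q t (a t) :=
      DefP.comp (p := fun z : T × M => q z.1 z.2) hq (f := fun t => (t, a t)) (by fun_prop)
    exact DefF.ite this ha hx
  have hgq : ∀ t, (∃ s, p t s) → q t (g t) := by
    rintro t ⟨s, hs⟩
    have hne : ∃ y, q t y := by
      rcases le_total 0 s with h | h
      · exact ⟨s, h, Or.inl hs⟩
      · exact ⟨-s, neg_nonneg.mpr h, Or.inr (by simpa using hs)⟩
    have hglb : IsGLB {y | q t y} (a t) := by
      obtain ⟨b, hb⟩ := exists_isGLB_of_defP (hqt t) hne ⟨0, fun y hy => hy.1⟩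
      have := ha' t ⟨b, ⟨fun y hy => hb.1 hy, fun z hz => hb.2 fun y hy => hz y hy⟩, fun c hc =>
        IsGLB.unique ⟨fun y hy => hc.1 y hy, fun z hz => hc.2 z fun y hy => hz hy⟩ hb⟩
      exact ⟨fun y hy => this.1 y hy, fun z hz => this.2 z fun y hy => hz hy⟩
    by_cases hat : q t (a t)
    · simpa [g, hat] using hat
    · simp only [g, hat, if_false]
      have hrne : ∃ h, r t h := by
        rcases eventually_right_or (hqt t) (a t) with ⟨b, hb, hb'⟩ | ⟨b, hb, hb'⟩
        · refine ⟨min (b - a t) e, lt_min (sub_pos.mpr hb) he, min_le_right _ _, fun y hy hy' => ?_⟩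
          refine hb' y hy (hy'.trans_le ?_)
          rw [← le_sub_iff_add_le']
          exact min_le_left _ _
        · exfalso
          obtain ⟨y, hy, hyb⟩ := (isGLB_lt_iff hglb).mp hb
          rcases (hglb.1 hy).lt_or_eq with h | h
          · exact hb' y h hyb hy
          · exact hat (h ▸ hy)
      obtain ⟨h, hh⟩ := exists_isLUB_of_defP (hrt t) hrne ⟨e, fun y hy => hy.2.1⟩
      obtain ⟨k, hk⟩ := exists_half L h
      have hx2 : ∀ y : M, y + y = a t + a t + h → y = a t + k := by
        intro y hy
        have h1 : (y - (a t + k)) + (y - (a t + k)) = 0 := by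
          rw [sub_add_sub_comm, hy, ← hk]; abel
        by_contra hne
        rcases lt_or_gt_of_ne (sub_ne_zero.mpr hne) with h2 | h2
        · exact (add_neg h2 h2).ne h1
        · exact (add_pos h2 h2).ne' h1
      have hxt : x t = a t + k := by
        obtain ⟨h', hh', hxx⟩ := hx' t ⟨a t + k, ⟨h, ⟨fun y hy => hh.1 hy,
            fun z hz => hh.2 fun y hy => hz y hy⟩, by rw [← hk]; abel⟩, fun y hy => by
          obtain ⟨h', hh', hyy⟩ := hy
          have : h' = h := IsLUB.unique ⟨fun y hy => hh'.1 y hy, fun z hz =>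
            hh'.2 z fun y hy => hz hy⟩ hh
          exact hx2 y (this ▸ hyy)⟩
        have : h' = h := IsLUB.unique ⟨fun y hy => hh'.1 y hy, fun z hz =>
            hh'.2 z fun y hy => hz hy⟩ hh
        exact hx2 _ (this ▸ hxx)
      obtain ⟨h1, hh1⟩ := hrne
      have hpos : 0 < h := hh1.1.trans_le (hh.1 hh1)
      have hk0 : 0 < k := by
        by_contra hk0
        rw [not_lt] at hk0
        exact absurd (hk ▸ add_nonpos hk0 hk0) (not_le.mpr hpos)
      obtain ⟨h2, hh2, hlt⟩ := (lt_isLUB_iff hh).mp (show k < h by rw [← hk]; exact lt_add_of_pos_left _ hk0)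
      rw [hxt]
      exact hh2.2.2 _ (lt_add_of_pos_right _ hk0) (add_lt_add_right hlt _)
  -- This undoes the folding at 0.
  refine ⟨fun t => if p t (g t) then g t else - g t, ?_, fun t ht => ?_⟩
  · have : DefP L univ fun t => p t (g t) :=
      DefP.comp (p := fun z : T × M => p z.1 z.2) hp (f := fun t => (t, g t)) (by fun_prop)
    fun_prop
  · have := (hgq t ht).2
    by_cases h : p t (g t)
    · simpa [h] using h
    · simpa [h] using this.resolve_left h

theorem exists_defF_choice_pi (k : ℕ) {p : T → (Fin k → M) → Prop}
    (hp : DefP L univ fun z : T × (Fin k → M) => p z.1 z.2) :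
    ∃ f : T → Fin k → M, DefF L univ f ∧ ∀ t, (∃ s, p t s) → p t (f t) := by
  induction k generalizing T with
  | zero =>
    refine ⟨fun _ => Fin.elim0, DefF.const _, fun t ⟨s, hs⟩ => ?_⟩
    rwa [Subsingleton.elim s Fin.elim0] at hs
  | succ k ih =>
    have hc : DefF L univ fun z : (T × M) × (Fin k → M) => (Fin.cons z.1.2 z.2 : Fin (k + 1) → M) := by
      refine DefF.pi fun i => ?_
      refine Fin.cases ?_ (fun i => ?_) i
      · simp only [Fin.cons_zero]; fun_prop
      · simp only [Fin.cons_succ]; fun_prop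
    have hp' : DefP L univ fun z : (T × M) × (Fin k → M) => p z.1.1 (Fin.cons z.1.2 z.2) :=
      DefP.comp (p := fun z : T × (Fin (k + 1) → M) => p z.1 z.2) hp
        (f := fun z : (T × M) × (Fin k → M) => (z.1.1, (Fin.cons z.1.2 z.2 : Fin (k + 1) → M)))
        (by fun_prop)
    obtain ⟨g, hg, hgp⟩ := exists_defF_choice_self (L := L) (T := T)
      (p := fun t x => ∃ y : Fin k → M, p t (Fin.cons x y)) hp'.exists
    obtain ⟨h, hh, hhp⟩ := ih (T := T) (p := fun t y => p t (Fin.cons (g t) y))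
      (DefP.comp (p := fun z : (T × M) × (Fin k → M) => p z.1.1 (Fin.cons z.1.2 z.2)) hp'
        (f := fun z : T × (Fin k → M) => ((z.1, g z.1), z.2)) (by fun_prop))
    refine ⟨fun t => Fin.cons (g t) (h t), ?_, fun t ⟨s, hs⟩ => ?_⟩
    · exact DefF.comp (S := (T × M) × (Fin k → M)) hc (f := fun t => ((t, g t), h t)) (by fun_prop)
    · exact hhp t (hgp t ⟨s 0, Fin.tail s, by rwa [Fin.cons_self_tail]⟩)

/-- Definable choice. -/
theorem exists_defF_choice [Nonempty S] {p : T → S → Prop}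
    (hp : DefP L univ fun z : T × S => p z.1 z.2) :
    ∃ f : T → S, DefF L univ f ∧ ∀ t, (∃ s, p t s) → p t (f t) := by
  obtain ⟨k, ⟨e⟩⟩ := Finite.exists_equiv_fin (Enc.ι S)
  let r : S → Fin k → M := fun s => Enc.enc s ∘ e.symm
  have hr : DefF L univ r := IsCoord.defF ⟨e.symm, fun s => rfl⟩
  have hinj : Function.Injective r := fun s s' h => Enc.injective (funext fun i => by
    simpa [r] using congrFun h (e i))
  have h1 : DefP L univ fun z : T × (Fin k → M) => ∃ s, p z.1 s ∧ r s = z.2 := by fun_prop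
  obtain ⟨v, hv, hvp⟩ := exists_defF_choice_pi k (p := fun t v => ∃ s, p t s ∧ r s = v) h1
  -- The chosen tuple encodes exactly one element of `S`, so decoding it is definable.
  obtain ⟨f, hf, hfp⟩ := exists_defF_of_existsUnique (L := L) (T := T) (S := S)
    (p := fun t s => p t s ∧ r s = v t) (by fun_prop)
  refine ⟨f, hf, fun t ⟨s, hs⟩ => ?_⟩
  obtain ⟨s', hs', h⟩ := hvp t ⟨_, s, hs, rfl⟩
  exact (hfp t ⟨s', ⟨hs', h⟩, fun s'' h' => hinj (h'.2.trans h.symm)⟩).1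

end Choice

/-! ### Definable topology, one-sided limits and fibres in the plane -/

/-- The topology of the encoded type `T` has a uniformly definable basis. -/
class DefTop (L : FirstOrder.Language.{u, v}) {M : Type w} [L.Structure M] (T : Type w) [Enc M T]
    [TopologicalSpace T] : Prop where
  exists_basis : ∃ (E : Type w) (_ : Enc M E) (_ : DefType L univ E) (B : E → T → Prop),
    (DefP L univ fun z : E × T => B z.1 z.2) ∧ (∀ e, IsOpen {t | B e t}) ∧
      ∀ x, ∀ U ∈ 𝓝 x, ∃ e, B e x ∧ ∀ y, B e y → y ∈ U

section Topological

variable {L : FirstOrder.Language.{u, v}} {M : Type w} [L.Structure M]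
variable {T S : Type w} [Enc M T] [Enc M S] [DefType L univ T] [DefType L univ S]

-- A quantifier over neighbourhoods becomes a quantifier over the indices of a basis, which range
-- over an encoded type.
@[fun_prop]
theorem DefP.eventually_nhds [TopologicalSpace S] [DefTop L S] {f : T → S} (hf : DefF L univ f)
    {p : T → S → Prop} (hp : DefP L univ fun z : T × S => p z.1 z.2) :
    DefP L univ fun t => ∀ᶠ y in 𝓝 (f t), p t y := by
  obtain ⟨E, _, _, B, hB, hBo, hBb⟩ := ‹DefTop L S›.exists_basis
  have : DefP L univ fun t => ∃ e, B e (f t) ∧ ∀ y, B e y → p t y := by fun_prop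
  refine this.congr fun t => ⟨fun h => hBb _ _ h, ?_⟩
  rintro ⟨e, he, h⟩
  exact mem_of_superset ((hBo e).mem_nhds he) fun y hy => h y hy

variable [AddCommGroup M] [LinearOrder M] [hM : Fact (OMinimalGroupExpansion L M)]
  [IsOrderedAddMonoid M] [Nontrivial M] [DenselyOrdered M] [TopologicalSpace M] [OrderTopology M]

-- Finitely many positive widths have a positive lower bound, so one half-width serves all
-- coordinates.
omit [DenselyOrdered M] in
theorem mem_nhds_iff_exists_box {d : ℕ} {x : Fin d → M} {U : Set (Fin d → M)} :
    U ∈ 𝓝 x ↔ ∃ t, 0 < t ∧ ∀ y : Fin d → M, (∀ j, x j - t < y j ∧ y j < x j + t) → y ∈ U := by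
  have h := hasBasis_pi_same_index (f := fun j : Fin d => 𝓝 (x j)) (p := fun t : M => 0 < t)
    (s := fun j t => Ioo (x j - t) (x j + t)) (fun j => nhds_basis_Ioo_pos (x j)) (by
      intro I k hI hk
      obtain ⟨e, he⟩ := exists_gt (0 : M)
      have : ∀ J : Finset (Fin d), (∀ i ∈ J, 0 < k i) → ∃ k₀, 0 < k₀ ∧ ∀ i ∈ J, k₀ ≤ k i := by
        intro J
        induction J using Finset.induction_on with
        | empty => exact fun _ => ⟨e, he, by simp⟩
        | insert a J _ ih =>
          intro hJ
          obtain ⟨k₀, h0, h1⟩ := ih fun i hi => hJ i (Finset.mem_insert_of_mem hi)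
          refine ⟨min k₀ (k a), lt_min h0 (hJ a (Finset.mem_insert_self _ _)), fun i hi => ?_⟩
          rcases Finset.mem_insert.mp hi with rfl | hi
          · exact min_le_right _ _
          · exact (min_le_left _ _).trans (h1 i hi)
      obtain ⟨k₀, h0, h1⟩ := this hI.toFinset (by simpa using hk)
      refine ⟨k₀, h0, fun i hi => Ioo_subset_Ioo (sub_le_sub_left ?_ _) (add_le_add_right ?_ _)⟩ <;>
      exact h1 i (by simpa using hi))
  rw [nhds_pi, h.mem_iff]
  constructor
  · rintro ⟨⟨I, t⟩, ⟨-, ht⟩, hI⟩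
    exact ⟨t, ht, fun y hy => hI fun j _ => hy j⟩
  · rintro ⟨t, ht, h⟩
    exact ⟨⟨univ, t⟩, ⟨finite_univ, ht⟩, fun y hy => h y fun j => hy j (mem_univ _)⟩

omit [DenselyOrdered M] in
theorem isOpen_box {d : ℕ} (x : Fin d → M) (t : M) :
    IsOpen {y : Fin d → M | ∀ j, x j - t < y j ∧ y j < x j + t} := by
  have : {y : Fin d → M | ∀ j, x j - t < y j ∧ y j < x j + t} =
      univ.pi fun j => Ioo (x j - t) (x j + t) := by
    ext y; simp [mem_univ_pi]
  rw [this]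
  exact isOpen_set_pi finite_univ fun j _ => isOpen_Ioo

omit [DenselyOrdered M] in
instance DefTop.pi (k : ℕ) : DefTop L (Fin k → M) where
  exists_basis := by
    refine ⟨(Fin k → M) × M, inferInstance, inferInstance,
      fun e y => ∀ j, e.1 j - e.2 < y j ∧ y j < e.1 j + e.2, ?_, fun e => isOpen_box _ _, ?_⟩
    · exact DefP.finite_forall fun j => by fun_prop
    · intro x U hU
      obtain ⟨t, ht, h⟩ := mem_nhds_iff_exists_box.mp hU
      exact ⟨(x, t), fun j => ⟨sub_lt_self _ ht, lt_add_of_pos_right _ ht⟩, h⟩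

omit [DenselyOrdered M] in
instance DefTop.self : DefTop L M where
  exists_basis := by
    refine ⟨M × M, inferInstance, inferInstance, fun e y => e.1 < y ∧ y < e.2, by fun_prop,
      fun e => isOpen_Ioo, ?_⟩
    intro x U hU
    obtain ⟨a, b, hx, h⟩ := mem_nhds_iff_exists_Ioo_subset.mp hU
    exact ⟨(a, b), hx, fun y hy => h hy⟩

omit [DenselyOrdered M] in
theorem eventually_nhdsGT_iff {p : M → Prop} {a : M} :
    (∀ᶠ x in 𝓝[>] a, p x) ↔ ∃ b, a < b ∧ ∀ x, a < x → x < b → p x := by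
  rw [Filter.Eventually, mem_nhdsGT_iff_exists_Ioo_subset]
  constructor
  · rintro ⟨b, hb, h⟩
    exact ⟨b, hb, fun x hx hx' => h ⟨hx, hx'⟩⟩
  · rintro ⟨b, hb, h⟩
    exact ⟨b, hb, fun x hx => h x hx.1 hx.2⟩

omit [DenselyOrdered M] in
@[fun_prop]
theorem DefP.eventually_nhdsGT {f : T → M} (hf : DefF L univ f)
    {p : T → M → Prop} (hp : DefP L univ fun z : T × M => p z.1 z.2) :
    DefP L univ fun t => ∀ᶠ y in 𝓝[>] (f t), p t y := by
  have : DefP L univ fun t => ∃ b, f t < b ∧ ∀ x, f t < x → x < b → p t x := by fun_prop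
  exact this.congr fun t => eventually_nhdsGT_iff

omit [DenselyOrdered M] in
theorem eventually_nhdsGT_or {p : M → Prop} (hp : DefP L univ p) (a : M) :
    (∀ᶠ x in 𝓝[>] a, p x) ∨ (∀ᶠ x in 𝓝[>] a, ¬ p x) := by
  rw [eventually_nhdsGT_iff, eventually_nhdsGT_iff]
  exact eventually_right_or hp a

/-- A bounded definable function has a limit from the right. -/
theorem exists_tendsto_nhdsGT {f : M → M} (hf : DefF L univ f) {c a b : M}
    (hab : ∀ᶠ t in 𝓝[>] c, a ≤ f t ∧ f t ≤ b) :
    ∃ l, a ≤ l ∧ l ≤ b ∧ Tendsto f (𝓝[>] c) (𝓝 l) := by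
  -- The limit is the supremum of the values that are eventually at most `f`.
  have hp : DefP L univ fun x : M => ∀ᶠ t in 𝓝[>] c, x ≤ f t := by fun_prop
  have hb : ∀ x, (∀ᶠ t in 𝓝[>] c, x ≤ f t) → x ≤ b := fun x hx => by
    obtain ⟨t, ht⟩ := (hx.and hab).exists
    exact ht.1.trans ht.2.2
  have ha : ∀ᶠ t in 𝓝[>] c, a ≤ f t := hab.mono fun t ht => ht.1
  obtain ⟨l, hl⟩ := exists_isLUB_of_defP hp ⟨a, ha⟩ ⟨b, fun x hx => hb x hx⟩
  refine ⟨l, hl.1 ha, hl.2 fun x hx => hb x hx, tendsto_order.mpr ⟨fun x hx => ?_, fun x hx => ?_⟩⟩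
  · obtain ⟨y, hy, hxy⟩ := (lt_isLUB_iff hl).mp hx
    exact Eventually.mono (show ∀ᶠ t in 𝓝[>] c, y ≤ f t from hy) fun t ht => hxy.trans_le ht
  · obtain ⟨y, hly, hyx⟩ := exists_between hx
    rcases eventually_nhdsGT_or (L := L) (p := fun t => y ≤ f t) (by fun_prop) c with h | h
    · exact absurd (hl.1 h) (not_le.mpr hly)
    · exact h.mono fun t ht => (not_le.mp ht).trans hyx

/-- Open intervals are definably connected. -/
theorem forall_Ioo_of_clopen {p : M → Prop} (hp : DefP L univ p) {a b x : M} (hax : a < x)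
    (hxb : x < b) (hx : p x) (hopen : ∀ t, a < t → t < b → p t → ∀ᶠ s in 𝓝 t, p s)
    (hclosed : ∀ t, a < t → t < b → ¬ p t → ∀ᶠ s in 𝓝 t, ¬ p s) :
    ∀ t, a < t → t < b → p t := by
  have key : ∀ q : M → Prop, DefP L univ q →
      (∀ t, a < t → t < b → q t → ∀ᶠ s in 𝓝 t, q s) →
      (∀ t, a < t → t < b → ¬ q t → ∀ᶠ s in 𝓝 t, ¬ q s) →
      ∀ x y, a < x → x < y → y < b → q x → q y := by
    intro q hq ho hc x y hax hxy hyb hqx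
    by_contra hqy
    -- At the supremum of the points up to which `q` holds throughout, openness would allow going
    -- further if `q` held there, and closedness would contradict the points before it if `q`
    -- failed.
    have hr : DefP L univ fun s : M => (x ≤ s ∧ s ≤ y) ∧ ∀ u, x ≤ u → u ≤ s → q u := by fun_prop
    obtain ⟨s, hs⟩ := exists_isLUB_of_defP hr
      ⟨x, ⟨le_rfl, hxy.le⟩, fun u h1 h2 => le_antisymm h2 h1 ▸ hqx⟩ ⟨y, fun z hz => hz.1.2⟩
    have hxs : x ≤ s := hs.1 ⟨⟨le_rfl, hxy.le⟩, fun u h1 h2 => le_antisymm h2 h1 ▸ hqx⟩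
    have hsy : s ≤ y := hs.2 fun z hz => hz.1.2
    have hlt : ∀ u, x ≤ u → u < s → q u := fun u hxu hus => by
      obtain ⟨z, hz, huz⟩ := (lt_isLUB_iff hs).mp hus
      exact hz.2 u hxu huz.le
    by_cases hqs : q s
    · have hsy' : s < y := lt_of_le_of_ne hsy fun h => hqy (h ▸ hqs)
      obtain ⟨l, r, hlr, h⟩ := mem_nhds_iff_exists_Ioo_subset.mp
        (ho s (hax.trans_le hxs) (hsy.trans_lt hyb) hqs)
      obtain ⟨z, hsz, hz⟩ := exists_between (lt_min hsy' hlr.2)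
      rw [lt_min_iff] at hz
      refine not_le.mpr hsz (hs.1 ⟨⟨hxs.trans hsz.le, hz.1.le⟩, fun u hxu huz => ?_⟩)
      rcases lt_or_ge u s with hus | hus
      · exact hlt u hxu hus
      · exact h ⟨hlr.1.trans_le hus, huz.trans_lt hz.2⟩
    · have hxs' : x < s := lt_of_le_of_ne hxs fun h => hqs (h ▸ hqx)
      obtain ⟨l, r, hlr, h⟩ := mem_nhds_iff_exists_Ioo_subset.mp
        (hc s (hax.trans_le hxs) (hsy.trans_lt hyb) hqs)
      obtain ⟨z, hz, hzs⟩ := exists_between (max_lt hxs' hlr.1)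
      rw [max_lt_iff] at hz
      exact h ⟨hz.2, hzs.trans hlr.2⟩ (hlt z hz.1.le hzs)
  intro t hat htb
  rcases lt_trichotomy x t with h | h | h
  · exact key p hp hopen hclosed x t hax h htb hx
  · exact h ▸ hx
  · by_contra hpt
    refine key (fun s => ¬ p s) hp.not hclosed (fun t h1 h2 h3 => ?_) t x hat h hxb hpt hx
    exact (hopen t h1 h2 (not_not.mp h3)).mono fun s hs => not_not.mpr hs

/-- A definable function on an infinite set takes values close to some fixed value infinitely
often. -/
theorem exists_infinite_near {f : M → M} (hf : DefF L univ f) {p : M → Prop} (hp : DefP L univ p)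
    (hinf : {x | p x}.Infinite) :
    ∃ x₀, p x₀ ∧ ∀ e, 0 < e → {x | p x ∧ f x₀ - e < f x ∧ f x < f x₀ + e}.Infinite := by
  have himg : DefP L univ fun y => ∃ x, p x ∧ f x = y := by fun_prop
  -- With finitely many values some fibre is infinite; otherwise the values fill an interval, and a
  -- value inside it is approached by infinitely many others.
  rcases finite_or_exists_Ioo_subset himg with hfin | ⟨a, b, hab, h⟩
  · obtain ⟨y, hy⟩ : ∃ y, {x | p x ∧ f x = y}.Infinite := by
      by_contra hcon
      push Not at hcon
      refine hinf ((hfin.biUnion fun y _ => hcon y).subset fun x hx => ?_)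
      exact mem_biUnion (show f x ∈ {y | ∃ x, p x ∧ f x = y} from ⟨x, hx, rfl⟩) ⟨hx, rfl⟩
    obtain ⟨x₀, hx₀, hx₀'⟩ := hy.nonempty
    refine ⟨x₀, hx₀, fun e he => hy.mono fun x hx => ⟨hx.1, ?_⟩⟩
    rw [show f x₀ = y from hx₀', show f x = y from hx.2]
    exact ⟨sub_lt_self _ he, lt_add_of_pos_right _ he⟩
  · obtain ⟨c, hac, hcb⟩ := exists_between hab
    obtain ⟨x₀, hx₀, rfl⟩ := h c hac hcb
    refine ⟨x₀, hx₀, fun e he hfin => ?_⟩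
    refine infinite_of_Ioo_subset (p := fun y => y ∈ f '' {x | p x ∧ f x₀ - e < f x ∧ f x < f x₀ + e})
      (lt_min hcb (lt_add_of_pos_right _ he)) (fun y hy hy' => ?_) (hfin.image f)
    rw [lt_min_iff] at hy'
    obtain ⟨x, hx, rfl⟩ := h y (hac.trans hy) hy'.1
    exact ⟨x, ⟨hx, (sub_lt_self _ he).trans hy, hy'.2⟩, rfl⟩

/-- If only finitely many c had infinite fibres, they could be discarded, leaving over each y an
interval of c's, chosen definably. For infinitely many y both the length and the left endpoint of
this interval are close to fixed values, so these intervals share a point, whose fibre is infinite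
after all. -/
theorem infinite_setOf_infinite_fiber {p : M → M → Prop}
    (hp : DefP L univ fun z : M × M => p z.1 z.2) {a b : M} (hab : a < b)
    (h : ∀ y, a < y → y < b → {c | p y c}.Infinite) :
    {c | {y | (a < y ∧ y < b) ∧ p y c}.Infinite}.Infinite := by
  by_contra hfin
  rw [not_infinite] at hfin
  have hp2 : DefP L univ fun z : M × M => p z.2 z.1 :=
    DefP.comp (p := fun z : M × M => p z.1 z.2) hp (f := fun z : M × M => (z.2, z.1)) (by fun_prop)
  have hC : DefP L univ fun c => {y | (a < y ∧ y < b) ∧ p y c}.Infinite :=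
    DefP.infinite (by fun_prop)
  let q : M → M → Prop := fun y c => p y c ∧ ¬ {y | (a < y ∧ y < b) ∧ p y c}.Infinite
  have hq : DefP L univ fun z : M × M => q z.1 z.2 :=
    DefP.and hp (DefP.not (DefP.comp hC (f := fun z : M × M => z.2) (by fun_prop)))
  have hqinf : ∀ y, a < y → y < b → {c | q y c}.Infinite := fun y h1 h2 =>
    ((h y h1 h2).sdiff hfin).mono fun c hc => hc
  have hqy : ∀ y, DefP L univ fun c => q y c := fun y =>
    DefP.comp hq (f := fun c : M => (y, c)) (by fun_prop)
  have hr : DefP L univ fun z : M × (M × M) =>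
      0 < z.2.2 ∧ ∀ c, z.2.1 < c → c < z.2.1 + z.2.2 → q z.1 c := by
    have : DefP L univ fun z : (M × (M × M)) × M => q z.1.1 z.2 :=
      DefP.comp hq (f := fun z : (M × (M × M)) × M => (z.1.1, z.2)) (by fun_prop)
    fun_prop
  obtain ⟨f, hf, hfp⟩ := exists_defF_choice hr (p := fun (y : M) (s : M × M) => 0 < s.2 ∧
    ∀ c, s.1 < c → c < s.1 + s.2 → q y c)
  have hfp' : ∀ y, a < y → y < b → 0 < (f y).2 ∧
      ∀ c, (f y).1 < c → c < (f y).1 + (f y).2 → q y c := by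
    intro y h1 h2
    obtain ⟨c, d, hcd, h⟩ := exists_Ioo_subset_of_infinite (hqy y) (hqinf y h1 h2)
    refine hfp y ⟨(c, d - c), sub_pos.mpr hcd, fun x h1 h2 => h x h1 ?_⟩
    simpa using h2
  obtain ⟨x₁, hx₁, hx₁'⟩ := exists_infinite_near (f := fun y => (f y).2) (by fun_prop)
    (p := fun y => a < y ∧ y < b) (by fun_prop) (infinite_of_Ioo_subset hab fun x h1 h2 => ⟨h1, h2⟩)
  obtain ⟨t, ht⟩ := exists_half L (f x₁).2
  have hpos : ∀ {s t : M}, t + t = s → 0 < s → 0 < t := fun {s t} h hs => by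
    by_contra hn
    rw [not_lt] at hn
    exact absurd (h ▸ add_nonpos hn hn) (not_le.mpr hs)
  have ht0 : 0 < t := hpos ht (hfp' x₁ hx₁.1 hx₁.2).1
  obtain ⟨s, hs⟩ := exists_half L t
  obtain ⟨e, he⟩ := exists_half L s
  have he0 : 0 < e := hpos he (hpos hs ht0)
  obtain ⟨x₂, hx₂, hx₂'⟩ := exists_infinite_near (f := fun y => (f y).1) (by fun_prop)
    (p := fun y => (a < y ∧ y < b) ∧ (f x₁).2 - t < (f y).2 ∧ (f y).2 < (f x₁).2 + t) (by fun_prop)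
    (hx₁' t ht0)
  have hinf := hx₂' e he0
  -- The left endpoints lie within e of `(f x₂).1` and the lengths exceed t = 4e, so the point at
  -- distance 2e lies in all these intervals.
  let c := (f x₂).1 + e + e
  have hqc : ∀ y, ((a < y ∧ y < b) ∧ (f x₁).2 - t < (f y).2 ∧ (f y).2 < (f x₁).2 + t) ∧
      (f x₂).1 - e < (f y).1 ∧ (f y).1 < (f x₂).1 + e → q y c := by
    rintro y ⟨⟨hy, h1, -⟩, h2, h3⟩
    refine (hfp' y hy.1 hy.2).2 c (h3.trans (lt_add_of_pos_right _ he0)) ?_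
    rw [← ht, add_sub_cancel_right, ← hs, ← he] at h1
    calc c < (f x₂).1 + e + e + e := lt_add_of_pos_right _ he0
      _ = ((f x₂).1 - e) + (e + e + (e + e)) := by abel
      _ < (f y).1 + (f y).2 := add_lt_add h2 h1
  obtain ⟨y, hy⟩ := hinf.nonempty
  exact (hqc y hy).2 (hinf.mono fun y hy => ⟨hy.1.1, (hqc y hy).1⟩)

end Topological

/-! ### Tameness, generic continuity and invariance of dimension -/

/-- The two properties of definable families over `T` on which the dimension theory rests: an
infinite family has a constant section over an open set, and of two definable sets which cover an
open set one contains a nonempty open subset of it. -/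
structure Tame (L : FirstOrder.Language.{u, v}) {M : Type w} [L.Structure M] (T : Type w) [Enc M T]
    [TopologicalSpace T] : Prop where
  exists_const_section : ∀ p : T → M → Prop, (DefP L univ fun z : T × M => p z.1 z.2) →
    ∀ U : Set T, IsOpen U → U.Nonempty → (∀ t ∈ U, {c | p t c}.Infinite) →
      ∃ c, ∃ V ⊆ U, IsOpen V ∧ V.Nonempty ∧ ∀ t ∈ V, p t c
  or : ∀ p q : T → Prop, DefP L univ p → DefP L univ q → ∀ U : Set T, IsOpen U → U.Nonempty →
    (∀ t ∈ U, p t ∨ q t) → ∃ V ⊆ U, IsOpen V ∧ V.Nonempty ∧ ((∀ t ∈ V, p t) ∨ ∀ t ∈ V, q t)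

section Tameness

variable {L : FirstOrder.Language.{u, v}} {M : Type w} [L.Structure M]
variable {T S : Type w} [Enc M T] [Enc M S] [DefType L univ T] [DefType L univ S]
  [TopologicalSpace T] [TopologicalSpace S]

theorem Tame.of_homeomorph (hT : Tame L T) (e : S ≃ₜ T) (he : DefF L univ e.symm) : Tame L S where
  exists_const_section p hp U hU hne h := by
    obtain ⟨c, V, hVU, hV, ⟨t, ht⟩, hVp⟩ := hT.exists_const_section (fun t c => p (e.symm t) c)
      (DefP.comp hp (f := fun z : T × M => (e.symm z.1, z.2)) (by fun_prop)) (e.symm ⁻¹' U)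
      (hU.preimage e.symm.continuous) (hne.preimage e.symm.surjective) fun t ht => h _ ht
    refine ⟨c, e ⁻¹' V, fun x hx => by simpa using hVU hx, hV.preimage e.continuous,
      ⟨e.symm t, by simpa using ht⟩, fun x hx => by simpa using hVp _ hx⟩
  or p q hp hq U hU hne h := by
    obtain ⟨V, hVU, hV, ⟨t, ht⟩, hVp⟩ := hT.or (fun t => p (e.symm t)) (fun t => q (e.symm t))
      (DefP.comp hp he) (DefP.comp hq he) (e.symm ⁻¹' U)
      (hU.preimage e.symm.continuous) (hne.preimage e.symm.surjective) fun t ht => h _ ht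
    refine ⟨e ⁻¹' V, fun x hx => by simpa using hVU hx, hV.preimage e.continuous,
      ⟨e.symm t, by simpa using ht⟩, hVp.imp ?_ ?_⟩ <;>
    exact fun h x hx => by simpa using h _ hx

variable [AddCommGroup M] [LinearOrder M] [hM : Fact (OMinimalGroupExpansion L M)]
  [IsOrderedAddMonoid M] [Nontrivial M] [DenselyOrdered M] [TopologicalSpace M] [OrderTopology M]

/-- Two constant sections are taken, first of left and then of right endpoints: the endpoints of an
interval in a fibre can be moved inwards, so infinitely many are available. -/
theorem Tame.exists_box (hT : Tame L T) {p : T → M → Prop}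
    (hp : DefP L univ fun z : T × M => p z.1 z.2) {U : Set T} (hU : IsOpen U) (hne : U.Nonempty)
    (h : ∀ t ∈ U, {c | p t c}.Infinite) :
    ∃ V ⊆ U, IsOpen V ∧ V.Nonempty ∧ ∃ a b, a < b ∧ ∀ t ∈ V, ∀ y, a < y → y < b → p t y := by
  have hpt : ∀ t, DefP L univ fun y => p t y := fun t =>
    DefP.comp hp (f := fun y : M => (t, y)) (by fun_prop)
  obtain ⟨a, V, hVU, hV, hVne, hVp⟩ := hT.exists_const_section
    (fun t a => ∃ b, a < b ∧ ∀ y, a < y → y < b → p t y) (by fun_prop) U hU hne fun t ht => by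
      obtain ⟨a, b, hab, hy⟩ := exists_Ioo_subset_of_infinite (hpt t) (h t ht)
      exact infinite_of_Ioo_subset hab fun x h1 h2 => ⟨b, h2, fun y h3 => hy y (h1.trans h3)⟩
  obtain ⟨b, W, hWV, hW, hWne, hWp⟩ := hT.exists_const_section
    (fun t b => a < b ∧ ∀ y, a < y → y < b → p t y) (by fun_prop) V hV hVne fun t ht => by
      obtain ⟨b, hab, hy⟩ := hVp t ht
      exact infinite_of_Ioo_subset hab fun x h1 h2 => ⟨h1, fun y h3 h4 => hy y h3 (h4.trans h2)⟩
  obtain ⟨t, ht⟩ := hWne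
  exact ⟨W, hWV.trans hVU, hW, ⟨t, ht⟩, a, b, (hWp t ht).1, fun t ht => (hWp t ht).2⟩

omit [AddCommGroup M] [IsOrderedAddMonoid M] [Nontrivial M] [DenselyOrdered M] hM in
omit [Enc M T] [DefType L univ T] in
theorem exists_prod_Ioo_subset [NoMinOrder M] [NoMaxOrder M] {U : Set (T × M)} (hU : IsOpen U)
    (hne : U.Nonempty) : ∃ V : Set T, IsOpen V ∧ V.Nonempty ∧ ∃ a b : M, a < b ∧
      ∀ t ∈ V, ∀ y, a < y → y < b → (t, y) ∈ U := by
  obtain ⟨x, hx⟩ := hne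
  obtain ⟨V, W, hV, hW, hxV, hxW, h⟩ := isOpen_prod_iff.mp hU x.1 x.2 hx
  obtain ⟨a, b, hab, h'⟩ := mem_nhds_iff_exists_Ioo_subset.mp (hW.mem_nhds hxW)
  exact ⟨V, hV, ⟨_, hxV⟩, a, b, hab.1.trans hab.2, fun t ht y h1 h2 => h ⟨ht, h' ⟨h1, h2⟩⟩⟩

/-- A condition on T × M is replaced by the definable condition on T that infinitely many y satisfy
it, and the result over T is spread to a box by `Tame.exists_box`. For constant sections,
`infinite_setOf_infinite_fiber` provides enough values c. -/
theorem Tame.prod (hT : Tame L T) : Tame L (T × M) where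
  exists_const_section p hp U hU hne h := by
    obtain ⟨V, hV, hVne, a, b, hab, hVU⟩ := exists_prod_Ioo_subset hU hne
    have hp1 : DefP L univ fun z : (T × M) × M => (a < z.2 ∧ z.2 < b) ∧ p (z.1.1, z.2) z.1.2 := by
      have := DefP.comp hp (f := fun z : (T × M) × M => ((z.1.1, z.2), z.1.2)) (by fun_prop)
      fun_prop
    obtain ⟨c, W, hWV, hW, hWne, hWp⟩ := hT.exists_const_section
      (fun t c => {y | (a < y ∧ y < b) ∧ p (t, y) c}.Infinite)
      (DefP.infinite (T := T × M) (p := fun z y => (a < y ∧ y < b) ∧ p (z.1, y) z.2) hp1)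
      V hV hVne fun t ht => by
        refine infinite_setOf_infinite_fiber (p := fun y c => p (t, y) c)
          (DefP.comp hp (f := fun z : M × M => ((t, z.1), z.2)) (by fun_prop)) hab ?_
        exact fun y h1 h2 => h _ (hVU t ht y h1 h2)
    obtain ⟨V', hV'W, hV', ⟨t, ht⟩, a', b', hab', hV'p⟩ := hT.exists_box
      (p := fun t y => (a < y ∧ y < b) ∧ p (t, y) c)
      (DefP.comp hp1 (f := fun z : T × M => ((z.1, c), z.2)) (by fun_prop)) hW hWne hWp
    obtain ⟨y, hy⟩ := exists_between hab'
    refine ⟨c, V' ×ˢ Ioo a' b', ?_, hV'.prod isOpen_Ioo, ⟨(t, y), ht, hy⟩, ?_⟩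
    · rintro ⟨s, x⟩ ⟨hs, hx⟩
      have := (hV'p s hs x hx.1 hx.2).1
      exact hVU s (hWV (hV'W hs)) x this.1 this.2
    · rintro ⟨s, x⟩ ⟨hs, hx⟩
      exact (hV'p s hs x hx.1 hx.2).2
  or p q hp hq U hU hne h := by
    obtain ⟨V, hV, hVne, a, b, hab, hVU⟩ := exists_prod_Ioo_subset hU hne
    have key : ∀ r : T × M → Prop, DefP L univ r → ∀ W ⊆ V, IsOpen W → W.Nonempty →
        (∀ t ∈ W, {y | (a < y ∧ y < b) ∧ r (t, y)}.Infinite) →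
        ∃ V ⊆ U, IsOpen V ∧ V.Nonempty ∧ ∀ t ∈ V, r t := by
      intro r hr W hWV hW hWne hWr
      obtain ⟨V', hV'W, hV', ⟨t, ht⟩, a', b', hab', hV'p⟩ := hT.exists_box
        (p := fun t y => (a < y ∧ y < b) ∧ r (t, y)) (by fun_prop) hW hWne hWr
      obtain ⟨y, hy⟩ := exists_between hab'
      refine ⟨V' ×ˢ Ioo a' b', ?_, hV'.prod isOpen_Ioo, ⟨(t, y), ht, hy⟩, ?_⟩
      · rintro ⟨s, x⟩ ⟨hs, hx⟩
        have := (hV'p s hs x hx.1 hx.2).1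
        exact hVU s (hWV (hV'W hs)) x this.1 this.2
      · rintro ⟨s, x⟩ ⟨hs, hx⟩
        exact (hV'p s hs x hx.1 hx.2).2
    obtain ⟨W, hWV, hW, hWne, hWpq⟩ := hT.or
      (fun t => {y | (a < y ∧ y < b) ∧ p (t, y)}.Infinite)
      (fun t => {y | (a < y ∧ y < b) ∧ q (t, y)}.Infinite)
      (DefP.infinite (by fun_prop)) (DefP.infinite (by fun_prop)) V hV hVne fun t ht => by
        rw [← infinite_union]
        refine infinite_of_Ioo_subset hab fun y h1 h2 => ?_
        exact (h _ (hVU t ht y h1 h2)).imp (fun h => ⟨⟨h1, h2⟩, h⟩) (fun h => ⟨⟨h1, h2⟩, h⟩)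
    rcases hWpq with hW' | hW'
    · obtain ⟨V', h1, h2, h3, h4⟩ := key p hp W hWV hW hWne hW'
      exact ⟨V', h1, h2, h3, Or.inl h4⟩
    · obtain ⟨V', h1, h2, h3, h4⟩ := key q hq W hWV hW hWne hW'
      exact ⟨V', h1, h2, h3, Or.inr h4⟩

/-- Splitting off the last coordinate. -/
def snocHomeo (M : Type w) [TopologicalSpace M] (k : ℕ) :
    (Fin (k + 1) → M) ≃ₜ (Fin k → M) × M where
  toFun v := (fun i => v i.castSucc, v (Fin.last k))
  invFun z := Fin.snoc z.1 z.2
  left_inv v := by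
    funext i
    refine Fin.lastCases ?_ (fun i => ?_) i <;> simp
  right_inv z := by simp
  continuous_toFun := by fun_prop
  continuous_invFun := Continuous.finSnoc continuous_fst continuous_snd

omit [AddCommGroup M] [LinearOrder M] [IsOrderedAddMonoid M] [Nontrivial M] [DenselyOrdered M]
  [OrderTopology M] hM [L.Structure M] in
theorem isCoord_snocHomeo (k : ℕ) : IsCoord (snocHomeo M k) :=
  IsCoord.prodMk (r := fun v : Fin (k + 1) → M => fun i => v i.castSucc)
    (IsCoord.pi fun i => IsCoord.apply _) (IsCoord.apply _)

omit [AddCommGroup M] [LinearOrder M] [IsOrderedAddMonoid M] [Nontrivial M] [DenselyOrdered M]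
  [OrderTopology M] hM [L.Structure M] in
theorem isCoord_snocHomeo_symm (k : ℕ) : IsCoord (snocHomeo M k).symm := by
  refine IsCoord.pi fun i => ?_
  change IsCoord fun z : (Fin k → M) × M => (Fin.snoc z.1 z.2 : Fin (k + 1) → M) i
  refine Fin.lastCases ?_ (fun i => ?_) i
  · simp only [Fin.snoc_last]; exact IsCoord.snd
  · simp only [Fin.snoc_castSucc]; exact (IsCoord.apply i).comp IsCoord.fst

theorem tame_pi (k : ℕ) : Tame L (Fin k → M) := by
  induction k with
  | zero =>
    refine ⟨fun p _ U hU hne h => ?_, fun p q _ _ U hU hne h => ?_⟩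
    · obtain ⟨t, ht⟩ := hne
      obtain ⟨c, hc⟩ := (h t ht).nonempty
      exact ⟨c, U, Subset.rfl, hU, ⟨t, ht⟩, fun s _ => Subsingleton.elim t s ▸ hc⟩
    · obtain ⟨t, ht⟩ := hne
      refine ⟨U, Subset.rfl, hU, ⟨t, ht⟩, (h t ht).imp ?_ ?_⟩ <;>
      exact fun hc s _ => Subsingleton.elim t s ▸ hc
  | succ k ih => exact ih.prod.of_homeomorph (snocHomeo M k) (isCoord_snocHomeo_symm k).defF

/-- If upper semicontinuity fails at t, a whole interval of c has f t < c but not f < c near t. If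
this happened throughout a nonempty open set, one c would serve on an open subset, where then f < c,
a contradiction. Lower semicontinuity is symmetric. -/
theorem Tame.exists_continuousAt (hT : Tame L T) [DefTop L T] {f : T → M} (hf : DefF L univ f)
    {U : Set T} (hU : IsOpen U) (hne : U.Nonempty) :
    ∃ V ⊆ U, IsOpen V ∧ V.Nonempty ∧ ∀ t ∈ V, ContinuousAt f t := by
  have key : ∀ p : T → M → Prop, (DefP L univ fun z : T × M => p z.1 z.2) →
      (∀ t c, p t c → {c | p t c}.Infinite) →
      (∀ c, ∀ V : Set T, IsOpen V → (∀ t ∈ V, p t c) → V = ∅) →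
      ∀ U : Set T, IsOpen U → U.Nonempty → ∃ V ⊆ U, IsOpen V ∧ V.Nonempty ∧ ∀ t ∈ V, ∀ c, ¬ p t c := by
    intro p hp hinf hemp U hU hne
    obtain ⟨V, hVU, hV, hVne, h⟩ := hT.or (fun t => ∃ c, p t c) (fun t => ¬ ∃ c, p t c)
      (by fun_prop) (by fun_prop) U hU hne fun t _ => em _
    rcases h with h | h
    · obtain ⟨c, W, _, hW, hWne, hWp⟩ := hT.exists_const_section p hp V hV hVne fun t ht => by
        obtain ⟨c, hc⟩ := h t ht
        exact hinf t c hc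
      exact absurd (hemp c W hW hWp) hWne.ne_empty
    · exact ⟨V, hVU, hV, hVne, fun t ht c hc => h t ht ⟨c, hc⟩⟩
  obtain ⟨V, hVU, hV, hVne, h1⟩ := key (fun t c => f t < c ∧ ¬ ∀ᶠ s in 𝓝 t, f s < c)
    (by fun_prop) (fun t c hc => by
      refine infinite_of_Ioo_subset hc.1 fun x h1 h2 => ⟨h1, fun h3 => hc.2 ?_⟩
      exact h3.mono fun s hs => hs.trans h2) (fun c V hV h => by
      by_contra hne
      obtain ⟨t, ht⟩ := nonempty_iff_ne_empty.mpr hne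
      exact (h t ht).2 (mem_of_superset (hV.mem_nhds ht) fun s hs => (h s hs).1)) U hU hne
  obtain ⟨W, hWV, hW, hWne, h2⟩ := key (fun t c => c < f t ∧ ¬ ∀ᶠ s in 𝓝 t, c < f s)
    (by fun_prop) (fun t c hc => by
      refine infinite_of_Ioo_subset hc.1 fun x h1 h2 => ⟨h2, fun h3 => hc.2 ?_⟩
      exact h3.mono fun s hs => h1.trans hs) (fun c V hV h => by
      by_contra hne
      obtain ⟨t, ht⟩ := nonempty_iff_ne_empty.mpr hne
      exact (h t ht).2 (mem_of_superset (hV.mem_nhds ht) fun s hs => (h s hs).1)) V hV hVne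
  refine ⟨W, hWV.trans hVU, hW, hWne, fun t ht => tendsto_order.mpr ⟨fun c hc => ?_, fun c hc => ?_⟩⟩
  · by_contra h
    exact h2 t ht c ⟨hc, h⟩
  · by_contra h
    exact h1 t (hWV ht) c ⟨hc, h⟩

theorem Tame.exists_continuousAt_pi (hT : Tame L T) [DefTop L T] {n : ℕ} {f : T → Fin n → M}
    (hf : DefF L univ f) {U : Set T} (hU : IsOpen U) (hne : U.Nonempty) :
    ∃ V ⊆ U, IsOpen V ∧ V.Nonempty ∧ ∀ t ∈ V, ContinuousAt f t := by
  have : ∀ J : Finset (Fin n), ∃ V ⊆ U, IsOpen V ∧ V.Nonempty ∧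
      ∀ t ∈ V, ∀ i ∈ J, ContinuousAt (fun t => f t i) t := by
    intro J
    induction J using Finset.induction_on with
    | empty => exact ⟨U, Subset.rfl, hU, hne, by simp⟩
    | insert i J _ ih =>
      obtain ⟨V, hVU, hV, hVne, h⟩ := ih
      obtain ⟨W, hWV, hW, hWne, h'⟩ := hT.exists_continuousAt (hf.apply i) hV hVne
      refine ⟨W, hWV.trans hVU, hW, hWne, fun t ht j hj => ?_⟩
      rcases Finset.mem_insert.mp hj with rfl | hj
      · exact h' t ht
      · exact h t (hWV ht) j hj
  obtain ⟨V, hVU, hV, hVne, h⟩ := this Finset.univ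
  exact ⟨V, hVU, hV, hVne, fun t ht => continuousAt_pi.mpr fun i => h t ht i (Finset.mem_univ _)⟩

/-- If the fibres of `g` over t take infinitely many values, some value is common to an open set of
t. If they take finitely many, one of them is taken infinitely often, hence on an interval. -/
theorem Tame.slice_or_const (hT : Tame L T) {g : T × M → M} (hg : DefF L univ g)
    {U : Set (T × M)} (hU : IsOpen U) (hne : U.Nonempty) :
    (∃ y : T → M, DefF L univ y ∧ ∃ V, IsOpen V ∧ V.Nonempty ∧ ∃ c,
      ∀ t ∈ V, (t, y t) ∈ U ∧ g (t, y t) = c) ∨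
    ∃ c : T → M, DefF L univ c ∧ ∃ V, IsOpen V ∧ V.Nonempty ∧ ∃ a b, a < b ∧
      ∀ t ∈ V, ∀ y, a < y → y < b → (t, y) ∈ U ∧ g (t, y) = c t := by
  obtain ⟨V, hV, hVne, a, b, hab, hVU⟩ := exists_prod_Ioo_subset hU hne
  have h1 : DefP L univ fun t => {c | ∃ y, (a < y ∧ y < b) ∧ g (t, y) = c}.Infinite :=
    DefP.infinite (by fun_prop)
  obtain ⟨W, hWV, hW, hWne, h⟩ := hT.or _ _ h1 h1.not V hV hVne fun t _ => em _
  rcases h with h | h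
  · obtain ⟨c, W', hW'W, hW', hW'ne, hc⟩ := hT.exists_const_section _ (by fun_prop) W hW hWne h
    obtain ⟨y, hy, hyp⟩ := exists_defF_choice (L := L) (T := T) (S := M)
      (p := fun t y => (a < y ∧ y < b) ∧ g (t, y) = c) (by fun_prop)
    refine Or.inl ⟨y, hy, W', hW', hW'ne, c, fun t ht => ?_⟩
    have := hyp t (hc t ht)
    exact ⟨hVU t (hWV (hW'W ht)) _ this.1.1 this.1.2, this.2⟩
  · obtain ⟨c, hc, hcp⟩ := exists_defF_choice (L := L) (T := T) (S := M)
      (p := fun t c => {y | (a < y ∧ y < b) ∧ g (t, y) = c}.Infinite)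
      (DefP.infinite (T := T × M) (p := fun z y => (a < y ∧ y < b) ∧ g (z.1, y) = z.2)
        (by fun_prop))
    obtain ⟨W', hW'W, hW', hW'ne, a', b', hab', h'⟩ := hT.exists_box
      (p := fun t y => (a < y ∧ y < b) ∧ g (t, y) = c t) (by fun_prop) hW hWne fun t ht => hcp t (by
        have hfin := not_infinite.mp (h t ht)
        by_contra hcon
        push Not at hcon
        refine Ioo_infinite hab ((hfin.biUnion fun c _ => hcon c).subset fun y hy => ?_)
        exact mem_biUnion (show g (t, y) ∈ {c | ∃ y, (a < y ∧ y < b) ∧ g (t, y) = c} from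
          ⟨y, hy, rfl⟩) ⟨hy, rfl⟩)
    refine Or.inr ⟨c, hc, W', hW', hW'ne, a', b', hab', fun t ht y h1 h2 => ?_⟩
    have := h' t ht y h1 h2
    exact ⟨hVU t (hWV (hW'W ht)) _ this.1.1 this.1.2, this.2⟩

/-- A level set of a definable function on an open subset of `M^(k+1)` contains an injective
image of an open subset of `M^k`. -/
theorem exists_slice (k : ℕ) {g : (Fin (k + 1) → M) → M} (hg : DefF L univ g)
    {U : Set (Fin (k + 1) → M)} (hU : IsOpen U) (hne : U.Nonempty) :
    ∃ ψ : (Fin k → M) → Fin (k + 1) → M, DefF L univ ψ ∧ ∃ O, IsOpen O ∧ O.Nonempty ∧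
      InjOn ψ O ∧ ∃ c, ∀ o ∈ O, ψ o ∈ U ∧ g (ψ o) = c := by
  induction k with
  | zero =>
    obtain ⟨u, hu⟩ := hne
    exact ⟨fun _ => u, DefF.const u, univ, isOpen_univ, univ_nonempty,
      (Function.injective_of_subsingleton _).injOn, g u, fun _ _ => ⟨hu, rfl⟩⟩
  | succ k ih =>
    have hes := (isCoord_snocHomeo_symm (M := M) (k + 1)).defF (L := L) (A := univ)
    have he := (isCoord_snocHomeo (M := M) k).defF (L := L) (A := univ)
    rcases (tame_pi (L := L) (M := M) (k + 1)).slice_or_const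
      (g := fun z => g ((snocHomeo M (k + 1)).symm z)) (by fun_prop)
      (hU.preimage (snocHomeo M (k + 1)).symm.continuous)
      (hne.preimage (snocHomeo M (k + 1)).symm.surjective) with
      ⟨y, hy, V, hV, hVne, c, h⟩ | ⟨c, hc, V, hV, hVne, a, b, hab, h⟩
    · refine ⟨fun t => (snocHomeo M (k + 1)).symm (t, y t), by fun_prop, V, hV, hVne, ?_, c, h⟩
      intro t _ s _ hts
      exact congrArg Prod.fst ((snocHomeo M (k + 1)).symm.injective hts)
    -- On a box `g` does not depend on the last coordinate, so a slice of `c` times an interval is a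
    -- slice of `g`.
    · obtain ⟨ψ, hψ, O, hO, ⟨o, ho⟩, hinj, v, hv⟩ := ih hc hV hVne
      refine ⟨fun t => (snocHomeo M (k + 1)).symm (ψ (snocHomeo M k t).1, (snocHomeo M k t).2),
        hes.comp ((hψ.comp he.fst).prodMk he.snd), snocHomeo M k ⁻¹' (O ×ˢ Ioo a b),
        (hO.prod isOpen_Ioo).preimage (snocHomeo M k).continuous, ?_, ?_, v, ?_⟩
      · obtain ⟨y, hy⟩ := exists_between hab
        exact ⟨(snocHomeo M k).symm (o, y), by simpa using ⟨ho, hy⟩⟩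
      · intro t ht s hs hts
        have := (snocHomeo M (k + 1)).symm.injective hts
        rw [Prod.mk.injEq] at this
        exact (snocHomeo M k).injective (Prod.ext (hinj ht.1 hs.1 this.1) this.2)
      · intro t ht
        have := h _ (hv _ ht.1).1 _ ht.2.1 ht.2.2
        exact ⟨this.1, this.2.trans (hv _ ht.1).2⟩

/-- There is no definable injection of an open subset of `M^k` into `M^m` when `m < k`. -/
theorem not_injOn_of_lt {m k : ℕ} (hmk : m < k) {g : (Fin k → M) → Fin m → M}
    (hg : DefF L univ g) {U : Set (Fin k → M)} (hU : IsOpen U) (hne : U.Nonempty) :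
    ¬ InjOn g U := by
  induction m generalizing k with
  | zero =>
    intro hinj
    obtain ⟨u, hu⟩ := hne
    obtain ⟨t, ht, h⟩ := mem_nhds_iff_exists_box.mp (hU.mem_nhds hu)
    obtain ⟨s, hs, hst⟩ := exists_between ht
    have hv : (fun j => u j + s) ∈ U := h _ fun j =>
      ⟨(sub_lt_self _ ht).trans (lt_add_of_pos_right _ hs), add_lt_add_right hst _⟩
    have := congrFun (hinj hu hv (Subsingleton.elim _ _)) ⟨0, hmk⟩
    exact (lt_add_of_pos_right _ hs).ne this
  | succ m ih =>
    intro hinj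
    obtain ⟨k, rfl⟩ : ∃ j, k = j + 1 := ⟨k - 1, by omega⟩
    -- Fixing the last coordinate of `g` lowers both dimensions by one.
    obtain ⟨ψ, hψ, O, hO, hOne, hψi, c, h⟩ := exists_slice k (hg.apply (Fin.last m)) hU hne
    refine ih (k := k) (by omega) (g := fun o i => g (ψ o) i.castSucc)
      (DefF.pi fun i => (hg.comp hψ).apply i.castSucc) hO hOne fun o ho o' ho' heq => ?_
    refine hψi ho ho' (hinj (h o ho).1 (h o' ho').1 (funext fun i => ?_))
    refine Fin.lastCases ?_ (fun i => congrFun heq i) i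
    rw [(h o ho).2, (h o' ho').2]

end Tameness

/-! ### Open cells in definable sets -/

section Cells

variable {L : FirstOrder.Language.{u, v}} {M : Type w} [L.Structure M]
variable {T S : Type w} [Enc M T] [Enc M S] [DefType L univ T] [DefType L univ S]
  [TopologicalSpace T] [TopologicalSpace S] [TopologicalSpace M]

variable (L) in
/-- A nonempty relatively open subset of `X` is mapped by a coordinate projection bijectively onto
an open subset of some `M^k`, with continuous definable inverse. -/
def HasOpenCell (X : T → Prop) : Prop :=
  ∃ (k : ℕ) (π : T → Fin k → M) (s : (Fin k → M) → T) (O : Set (Fin k → M)) (U : Set T),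
    IsCoord π ∧ Continuous π ∧ DefF L univ s ∧ IsOpen O ∧ O.Nonempty ∧ IsOpen U ∧
    ContinuousOn s O ∧ (∀ x ∈ U, π x ∈ O) ∧ (∀ o ∈ O, s o ∈ U ∧ X (s o) ∧ π (s o) = o) ∧
    ∀ x ∈ U, X x → s (π x) = x

theorem HasOpenCell.of_homeomorph (e : S ≃ₜ T) (he : IsCoord e) (he' : IsCoord e.symm)
    {X : S → Prop} (h : HasOpenCell L fun t => X (e.symm t)) : HasOpenCell L X := by
  obtain ⟨k, π, s, O, U, h1, h2, h3, h4, h5, h6, h7, h8, h9, h10⟩ := h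
  refine ⟨k, fun x => π (e x), fun o => e.symm (s o), O, e ⁻¹' U, h1.comp he,
    h2.comp e.continuous, he'.defF.comp h3, h4, h5, h6.preimage e.continuous,
    e.symm.continuous.comp_continuousOn h7, fun x hx => h8 _ hx, fun o ho => ?_, fun x hx hX => ?_⟩
  · simpa using h9 o ho
  · change e.symm (s (π (e x))) = x
    rw [h10 (e x) hx (by simpa using hX), e.symm_apply_apply]

variable [AddCommGroup M] [LinearOrder M] [hM : Fact (OMinimalGroupExpansion L M)]
  [IsOrderedAddMonoid M] [Nontrivial M] [DenselyOrdered M] [OrderTopology M]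

/-- A cell of the projection to T is refined. Where the fibres are infinite, it is thickened by an
interval; where they are finite, their least elements form a continuous graph, which a constant
isolates from the rest of the fibres. -/
theorem HasOpenCell.prod (hT : ∀ X : T → Prop, DefP L univ X → (∃ x, X x) → HasOpenCell L X)
    {X : T × M → Prop} (hX : DefP L univ X) (hne : ∃ x, X x) : HasOpenCell L X := by
  obtain ⟨k, π, s, O, U, hπ, hπc, hs, hO, hOne, hU, hsc, hUO, hOU, hXs⟩ :=
    hT (fun t => ∃ y, X (t, y)) (by fun_prop) (by obtain ⟨x, hx⟩ := hne; exact ⟨x.1, x.2, hx⟩)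
  have hinf : DefP L univ fun o => {y | X (s o, y)}.Infinite := DefP.infinite (by fun_prop)
  have hXo : DefP L univ fun z : (Fin k → M) × M => X (s z.1, z.2) := by fun_prop
  obtain ⟨V, hVO, hV, hVne, h⟩ := (tame_pi k).or _ _ hinf hinf.not O hO hOne fun o _ => em _
  rcases h with h | h
  · obtain ⟨W, hWV, hW, ⟨o, ho⟩, a, b, hab, hWX⟩ := (tame_pi k).exists_box hXo hV hVne h
    obtain ⟨y, hy⟩ := exists_between hab
    let e := snocHomeo M k
    refine ⟨k + 1, fun x => e.symm (π x.1, x.2), fun w => (s (e w).1, (e w).2),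
      e ⁻¹' (W ×ˢ Ioo a b), {x | x.1 ∈ U ∧ π x.1 ∈ W ∧ x.2 ∈ Ioo a b}, ?_, ?_, ?_, ?_, ?_, ?_, ?_,
      ?_, ?_, ?_⟩
    · exact (isCoord_snocHomeo_symm k).comp ((hπ.comp IsCoord.fst).prodMk IsCoord.snd)
    · exact e.symm.continuous.comp ((hπc.comp continuous_fst).prodMk continuous_snd)
    · have he := (isCoord_snocHomeo (M := M) k).defF (L := L) (A := univ)
      exact (hs.comp he.fst).prodMk he.snd
    · exact (hW.prod isOpen_Ioo).preimage e.continuous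
    · exact ⟨e.symm (o, y), by simpa using ⟨ho, hy⟩⟩
    · exact (hU.preimage continuous_fst).inter (((hW.preimage hπc).preimage continuous_fst).inter
        (isOpen_Ioo.preimage continuous_snd))
    · refine ContinuousOn.prodMk (hsc.comp (continuous_fst.comp e.continuous).continuousOn ?_)
        (continuous_snd.comp e.continuous).continuousOn
      exact fun w hw => hVO (hWV hw.1)
    · intro x hx
      simpa using ⟨hx.2.1, hx.2.2⟩
    · intro w hw
      have h1 := hOU _ (hVO (hWV hw.1))
      refine ⟨⟨h1.1, by rw [h1.2.2]; exact hw.1, hw.2⟩, hWX _ hw.1 _ hw.2.1 hw.2.2, ?_⟩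
      change e.symm (π (s (e w).1), (e w).2) = w
      rw [h1.2.2]
      exact e.symm_apply_apply w
    · intro x hx hXx
      have := hXs x.1 hx.1 ⟨x.2, hXx⟩
      simp [this]
  · have hfin : ∀ o ∈ V, {y | X (s o, y)}.Finite := fun o ho => not_infinite.mp (h o ho)
    obtain ⟨f, hf, hfp⟩ := exists_defF_choice (L := L) (T := Fin k → M) (S := M)
      (p := fun o y => X (s o, y) ∧ ∀ z, X (s o, z) → y ≤ z) (by fun_prop)
    -- `g` is a lower bound, above `f`, for all further elements of the fibre; it exists also when
    -- there are none.
    obtain ⟨g, hg, hgp⟩ := exists_defF_choice (L := L) (T := Fin k → M) (S := M)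
      (p := fun o y => f o < y ∧ ∀ z, X (s o, z) → f o < z → y ≤ z) (by fun_prop)
    have hf1 : ∀ o ∈ V, X (s o, f o) ∧ ∀ z, X (s o, z) → f o ≤ z := fun o ho => hfp o (by
      obtain ⟨y, hy, hy'⟩ := exists_min_image {y | X (s o, y)} id (hfin o ho) (hOU o (hVO ho)).2.1
      exact ⟨y, hy, hy'⟩)
    have hg1 : ∀ o ∈ V, f o < g o ∧ ∀ z, X (s o, z) → f o < z → g o ≤ z := fun o ho => hgp o (by
      by_cases hz : ∃ z, X (s o, z) ∧ f o < z
      · obtain ⟨y, hy, hy'⟩ := exists_min_image {y | X (s o, y) ∧ f o < y} id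
          ((hfin o ho).subset fun y hy => hy.1) hz
        exact ⟨y, hy.2, fun z h1 h2 => hy' z ⟨h1, h2⟩⟩
      · obtain ⟨y, hy⟩ := exists_gt (f o)
        exact ⟨y, hy, fun z h1 h2 => absurd ⟨z, h1, h2⟩ hz⟩)
    obtain ⟨V1, hV1V, hV1, hV1ne, hfc⟩ := (tame_pi k).exists_continuousAt hf hV hVne
    obtain ⟨V2, hV2V, hV2, ⟨o₀, ho₀⟩, hgc⟩ := (tame_pi k).exists_continuousAt hg hV1 hV1ne
    -- Near `o₀` the constant c separates `f` from `g`, so below c the set is the graph of `f`.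
    obtain ⟨c, hc1, hc2⟩ := exists_between (hg1 o₀ (hV1V (hV2V ho₀))).1
    obtain ⟨W, hWsub, hW, ho₀W⟩ := eventually_nhds_iff.mp
      (((hfc o₀ (hV2V ho₀)).eventually_lt continuousAt_const hc1).and
        ((continuousAt_const.eventually_lt (hgc o₀ ho₀) hc2).and (hV2.mem_nhds ho₀)))
    have hWV : W ⊆ V := fun o ho => hV1V (hV2V (hWsub o ho).2.2)
    refine ⟨k, fun x => π x.1, fun o => (s o, f o), W, {x | x.1 ∈ U ∧ π x.1 ∈ W ∧ x.2 ∈ Iio c},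
      hπ.comp IsCoord.fst, hπc.comp continuous_fst, hs.prodMk hf, hW, ⟨o₀, ho₀W⟩, ?_, ?_,
      fun x hx => hx.2.1, ?_, ?_⟩
    · exact (hU.preimage continuous_fst).inter (((hW.preimage hπc).preimage continuous_fst).inter
        (isOpen_Iio.preimage continuous_snd))
    · exact (hsc.mono (hWV.trans hVO)).prodMk fun o ho =>
        (hfc o (hV2V (hWsub o ho).2.2)).continuousWithinAt
    · intro o ho
      have h1 := hOU _ (hVO (hWV ho))
      exact ⟨⟨h1.1, by rw [h1.2.2]; exact ho, (hWsub o ho).1⟩, (hf1 o (hWV ho)).1, h1.2.2⟩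
    · intro x hx hXx
      have h1 := hXs x.1 hx.1 ⟨x.2, hXx⟩
      have hXx' : X (s (π x.1), x.2) := by rw [h1]; exact hXx
      refine Prod.ext h1 ?_
      change f (π x.1) = x.2
      refine ((hf1 _ (hWV hx.2.1)).2 _ hXx').eq_of_not_lt fun hlt => ?_
      exact lt_irrefl _ (((hg1 _ (hWV hx.2.1)).2 _ hXx' hlt).trans_lt
        (LT.lt.trans hx.2.2 (hWsub _ hx.2.1).2.1))

theorem hasOpenCell_pi {n : ℕ} {X : (Fin n → M) → Prop} (hX : DefP L univ X) (hne : ∃ x, X x) :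
    HasOpenCell L X := by
  induction n with
  | zero =>
    obtain ⟨x, hx⟩ := hne
    refine ⟨0, id, id, univ, univ, IsCoord.id, continuous_id, DefF.id, isOpen_univ, univ_nonempty,
      isOpen_univ, continuousOn_id, fun _ _ => trivial,
      fun o _ => ⟨trivial, Subsingleton.elim x o ▸ hx, rfl⟩, fun _ _ _ => rfl⟩
  | succ n ih =>
    refine HasOpenCell.of_homeomorph (snocHomeo M n) (isCoord_snocHomeo n)
      (isCoord_snocHomeo_symm n) (HasOpenCell.prod (fun X hX hne => ih hX hne)
        (hX.comp (isCoord_snocHomeo_symm n).defF) ?_)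
    obtain ⟨x, hx⟩ := hne
    exact ⟨snocHomeo M n x, by simpa using hx⟩

/-- A nonempty definable set is relatively closed in some open set which meets it. -/
theorem exists_open_relatively_closed {n : ℕ} {X : Set (Fin n → M)} (hX : DefP L univ (· ∈ X))
    (hne : X.Nonempty) :
    ∃ U, IsOpen U ∧ (X ∩ U).Nonempty ∧ ∀ u ∈ U, u ∈ closure X → u ∈ X := by
  obtain ⟨k, π, s, O, U, hπ, hπc, hs, hO, ⟨o, ho⟩, hU, hsc, hUO, hOU, hXs⟩ :=
    hasOpenCell_pi hX hne
  refine ⟨U, hU, ⟨s o, (hOU o ho).2.1, (hOU o ho).1⟩, fun u hu hcl => ?_⟩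
  -- In `U` the set consists of the fixed points of the continuous map s ∘ π, so it contains its
  -- limit points there.
  have hc : ContinuousOn (fun x => s (π x)) U := hsc.comp hπc.continuousOn hUO
  have hu' : u ∈ closure (X ∩ U) := by
    rw [inter_comm]
    exact hU.inter_closure ⟨hu, hcl⟩
  have : (𝓝[X ∩ U] u).NeBot := mem_closure_iff_nhdsWithin_neBot.mp hu'
  have h1 : Tendsto (fun x => s (π x)) (𝓝[X ∩ U] u) (𝓝 (s (π u))) :=
    (hc u hu).mono_left (nhdsWithin_mono _ inter_subset_right)
  have h2 : Tendsto (fun x => s (π x)) (𝓝[X ∩ U] u) (𝓝 u) :=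
    (tendsto_id.mono_left nhdsWithin_le_nhds).congr' (by
      filter_upwards [self_mem_nhdsWithin] with x hx
      exact (hXs x hx.2 hx.1).symm)
  rw [tendsto_nhds_unique h2 h1]
  exact (hOU _ (hUO u hu)).2.1

theorem exists_defP_isOpen_subset {T : Type w} [Enc M T] [DefType L univ T] [TopologicalSpace T]
    [DefTop L T] {x : T} {U : Set T} (hU : U ∈ 𝓝 x) :
    ∃ V ⊆ U, IsOpen V ∧ x ∈ V ∧ DefP L univ (· ∈ V) := by
  obtain ⟨E, _, _, B, hB, hBo, hBb⟩ := ‹DefTop L T›.exists_basis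
  obtain ⟨e, he, h⟩ := hBb x U hU
  refine ⟨{t | B e t}, fun t ht => h t ht, hBo e, he, ?_⟩
  exact DefP.comp hB (f := fun t : T => (e, t)) (by fun_prop)

/-- A definable injective image of an open subset of `M^k` has a projection to `k` coordinates
with nonempty interior. -/
theorem exists_interior_image_nonempty {k n : ℕ} {h : (Fin k → M) → Fin n → M}
    (hh : DefF L univ h) {U : Set (Fin k → M)} (hU : IsOpen U) (hne : U.Nonempty)
    (hinj : InjOn h U) {Z : Set (Fin n → M)} (hZ : ∀ u ∈ U, h u ∈ Z) :
    ∃ σ : Fin k ↪ Fin n, (interior ((fun t : Fin n → M => t ∘ σ) '' Z)).Nonempty := by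
  obtain ⟨V, hVU, hV, ⟨v, hv⟩, hc⟩ := (tame_pi k).exists_continuousAt_pi hh hU hne
  obtain ⟨V', hV'V, hV', hvV', hV'd⟩ := exists_defP_isOpen_subset (L := L) (hV.mem_nhds hv)
  obtain ⟨m, π, s, O, W, hπ, hπc, hs, hO, ⟨o, ho⟩, hW, hsc, hWO, hOW, hXs⟩ :=
    hasOpenCell_pi (L := L) (X := fun z => ∃ u, u ∈ V' ∧ h u = z) (by fun_prop) ⟨_, v, hvV', rfl⟩
  obtain ⟨u₀, hu₀, hu₀'⟩ := (hOW o ho).2.1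
  obtain ⟨Y, hY, hYo, hu₀Y⟩ := eventually_nhds_iff.mp
    (((hc u₀ (hV'V hu₀)).eventually (hW.mem_nhds (hu₀' ▸ (hOW o ho).1))).and (hV'.mem_nhds hu₀))
  -- Near `u₀` the map π ∘ h is an injection into M^m.
  have hkm : k ≤ m := by
    by_contra hlt
    rw [not_le] at hlt
    refine not_injOn_of_lt hlt (hπ.defF.comp hh) hYo ⟨u₀, hu₀Y⟩ fun x hx y hy hxy => ?_
    have h1 := hXs _ (hY x hx).1 ⟨x, (hY x hx).2, rfl⟩
    have h2 := hXs _ (hY y hy).1 ⟨y, (hY y hy).2, rfl⟩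
    refine hinj (hVU (hV'V (hY x hx).2)) (hVU (hV'V (hY y hy).2)) ?_
    rw [← h1, ← h2]
    exact congrArg s hxy
  obtain ⟨ρ, hρ⟩ : ∃ ρ : Fin m → Fin n, ∀ t, π t = t ∘ ρ := hπ
  obtain ⟨t, ht, hbox⟩ := mem_nhds_iff_exists_box.mp (hO.mem_nhds ho)
  have hπs : ∀ y : Fin m → M, (∀ j, o j - t < y j ∧ y j < o j + t) → s y ∘ ρ = y := fun y hy =>
    (hρ (s y)).symm.trans (hOW y (hbox y hy)).2.2
  have ho1 : ∀ j, o j - t < o j ∧ o j < o j + t := fun j =>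
    ⟨sub_lt_self _ ht, lt_add_of_pos_right _ ht⟩
  -- As π ∘ s is the identity on a box, moving a single coordinate of `o` shows that π uses no
  -- coordinate twice.
  have hρi : Function.Injective ρ := by
    intro i j hij
    by_contra hne
    obtain ⟨e, he, het⟩ := exists_between ht
    have h1 := hπs (Function.update o i (o i + e)) fun l => by
      rcases eq_or_ne l i with rfl | hl
      · rw [Function.update_self]
        exact ⟨(sub_lt_self _ ht).trans (lt_add_of_pos_right _ he), add_lt_add_right het _⟩
      · rw [Function.update_of_ne hl]
        exact ho1 l
    have h2 := hπs o ho1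
    have e1 := congrFun h1 i
    have e2 := congrFun h1 j
    have e3 := congrFun h2 i
    have e4 := congrFun h2 j
    simp only [Function.comp_apply, Function.update_self,
      Function.update_of_ne (Ne.symm hne)] at e1 e2 e3 e4
    rw [hij, e2] at e1
    rw [hij, e4] at e3
    rw [e3] at e1
    exact (lt_add_of_pos_right _ he).ne e1
  refine ⟨⟨ρ ∘ Fin.castLE hkm, hρi.comp (Fin.castLE_injective hkm)⟩, o ∘ Fin.castLE hkm, ?_⟩
  rw [mem_interior_iff_mem_nhds, mem_nhds_iff_exists_box]
  refine ⟨t, ht, fun y hy => ?_⟩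
  let y' : Fin m → M := fun j => if hj : (j : ℕ) < k then y ⟨j, hj⟩ else o j
  have hy' : ∀ j, o j - t < y' j ∧ y' j < o j + t := by
    intro j
    by_cases hj : (j : ℕ) < k
    · simp only [y', hj, dite_true]
      exact hy ⟨j, hj⟩
    · simp only [y', hj, dite_false]
      exact ho1 j
  obtain ⟨u, hu, hu'⟩ := (hOW y' (hbox y' hy')).2.1
  refine ⟨s y', hu' ▸ hZ u (hVU (hV'V hu)), funext fun j => ?_⟩
  have := congrFun (hπs y' hy') (Fin.castLE hkm j)
  simpa [y'] using this

end Cells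

/-! ### Topology and curves in definable groups -/

/-- `G` is covered by finitely many charts, definable over `A`, in which the images of `0` have
coordinates in `A`. -/
class DefAtlas (L : FirstOrder.Language.{u, v}) {M : Type w} [L.Structure M] [TopologicalSpace M]
    (A : Set M) (G : Type w) [Enc M G] [TopologicalSpace G] [Zero G] : Prop where
  exists_atlas : ∃ (d k : ℕ) (φ : Fin k → OpenPartialHomeomorph G (Fin d → M)),
    (∀ g, ∃ i, g ∈ (φ i).source) ∧
    (∀ i, DefP L A fun z : G × (Fin d → M) => z.1 ∈ (φ i).source ∧ φ i z.1 = z.2) ∧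
    ∀ i, (0 : G) ∈ (φ i).source → ∀ j, φ i 0 j ∈ A

section Groups

variable {L : FirstOrder.Language.{u, v}} {M : Type w} [L.Structure M]
  [AddCommGroup M] [LinearOrder M] [hM : Fact (OMinimalGroupExpansion L M)]
  [IsOrderedAddMonoid M] [Nontrivial M] [TopologicalSpace M] [OrderTopology M]
variable {G : Type w} [AddCommGroup G] [TopologicalSpace G] [IsTopologicalAddGroup G] [Enc M G]

-- Cubes in a chart at 0 form the family; it is definable over `A` because the chart coordinates of
-- 0 lie in `A`. The single radius in M is what saturation will act on.
omit [IsTopologicalAddGroup G] in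
theorem exists_defP_basis_zero {A : Set M} [DefType L A G] [DefAtlas L A G] :
    ∃ V : M → G → Prop, (DefP L A fun z : M × G => V z.1 z.2) ∧
      (∀ t, 0 < t → IsOpen {g | V t g} ∧ V t 0) ∧ (∀ s t g, s ≤ t → V s g → V t g) ∧
      ∀ U ∈ 𝓝 (0 : G), ∃ t, 0 < t ∧ ∀ g, V t g → g ∈ U := by
  obtain ⟨d, k, φ, hcov, hdef, h0⟩ := DefAtlas.exists_atlas (L := L) (A := A) (G := G)
  obtain ⟨i, hi⟩ := hcov 0
  refine ⟨fun t g => g ∈ (φ i).source ∧ ∀ j, φ i 0 j - t < φ i g j ∧ φ i g j < φ i 0 j + t,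
    ?_, ?_, ?_, ?_⟩
  · have hc : ∀ j, DefF L A fun _ : (M × G) × (Fin d → M) => φ i 0 j := fun j =>
      DefF.const_of_mem _ fun _ => h0 i hi j
    have h1 : DefP L A fun z : (M × G) × (Fin d → M) => z.1.2 ∈ (φ i).source ∧ φ i z.1.2 = z.2 :=
      DefP.comp (hdef i) (f := fun z : (M × G) × (Fin d → M) => (z.1.2, z.2)) (by fun_prop)
    have h2 : DefP L A fun z : (M × G) × (Fin d → M) =>
        ∀ j, φ i 0 j - z.1.1 < z.2 j ∧ z.2 j < φ i 0 j + z.1.1 :=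
      DefP.finite_forall fun j => by
        have := hc j
        fun_prop
    refine DefP.congr (DefP.exists (T := M × G) (S := Fin d → M)
      (p := fun z v => (z.2 ∈ (φ i).source ∧ φ i z.2 = v) ∧
        ∀ j, φ i 0 j - z.1 < v j ∧ v j < φ i 0 j + z.1) (h1.and h2)) fun z => ?_
    constructor
    · rintro ⟨h3, h4⟩
      exact ⟨_, ⟨h3, rfl⟩, h4⟩
    · rintro ⟨v, ⟨h3, rfl⟩, h4⟩
      exact ⟨h3, h4⟩
  · intro t ht
    refine ⟨(φ i).isOpen_inter_preimage (isOpen_box (φ i 0) t), hi, fun j => ?_⟩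
    exact ⟨sub_lt_self _ ht, lt_add_of_pos_right _ ht⟩
  · rintro s t g hst ⟨h1, h2⟩
    exact ⟨h1, fun j => ⟨(sub_le_sub_left hst _).trans_lt (h2 j).1,
      (h2 j).2.trans_le (add_le_add_right hst _)⟩⟩
  · intro U hU
    obtain ⟨t, ht, h⟩ := mem_nhds_iff_exists_box.mp ((φ i).symm.continuousAt
      ((φ i).map_source hi) (by rwa [(φ i).left_inv hi]))
    refine ⟨t, ht, fun g hg => ?_⟩
    have := h _ hg.2
    rwa [mem_preimage, (φ i).left_inv hg.1] at this

variable [DefType L univ G] [DefAtlas L univ G]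

/-- Charts separate inseparable points, and a T0 topological group is Hausdorff. -/
theorem t2Space_of_defAtlas (L : FirstOrder.Language.{u, v}) (M : Type w) [L.Structure M]
    [LinearOrder M] [TopologicalSpace M] [OrderTopology M] (G : Type w) [AddCommGroup G]
    [TopologicalSpace G] [IsTopologicalAddGroup G] [Enc M G] [DefAtlas L (univ : Set M) G] :
    T2Space G := by
  obtain ⟨d, k, φ, hcov, -, -⟩ := DefAtlas.exists_atlas (L := L) (A := (univ : Set M)) (G := G)
  have : T0Space G := by
    refine (t0Space_iff_inseparable G).mpr fun x y h => ?_
    obtain ⟨i, hi⟩ := hcov x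
    have hy : y ∈ (φ i).source := (h.mem_open_iff (φ i).open_source).mp hi
    refine (φ i).injOn hi hy ?_
    exact (h.map_of_continuousAt ((φ i).continuousAt hi) ((φ i).continuousAt hy)).eq
  infer_instance

/-- Arbitrarily small definable neighbourhoods of `0` in which definable curves converge. -/
theorem exists_defP_nhds_curves_converge [DenselyOrdered M] {U : Set G} (hU : U ∈ 𝓝 0) :
    ∃ K ⊆ U, K ∈ 𝓝 0 ∧ DefP L univ (· ∈ K) ∧ ∀ γ : M → G, DefF L univ γ →
      (∀ᶠ t in 𝓝[>] 0, γ t ∈ K) → ∃ l ∈ K, Tendsto γ (𝓝[>] 0) (𝓝 l) := by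
  obtain ⟨d, k, φ, hcov, hdef, h0⟩ := DefAtlas.exists_atlas (L := L) (A := (univ : Set M)) (G := G)
  obtain ⟨i, hi⟩ := hcov 0
  obtain ⟨t, ht, h⟩ := mem_nhds_iff_exists_box.mp (inter_mem ((φ i).symm.continuousAt
      ((φ i).map_source hi) (by rwa [(φ i).left_inv hi]))
      ((φ i).open_target.mem_nhds ((φ i).map_source hi)))
  obtain ⟨s, hs, hst⟩ := exists_between ht
  have hlt : ∀ v : Fin d → M, (∀ j, φ i 0 j - s ≤ v j ∧ v j ≤ φ i 0 j + s) →
      (φ i).symm v ∈ U ∧ v ∈ (φ i).target := fun v hv => h v fun j =>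
    ⟨(sub_lt_sub_left hst _).trans_le (hv j).1, (hv j).2.trans_lt (add_lt_add_right hst _)⟩
  -- A closed cube in the chart: the coordinates of a definable curve in it are bounded, so they
  -- converge, and within the cube.
  refine ⟨{g | g ∈ (φ i).source ∧ ∀ j, φ i 0 j - s ≤ φ i g j ∧ φ i g j ≤ φ i 0 j + s},
    fun g hg => ?_, ?_, ?_, fun γ hγ hγK => ?_⟩
  · have := (hlt _ hg.2).1
    rwa [(φ i).left_inv hg.1] at this
  · refine mem_of_superset (((φ i).isOpen_inter_preimage (isOpen_box (φ i 0) s)).mem_nhds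
      ⟨hi, fun j => ⟨sub_lt_self _ hs, lt_add_of_pos_right _ hs⟩⟩) fun g hg => ?_
    exact ⟨hg.1, fun j => ⟨(hg.2 j).1.le, (hg.2 j).2.le⟩⟩
  · have h2 : DefP L univ fun z : G × (Fin d → M) =>
        ∀ j, φ i 0 j - s ≤ z.2 j ∧ z.2 j ≤ φ i 0 j + s := DefP.finite_forall fun j => by fun_prop
    refine DefP.congr (DefP.exists (T := G) (S := Fin d → M)
      (p := fun z v => (z ∈ (φ i).source ∧ φ i z = v) ∧
        ∀ j, φ i 0 j - s ≤ v j ∧ v j ≤ φ i 0 j + s) ((hdef i).and h2)) fun z => ?_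
    constructor
    · rintro ⟨h3, h4⟩
      exact ⟨_, ⟨h3, rfl⟩, h4⟩
    · rintro ⟨v, ⟨h3, rfl⟩, h4⟩
      exact ⟨h3, h4⟩
  · obtain ⟨f, hf, hfp⟩ := exists_defF_choice (L := L) (T := M) (S := Fin d → M)
      (p := fun t v => γ t ∈ (φ i).source ∧ φ i (γ t) = v)
      (DefP.comp (hdef i) (f := fun z : M × (Fin d → M) => (γ z.1, z.2)) (by fun_prop))
    have hfK : ∀ᶠ t in 𝓝[>] 0, γ t = (φ i).symm (f t) ∧
        ∀ j, φ i 0 j - s ≤ f t j ∧ f t j ≤ φ i 0 j + s := by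
      filter_upwards [hγK] with t ht
      obtain ⟨h1, h2⟩ := hfp t ⟨_, ht.1, rfl⟩
      refine ⟨by rw [← h2, (φ i).left_inv h1], ?_⟩
      rw [← h2]
      exact ht.2
    have hlim : ∀ j, ∃ l, φ i 0 j - s ≤ l ∧ l ≤ φ i 0 j + s ∧
        Tendsto (fun t => f t j) (𝓝[>] 0) (𝓝 l) := fun j =>
      exists_tendsto_nhdsGT (L := L) (hf.apply j) (hfK.mono fun t ht => ht.2 j)
    choose l hl1 hl2 hl using hlim
    have hlt' := hlt l fun j => ⟨hl1 j, hl2 j⟩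
    refine ⟨(φ i).symm l, ⟨(φ i).map_target hlt'.2, ?_⟩, ?_⟩
    · rw [(φ i).right_inv hlt'.2]
      exact fun j => ⟨hl1 j, hl2 j⟩
    · refine Tendsto.congr' (hfK.mono fun t ht => ht.1.symm) ?_
      exact ((φ i).symm.continuousAt hlt'.2).tendsto.comp (tendsto_pi_nhds.mpr hl)

theorem Tame.exists_of_finite {T : Type w} [Enc M T] [DefType L univ T] [TopologicalSpace T]
    (hT : Tame L T) {k : ℕ} {p : Fin k → T → Prop} (hp : ∀ i, DefP L univ (p i)) {U : Set T}
    (hU : IsOpen U) (hne : U.Nonempty) (h : ∀ t ∈ U, ∃ i, p i t) :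
    ∃ i, ∃ V ⊆ U, IsOpen V ∧ V.Nonempty ∧ ∀ t ∈ V, p i t := by
  induction k generalizing U with
  | zero =>
    obtain ⟨t, ht⟩ := hne
    exact (h t ht).choose.elim0
  | succ k ih =>
    obtain ⟨V, hVU, hV, hVne, hV'⟩ := hT.or (p 0) (fun t => ∃ i : Fin k, p i.succ t) (hp 0)
      (DefP.finite_exists fun i => hp i.succ) U hU hne fun t ht => by
        obtain ⟨i, hi⟩ := h t ht
        exact i.cases (fun h => Or.inl h) (fun i h => Or.inr ⟨i, h⟩) hi
    rcases hV' with hV' | hV'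
    · exact ⟨0, V, hVU, hV, hVne, hV'⟩
    · obtain ⟨i, W, hWV, hW⟩ := ih (p := fun i => p i.succ) (fun i => hp i.succ) hV hVne hV'
      exact ⟨i.succ, W, hWV.trans hVU, hW⟩

-- On some open set the values lie in a single chart, where generic continuity of coordinates
-- applies.
omit [IsTopologicalAddGroup G] in
theorem Tame.exists_continuousAt_group [DenselyOrdered M] {T : Type w} [Enc M T]
    [DefType L univ T] [TopologicalSpace T] [DefTop L T] (hT : Tame L T) {f : T → G}
    (hf : DefF L univ f) {U : Set T} (hU : IsOpen U) (hne : U.Nonempty) :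
    ∃ V ⊆ U, IsOpen V ∧ V.Nonempty ∧ ∀ t ∈ V, ContinuousAt f t := by
  obtain ⟨d, k, φ, hcov, hdef, h0⟩ := DefAtlas.exists_atlas (L := L) (A := (univ : Set M)) (G := G)
  have hg : ∀ i, DefP L univ fun z : T × (Fin d → M) => f z.1 ∈ (φ i).source ∧ φ i (f z.1) = z.2 :=
    fun i => DefP.comp (hdef i) (f := fun z : T × (Fin d → M) => (f z.1, z.2)) (by fun_prop)
  obtain ⟨i, V, hVU, hV, hVne, h⟩ := hT.exists_of_finite (p := fun i t => f t ∈ (φ i).source)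
    (fun i => (DefP.exists (hg i) (p := fun t v => f t ∈ (φ i).source ∧ φ i (f t) = v)).congr
      fun t => by simp) hU hne fun t _ => hcov (f t)
  obtain ⟨c, hc, hcp⟩ := exists_defF_choice (hg i)
    (p := fun t v => f t ∈ (φ i).source ∧ φ i (f t) = v)
  obtain ⟨W, hWV, hW, hWne, hWc⟩ := hT.exists_continuousAt_pi hc hV hVne
  refine ⟨W, hWV.trans hVU, hW, hWne, fun t ht => ?_⟩
  have heq : ∀ s ∈ W, (φ i).symm (c s) = f s ∧ c s ∈ (φ i).target := fun s hs => by
    obtain ⟨h1, h2⟩ := hcp s ⟨_, h s (hWV hs), rfl⟩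
    rw [← h2]
    exact ⟨(φ i).left_inv h1, (φ i).map_source h1⟩
  have h1 : ContinuousAt (fun s => (φ i).symm (c s)) t :=
    ContinuousAt.comp' ((φ i).symm.continuousAt (heq t ht).2) (hWc t ht)
  exact h1.congr (mem_of_superset (hW.mem_nhds ht) fun s hs => (heq s hs).1)

variable [DefAdd L univ G]

instance defTop_group : DefTop L G where
  exists_basis := by
    obtain ⟨V, hV, hVo, -, hVb⟩ := exists_defP_basis_zero (L := L) (A := (univ : Set M)) (G := G)
    refine ⟨M × G, inferInstance, inferInstance, fun e g => 0 < e.1 ∧ V e.1 (g - e.2), ?_, ?_, ?_⟩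
    · have : DefP L univ fun z : (M × G) × G => V z.1.1 (z.2 - z.1.2) :=
        DefP.comp hV (f := fun z : (M × G) × G => (z.1.1, z.2 - z.1.2)) (by fun_prop)
      fun_prop
    · intro e
      by_cases he : 0 < e.1
      · simpa [he] using (hVo e.1 he).1.preimage (continuous_id.sub (continuous_const (y := e.2)))
      · simp [he]
    · intro x U hU
      obtain ⟨t, ht, h⟩ := hVb ((fun g => g + x) ⁻¹' U)
        ((continuous_add_const x).continuousAt (by simpa using hU))
      refine ⟨(t, x), ⟨ht, by simpa using (hVo t ht).2⟩, fun y hy => ?_⟩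
      simpa using h _ hy.2

/-- The continuity points form a definable set, so near 0+ a curve is continuous or everywhere
discontinuous; generic continuity excludes the latter. -/
theorem eventually_continuousAt [DenselyOrdered M] {γ : M → G} (hγ : DefF L univ γ) :
    ∀ᶠ t in 𝓝[>] (0 : M), ContinuousAt γ t := by
  have htame : Tame L M := by
    refine (tame_pi (L := L) (M := M) 1).of_homeomorph (Homeomorph.funUnique (Fin 1) M).symm ?_
    exact (IsCoord.apply (0 : Fin 1)).defF
  obtain ⟨E, _, _, B, hB, hBo, hBb⟩ := (defTop_group (L := L) (M := M) (G := G)).exists_basis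
  have hB' : DefP L univ fun z : (M × E) × M => B z.1.2 (γ z.2) :=
    DefP.comp hB (f := fun z : (M × E) × M => (z.1.2, γ z.2)) (by fun_prop)
  have hB'' : DefP L univ fun z : M × E => B z.2 (γ z.1) :=
    DefP.comp hB (f := fun z : M × E => (z.2, γ z.1)) (by fun_prop)
  have h1 : DefP L univ fun t => ContinuousAt γ t := by
    have : DefP L univ fun t => ∀ e, B e (γ t) → ∀ᶠ s in 𝓝 t, B e (γ s) := by fun_prop
    refine this.congr fun t => ⟨fun h e he => h ((hBo e).mem_nhds he), fun h U hU => ?_⟩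
    obtain ⟨e, he, heU⟩ := hBb _ U hU
    exact (h e he).mono fun s hs => heU _ hs
  refine (eventually_nhdsGT_or h1 0).resolve_right fun h => ?_
  obtain ⟨b, hb, h⟩ := eventually_nhdsGT_iff.mp h
  obtain ⟨V, hVU, hV, ⟨t, ht⟩, hVc⟩ := htame.exists_continuousAt_group hγ isOpen_Ioo
    (nonempty_Ioo.mpr hb)
  exact h t (hVU ht).1 (hVU ht).2 (hVc t ht)

/-- Curve selection at `0`, for pairs. -/
theorem exists_curve_prod {p : G → G → Prop} (hp : DefP L univ fun z : G × G => p z.1 z.2)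
    (h : ∀ U ∈ 𝓝 (0 : G), ∃ a ∈ U, ∃ b ∈ U, p a b) :
    ∃ α β : M → G, DefF L univ α ∧ DefF L univ β ∧ (∀ᶠ t in 𝓝[>] 0, p (α t) (β t)) ∧
      Tendsto α (𝓝[>] 0) (𝓝 0) ∧ Tendsto β (𝓝[>] 0) (𝓝 0) := by
  obtain ⟨V, hV, hVo, hVm, hVb⟩ := exists_defP_basis_zero (L := L) (A := (univ : Set M)) (G := G)
  -- One pair is chosen in each basic neighbourhood of radius t, so both curves tend to 0 with t.
  obtain ⟨γ, hγ, hγp⟩ := exists_defF_choice (L := L) (T := M) (S := G × G)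
    (p := fun t z => V t z.1 ∧ V t z.2 ∧ p z.1 z.2)
    ((DefP.comp hV (f := fun z : M × (G × G) => (z.1, z.2.1)) (by fun_prop)).and
      ((DefP.comp hV (f := fun z : M × (G × G) => (z.1, z.2.2)) (by fun_prop)).and
        (DefP.comp hp (f := fun z : M × (G × G) => z.2) (by fun_prop))))
  have hγ' : ∀ t, 0 < t → V t (γ t).1 ∧ V t (γ t).2 ∧ p (γ t).1 (γ t).2 := fun t ht => hγp t (by
    obtain ⟨a, ha, b, hb, hab⟩ := h _ ((hVo t ht).1.mem_nhds (hVo t ht).2)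
    exact ⟨(a, b), ha, hb, hab⟩)
  have hlim : ∀ f : M → G, (∀ t, 0 < t → V t (f t)) → Tendsto f (𝓝[>] 0) (𝓝 0) := by
    intro f hf U hU
    obtain ⟨t, ht, hU⟩ := hVb U hU
    refine eventually_nhdsGT_iff.mpr ⟨t, ht, fun s hs hst => hU _ (hVm s t _ hst.le (hf s hs))⟩
  refine ⟨fun t => (γ t).1, fun t => (γ t).2, by fun_prop, by fun_prop, ?_,
    hlim _ fun t ht => (hγ' t ht).1, hlim _ fun t ht => (hγ' t ht).2.1⟩
  filter_upwards [self_mem_nhdsWithin] with t ht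
  exact (hγ' t ht).2.2

/-- Curve selection at `0`. -/
theorem exists_curve {p : G → Prop} (hp : DefP L univ p) (h : ∃ᶠ g in 𝓝 (0 : G), p g) :
    ∃ γ : M → G, DefF L univ γ ∧ (∀ᶠ t in 𝓝[>] 0, p (γ t)) ∧ Tendsto γ (𝓝[>] 0) (𝓝 0) := by
  obtain ⟨α, β, hα, -, h1, h2, -⟩ := exists_curve_prod (L := L) (p := fun a _ : G => p a)
    (by fun_prop) fun U hU => by
      obtain ⟨a, ha, haU⟩ := (h.and_eventually hU).exists
      exact ⟨a, haU, 0, mem_of_mem_nhds hU, ha⟩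
  exact ⟨α, hα, h1, h2⟩

end Groups

/-! ### Local subgroups and the curve criterion -/

section Germs

variable (L : FirstOrder.Language.{u, v}) {M : Type w} [L.Structure M]
  {G : Type w} [AddCommGroup G] [TopologicalSpace G] [Enc M G]

/-- A definable set whose germ at `0` is that of a locally closed local subgroup. -/
structure LocSubgroup (W : Set G) : Prop where
  defP : DefP L univ (· ∈ W)
  zero_mem : (0 : G) ∈ W
  exists_open : ∃ U, IsOpen U ∧ (0 : G) ∈ U ∧ (∀ u ∈ U, u ∈ closure W → u ∈ W) ∧
    ∀ x ∈ W, x ∈ U → ∀ y ∈ W, y ∈ U → x - y ∈ W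

/-- Every translate of the definable set `C` to `0` has its germ contained in that of `W`. -/
structure GermIn (C W : Set G) : Prop where
  defP : DefP L univ (· ∈ C)
  germ : ∀ c ∈ C, ∀ᶠ v in 𝓝 (0 : G), v + c ∈ C → v ∈ W

/-- Definable curves in `C` locally move along `W`. -/
def CurvesIn [LinearOrder M] [Zero M] [TopologicalSpace M] (C W : Set G) : Prop :=
  ∀ γ : M → G, DefF L univ γ → (∀ᶠ t in 𝓝[>] (0 : M), γ t ∈ C) →
    ∀ᶠ t in 𝓝[>] (0 : M), ∀ᶠ s in 𝓝 t, γ s - γ t ∈ W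

variable {L}
variable [AddCommGroup M] [LinearOrder M] [hM : Fact (OMinimalGroupExpansion L M)]
  [IsOrderedAddMonoid M] [Nontrivial M] [TopologicalSpace M] [OrderTopology M]
  [IsTopologicalAddGroup G] [DefType L univ G] [DefAtlas L univ G] [DefAdd L univ G]

omit [IsOrderedAddMonoid M] hM [Nontrivial M] [DefType L univ G] [DefAtlas L univ G]
  [DefAdd L univ G] [LinearOrder M] [TopologicalSpace M] [OrderTopology M] [AddCommGroup M] in
theorem LocSubgroup.exists_open_symm {W : Set G} (hW : LocSubgroup L W) :
    ∃ U, IsOpen U ∧ (0 : G) ∈ U ∧ (∀ u ∈ U, u ∈ closure W → u ∈ W) ∧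
      (∀ x ∈ W, x ∈ U → -x ∈ W) ∧ (∀ x ∈ W, x ∈ U → ∀ y ∈ W, y ∈ U → x - y ∈ W) ∧
      ∀ x ∈ W, x ∈ U → ∀ y ∈ W, y ∈ U → x + y ∈ W := by
  obtain ⟨U, hU, h0, hcl, hsub⟩ := hW.exists_open
  have hneg : ∀ x ∈ W, x ∈ U ∩ -U → -x ∈ W := fun x hx hxU => by
    simpa using hsub 0 hW.zero_mem h0 x hx hxU.1
  refine ⟨U ∩ -U, hU.inter hU.neg, ⟨h0, by simpa using h0⟩, fun u hu => hcl u hu.1, hneg,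
    fun x hx hxU y hy hyU => hsub x hx hxU.1 y hy hyU.1, fun x hx hxU y hy hyU => ?_⟩
  simpa using hsub x hx hxU.1 (-y) (hneg y hy hyU) hyU.2

/-- A definable continuous curve which locally moves along `W` and meets `W` stays in `W`. -/
theorem forall_mem_of_locally_mem [DenselyOrdered M] {W U : Set G} (hW : DefP L univ (· ∈ W))
    (hcl : ∀ u ∈ U, u ∈ closure W → u ∈ W)
    (hadd : ∀ w ∈ W, w ∈ U → ∀ᶠ ξ in 𝓝 (0 : G), ξ ∈ W → w + ξ ∈ W) {γ : M → G}
    (hγ : DefF L univ γ) (z : G) {b s₀ : M} (hs₀ : 0 < s₀) (hs₀b : s₀ < b)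
    (hc : ∀ s, 0 < s → s < b → ContinuousAt γ s)
    (hloc : ∀ s, 0 < s → s < b → ∀ᶠ s' in 𝓝 s, γ s' - γ s ∈ W)
    (hU : ∀ s, 0 < s → s < b → z + γ s ∈ U) (h₀ : z + γ s₀ ∈ W) :
    ∀ s, 0 < s → s < b → z + γ s ∈ W := by
  refine forall_Ioo_of_clopen (L := L) (p := fun s => z + γ s ∈ W) (by fun_prop) hs₀ hs₀b h₀
    (fun s h1 h2 hs => ?_) (fun s h1 h2 hs => ?_)
  · have hlim : Tendsto (fun s' => γ s' - γ s) (𝓝 s) (𝓝 0) := by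
      simpa using (hc s h1 h2).tendsto.sub_const (γ s)
    filter_upwards [hlim.eventually (hadd _ hs (hU s h1 h2)), hloc s h1 h2] with s' h3 h4
    have := h3 h4
    rwa [show z + γ s + (γ s' - γ s) = z + γ s' by abel] at this
  · have hn : z + γ s ∈ (closure W)ᶜ := fun h => hs (hcl _ (hU s h1 h2) h)
    have hlim : ContinuousAt (fun s' => z + γ s') s := continuousAt_const.add (hc s h1 h2)
    exact (hlim.eventually (isClosed_closure.isOpen_compl.mem_nhds hn)).mono
      fun s' h3 h4 => h3 (subset_closure h4)

/-- Otherwise curve selection gives ν → 0 in C - c avoiding W. By connectedness ν(s) - ν(t) stays in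
W for s in an interval (0, b). As s → 0 this tends to -ν(t), which lies in W by local closedness,
hence so does ν(t). -/
theorem LocSubgroup.eventually_of_curvesIn [DenselyOrdered M] {W C : Set G}
    (hW : LocSubgroup L W) (hC : DefP L univ (· ∈ C)) (hcur : CurvesIn L C W) (c : G) :
    ∀ᶠ v in 𝓝 (0 : G), v + c ∈ C → v ∈ W := by
  by_contra hcon
  have hWd := hW.defP
  obtain ⟨ν, hν, hνp, hνlim⟩ := exists_curve (L := L) (p := fun v => v + c ∈ C ∧ v ∉ W)
    (by fun_prop) fun h => hcon (h.mono fun v hv h1 => by by_contra h2; exact hv ⟨h1, h2⟩)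
  obtain ⟨U, hUo, h0U, hcl, hneg, hsub, hadd⟩ := hW.exists_open_symm
  obtain ⟨O, hO, hOU⟩ := exists_nhds_half_neg (hUo.mem_nhds h0U)
  have hloc := hcur (fun t => ν t + c) (by fun_prop) (hνp.mono fun t ht => ht.1)
  obtain ⟨b, hb, hall⟩ := eventually_nhdsGT_iff.mp
    ((hνlim.eventually hO).and ((eventually_continuousAt hν).and (hloc.and hνp)))
  obtain ⟨t, ht, htb⟩ := exists_between hb
  have hmem := forall_mem_of_locally_mem hWd hcl
    (fun w hw hwU => Eventually.mono (show ∀ᶠ ξ in 𝓝 (0 : G), ξ ∈ U from hUo.mem_nhds h0U)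
      fun ξ hξU hξ => hadd w hw hwU ξ hξ hξU) hν (-ν t) ht htb
    (fun s h1 h2 => (hall s h1 h2).2.1)
    (fun s h1 h2 => (hall s h1 h2).2.2.1.mono fun s' h => by simpa using h)
    (fun s h1 h2 => by
      rw [neg_add_eq_sub]
      exact hOU _ (hall s h1 h2).1 _ (hall t ht htb).1)
    (by simpa using hW.zero_mem)
  have hU' : -ν t ∈ U := by simpa using hOU 0 (mem_of_mem_nhds hO) _ (hall t ht htb).1
  have hclos : -ν t ∈ closure W := by
    have hlim : Tendsto (fun s => -ν t + ν s) (𝓝[>] 0) (𝓝 (-ν t)) := by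
      simpa using hνlim.const_add (-ν t)
    exact mem_closure_of_tendsto hlim (eventually_nhdsGT_iff.mpr ⟨b, hb, hmem⟩)
  have := hneg _ (hcl _ hU' hclos) hU'
  exact (hall t ht htb).2.2.2.2 (by simpa using this)

/-- By continuity the increments γ(s) - γ(t) are small, so the germ at γ(t) applies to them. -/
theorem GermIn.curvesIn [DenselyOrdered M] {C W : Set G} (h : GermIn L C W) : CurvesIn L C W := by
  intro γ hγ hC
  obtain ⟨b, hb, hall⟩ := eventually_nhdsGT_iff.mp (hC.and (eventually_continuousAt hγ))
  refine eventually_nhdsGT_iff.mpr ⟨b, hb, fun t h1 h2 => ?_⟩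
  have hlim : Tendsto (fun s => γ s - γ t) (𝓝 t) (𝓝 0) := by
    simpa using (hall t h1 h2).2.tendsto.sub_const (γ t)
  filter_upwards [hlim.eventually (h.germ _ (hall t h1 h2).1), Ioo_mem_nhds h1 h2] with s h3 h4
  exact h3 (by simpa using (hall s h4.1 h4.2).1)

theorem GermIn.of_curvesIn [DenselyOrdered M] {C W : Set G} (hW : LocSubgroup L W)
    (hC : DefP L univ (· ∈ C)) (hcur : CurvesIn L C W) : GermIn L C W :=
  ⟨hC, fun c _ => hW.eventually_of_curvesIn hC hcur c⟩

omit [LinearOrder M] [IsOrderedAddMonoid M] [Nontrivial M] [TopologicalSpace M]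
  [OrderTopology M] [AddCommGroup M] hM [TopologicalSpace G] [IsTopologicalAddGroup G]
  [DefType L univ G] [DefAtlas L univ G] [DefAdd L univ G] in
theorem DefP.mem_add {B : Set M} [DefType L B G] [DefAdd L B G] {X Y : Set G}
    (hX : DefP L B (· ∈ X)) (hY : DefP L B (· ∈ Y)) : DefP L B (· ∈ X + Y) := by
  have : DefP L B fun z => ∃ x y, x ∈ X ∧ y ∈ Y ∧ x + y = z := by fun_prop
  exact this.congr fun z => by simp only [Set.mem_add]; grind

/-- Definable choice lifts a curve in X + Y to curves in X and in Y; their increments are small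
elements of W, so their sum is in W. -/
theorem GermIn.add [DenselyOrdered M] {X Y W : Set G} (hW : LocSubgroup L W) (hX : GermIn L X W)
    (hY : GermIn L Y W) : GermIn L (X + Y) W := by
  have hXd := hX.defP
  have hYd := hY.defP
  refine GermIn.of_curvesIn hW (hXd.mem_add hYd) fun γ hγ hC => ?_
  obtain ⟨f, hf, hfp⟩ := exists_defF_choice (L := L) (T := M) (S := G × G)
    (p := fun t z => (z.1 ∈ X ∧ z.2 ∈ Y) ∧ z.1 + z.2 = γ t) (by fun_prop)
  have hall' : ∀ᶠ t in 𝓝[>] 0, ((f t).1 ∈ X ∧ (f t).2 ∈ Y) ∧ (f t).1 + (f t).2 = γ t := by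
    filter_upwards [hC] with t ht
    obtain ⟨x, hx, y, hy, hxy⟩ := ht
    exact hfp t ⟨(x, y), ⟨hx, hy⟩, hxy⟩
  have h1 : DefF L univ fun t => (f t).1 := by fun_prop
  have h2 : DefF L univ fun t => (f t).2 := by fun_prop
  have l1 := hX.curvesIn _ h1 (hall'.mono fun t ht => ht.1.1)
  have l2 := hY.curvesIn _ h2 (hall'.mono fun t ht => ht.1.2)
  obtain ⟨U, hUo, h0U, -, -, -, hadd⟩ := hW.exists_open_symm
  obtain ⟨b, hb, hall⟩ := eventually_nhdsGT_iff.mp (hall'.and (l1.and (l2.and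
    ((eventually_continuousAt h1).and (eventually_continuousAt h2)))))
  refine eventually_nhdsGT_iff.mpr ⟨b, hb, fun t ht htb => ?_⟩
  obtain ⟨ht1, ht2, ht3, ht4, ht5⟩ := hall t ht htb
  have lim1 : Tendsto (fun s => (f s).1 - (f t).1) (𝓝 t) (𝓝 0) := by
    simpa using ht4.tendsto.sub_const (f t).1
  have lim2 : Tendsto (fun s => (f s).2 - (f t).2) (𝓝 t) (𝓝 0) := by
    simpa using ht5.tendsto.sub_const (f t).2
  filter_upwards [Ioo_mem_nhds ht htb, ht2, ht3, lim1.eventually (hUo.mem_nhds h0U),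
    lim2.eventually (hUo.mem_nhds h0U)] with s hs h3 h4 h5 h6
  have := hadd _ h3 h5 _ h4 h6
  rwa [sub_add_sub_comm, ht1.2, (hall s hs.1 hs.2).1.2] at this

theorem GermIn.neg [DenselyOrdered M] {X W : Set G} (hW : LocSubgroup L W) (hX : GermIn L X W) :
    GermIn L (-X) W := by
  have hXd := hX.defP
  refine GermIn.of_curvesIn hW (DefP.comp hXd (f := fun x : G => -x) (by fun_prop))
    fun γ hγ hC => ?_
  have h1 : DefF L univ fun t => -γ t := by fun_prop
  obtain ⟨U, hUo, h0U, -, hneg, -⟩ := hW.exists_open_symm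
  filter_upwards [hX.curvesIn _ h1 hC, eventually_continuousAt hγ] with t ht hct
  have lim1 : Tendsto (fun s => -γ s - -γ t) (𝓝 t) (𝓝 0) := by
    simpa using hct.tendsto.neg.sub_const (-γ t)
  filter_upwards [ht, lim1.eventually (hUo.mem_nhds h0U)] with s hs hsU
  have := hneg _ hs hsU
  rwa [neg_sub_neg, neg_sub] at this

/-- Near 0+ a definable curve stays in X or stays outside X. -/
theorem GermIn.union [DenselyOrdered M] {X Y W : Set G} (hW : LocSubgroup L W)
    (hX : GermIn L X W) (hY : GermIn L Y W) : GermIn L (X ∪ Y) W := by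
  have hXd := hX.defP
  have hYd := hY.defP
  refine GermIn.of_curvesIn hW (hXd.or hYd) fun γ hγ hC => ?_
  rcases eventually_nhdsGT_or (L := L) (p := fun t => γ t ∈ X) (by fun_prop) 0 with h | h
  · exact hX.curvesIn γ hγ h
  · exact hY.curvesIn γ hγ (by filter_upwards [h, hC] with t h1 h2 using h2.resolve_left h1)

/-- A definable set which near each of its points looks as at `0` is locally closed at `0`. -/
theorem exists_open_closed_of_homogeneous [DenselyOrdered M] {X : Set G}
    (hX : DefP L univ (· ∈ X)) (h0 : (0 : G) ∈ X)
    (h : ∀ x ∈ X, ∀ᶠ v in 𝓝 (0 : G), v + x ∈ X ↔ v ∈ X) :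
    ∃ U, IsOpen U ∧ (0 : G) ∈ U ∧ ∀ u ∈ U, u ∈ closure X → u ∈ X := by
  obtain ⟨d, k, φ, hcov, hdef, -⟩ := DefAtlas.exists_atlas (L := L) (A := (univ : Set M)) (G := G)
  obtain ⟨i, hi⟩ := hcov 0
  have hd : DefP L univ fun v : Fin d → M => ∃ g, (g ∈ (φ i).source ∧ φ i g = v) ∧ g ∈ X := by
    have := DefP.comp (hdef i) (f := fun z : (Fin d → M) × G => (z.2, z.1)) (by fun_prop)
    exact DefP.exists (p := fun v g => (g ∈ (φ i).source ∧ φ i g = v) ∧ g ∈ X)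
      (DefP.and this (DefP.comp hX (f := fun z : (Fin d → M) × G => z.2) (by fun_prop)))
  have hne : {v : Fin d → M | ∃ g, (g ∈ (φ i).source ∧ φ i g = v) ∧ g ∈ X}.Nonempty :=
    ⟨φ i 0, 0, ⟨hi, rfl⟩, h0⟩
  -- Local closedness is known only near some point x of the set; homogeneity transports it to 0.
  obtain ⟨U, hU, ⟨_, ⟨x, ⟨hxs, rfl⟩, hxX⟩, hxU⟩, hcl⟩ :=
    exists_open_relatively_closed (L := L) hd hne
  have hclX : ∀ u, u ∈ (φ i).source → φ i u ∈ U → u ∈ closure X → u ∈ X := by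
    intro u hus huU huX
    have h1 : u ∈ closure ((φ i).source ∩ X) := (φ i).open_source.inter_closure ⟨hus, huX⟩
    have hsub : φ i '' ((φ i).source ∩ X) ⊆ {v | ∃ g, (g ∈ (φ i).source ∧ φ i g = v) ∧ g ∈ X} := by
      rintro _ ⟨g, hg, rfl⟩
      exact ⟨g, ⟨hg.1, rfl⟩, hg.2⟩
    have h2 := closure_mono hsub
      (((φ i).continuousAt hus).continuousWithinAt.mem_closure_image h1)
    obtain ⟨g, ⟨hgs, hgu⟩, hgX⟩ := hcl _ huU h2
    rwa [← (φ i).injOn hgs hus hgu]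
  obtain ⟨N, hN, hNo, hN0⟩ := eventually_nhds_iff.mp (h x hxX)
  have hopen : IsOpen ((φ i).source ∩ φ i ⁻¹' U) := (φ i).isOpen_inter_preimage hU
  refine ⟨N ∩ (fun v => v + x) ⁻¹' ((φ i).source ∩ φ i ⁻¹' U),
    hNo.inter (hopen.preimage (continuous_add_const x)), ⟨hN0, by simpa using ⟨hxs, hxU⟩⟩, ?_⟩
  rintro u ⟨huN, hu1, hu2⟩ huX
  rw [← hN u huN]
  refine hclX _ hu1 hu2 ?_
  have h1 : u ∈ closure (N ∩ X) := hNo.inter_closure ⟨huN, huX⟩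
  refine closure_mono (image_subset_iff.mpr fun v hv => ?_)
    ((continuous_add_const x).continuousAt.continuousWithinAt.mem_closure_image h1)
  exact (hN v hv.1).mpr hv.2

/-- Suppose curves α, β → 0 in X have α - β outside X. Connectedness along s ↦ β(s) - β(t) and local
closedness give -β(t) ∈ X. Homogeneity at α(t) then puts α(t) - β(s) in X for some small s, and
connectedness along s ↦ α(t) - β(s) carries this to s = t. -/
theorem locSubgroup_of_homogeneous [DenselyOrdered M] {X : Set G}
    (hX : DefP L univ (· ∈ X)) (h0 : (0 : G) ∈ X)
    (h : ∀ x ∈ X, ∀ᶠ v in 𝓝 (0 : G), v + x ∈ X ↔ v ∈ X) : LocSubgroup L X := by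
  obtain ⟨U, hUo, h0U, hcl⟩ := exists_open_closed_of_homogeneous hX h0 h
  have hX' : GermIn L X X := ⟨hX, fun x hx => (h x hx).mono fun v hv => hv.mp⟩
  have hadd : ∀ w ∈ X, w ∈ U → ∀ᶠ ξ in 𝓝 (0 : G), ξ ∈ X → w + ξ ∈ X := fun w hw _ =>
    (h w hw).mono fun ξ hξ hξX => by rw [add_comm]; exact hξ.mpr hξX
  suffices hs : ∃ V ∈ 𝓝 (0 : G), ∀ x ∈ X, x ∈ V → ∀ y ∈ X, y ∈ V → x - y ∈ X by
    obtain ⟨V, hV, hs⟩ := hs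
    refine ⟨hX, h0, U ∩ interior V, hUo.inter isOpen_interior,
      ⟨h0U, mem_interior_iff_mem_nhds.mpr hV⟩, fun u hu => hcl u hu.1, fun x hx hxV y hy hyV =>
        hs x hx (interior_subset hxV.2) y hy (interior_subset hyV.2)⟩
  by_contra hcon
  push Not at hcon
  obtain ⟨α, β, hα, hβ, hp, hα0, hβ0⟩ := exists_curve_prod (L := L)
    (p := fun a b => a ∈ X ∧ b ∈ X ∧ a - b ∉ X) (by fun_prop) fun V hV => by
      obtain ⟨x, hx, hxV, y, hy, hyV, hxy⟩ := hcon V hV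
      exact ⟨x, hxV, y, hyV, hx, hy, hxy⟩
  obtain ⟨O, hO, hOU⟩ := exists_nhds_half_neg (hUo.mem_nhds h0U)
  have hβn : DefF L univ fun t => -β t := by fun_prop
  have hβn0 : Tendsto (fun t => -β t) (𝓝[>] 0) (𝓝 0) := by simpa using hβ0.neg
  have hnegX : ∀ᶠ t in 𝓝[>] (0 : M), -β t ∈ X := by
    obtain ⟨b, hb, hall⟩ := eventually_nhdsGT_iff.mp ((hβ0.eventually hO).and
      ((eventually_continuousAt hβ).and (hX'.curvesIn β hβ (hp.mono fun t ht => ht.2.1))))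
    refine eventually_nhdsGT_iff.mpr ⟨b, hb, fun t ht htb => ?_⟩
    have hmem := forall_mem_of_locally_mem hX hcl hadd hβ (-β t) ht htb
      (fun s h1 h2 => (hall s h1 h2).2.1) (fun s h1 h2 => (hall s h1 h2).2.2)
      (fun s h1 h2 => by
        rw [neg_add_eq_sub]
        exact hOU _ (hall s h1 h2).1 _ (hall t ht htb).1) (by simpa using h0)
    refine hcl _ (by simpa using hOU 0 (mem_of_mem_nhds hO) _ (hall t ht htb).1) ?_
    have hlim : Tendsto (fun s => -β t + β s) (𝓝[>] 0) (𝓝 (-β t)) := by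
      simpa using hβ0.const_add (-β t)
    exact mem_closure_of_tendsto hlim (eventually_nhdsGT_iff.mpr ⟨b, hb, hmem⟩)
  obtain ⟨b, hb, hall⟩ := eventually_nhdsGT_iff.mp ((hα0.eventually hO).and
    ((hβ0.eventually hO).and ((eventually_continuousAt hβn).and
      ((hX'.curvesIn _ hβn hnegX).and hp))))
  obtain ⟨t, ht, htb⟩ := exists_between hb
  obtain ⟨s₀, ⟨hs₀, hs₀X⟩, hs₀0, hs₀b⟩ := (((hβn0.eventually (h _ (hall t ht htb).2.2.2.2.1)).and
    hnegX).and (Ioo_mem_nhdsGT hb)).exists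
  have := forall_mem_of_locally_mem hX hcl hadd hβn (α t) hs₀0 hs₀b
    (fun s h1 h2 => (hall s h1 h2).2.2.1) (fun s h1 h2 => (hall s h1 h2).2.2.2.1)
    (fun s h1 h2 => by
      rw [← sub_eq_add_neg]
      exact hOU _ (hall t ht htb).1 _ (hall s h1 h2).2.1)
    (by rw [add_comm]; exact hs₀.mpr hs₀X) t ht htb
  exact (hall t ht htb).2.2.2.2.2.2 (by rwa [sub_eq_add_neg])

/-- Local subgroups have a sum, whose elements near `0` are sums of elements near `0`. -/
theorem LocSubgroup.exists_add [DenselyOrdered M] {X Y : Set G} (hX : LocSubgroup L X)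
    (hY : LocSubgroup L Y) : ∃ W, LocSubgroup L W ∧ (∀ᶠ v in 𝓝 (0 : G), v ∈ X → v ∈ W) ∧
      (∀ᶠ v in 𝓝 (0 : G), v ∈ Y → v ∈ W) ∧ ∀ V ∈ 𝓝 (0 : G), ∀ᶠ v in 𝓝 (0 : G), v ∈ W →
        ∃ x ∈ V, ∃ y ∈ V, x ∈ X ∧ y ∈ Y ∧ x + y = v := by
  have := t2Space_of_defAtlas L M G
  have hXd := hX.defP
  have hYd := hY.defP
  obtain ⟨U₁, hU₁, h0₁, hcl₁, -, hsub₁, -⟩ := hX.exists_open_symm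
  obtain ⟨U₂, hU₂, h0₂, hcl₂, -, hsub₂, -⟩ := hY.exists_open_symm
  obtain ⟨K, hKU, hK, hKd, hKc⟩ := exists_defP_nhds_curves_converge (L := L)
    (inter_mem (hU₁.mem_nhds h0₁) (hU₂.mem_nhds h0₂))
  have hXK : DefP L univ (· ∈ X ∩ K) := hXd.and hKd
  have hYK : DefP L univ (· ∈ Y ∩ K) := hYd.and hKd
  have hWd : DefP L univ (· ∈ X ∩ K + Y ∩ K) := hXK.mem_add hYK
  -- A curve in the sum lifts to curves in the summands; these converge in `K`, and to points of X
  -- and Y by local closedness.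
  have hlim : ∀ γ : M → G, DefF L univ γ → (∀ᶠ t in 𝓝[>] 0, γ t ∈ X ∩ K + Y ∩ K) →
      ∃ α β : M → G, ∃ a ∈ X ∩ K, ∃ b ∈ Y ∩ K, Tendsto α (𝓝[>] 0) (𝓝 a) ∧
        Tendsto β (𝓝[>] 0) (𝓝 b) ∧
        ∀ᶠ t in 𝓝[>] 0, (α t ∈ X ∩ K ∧ β t ∈ Y ∩ K) ∧ α t + β t = γ t := by
    intro γ hγ hγW
    obtain ⟨f, hf, hfp⟩ := exists_defF_choice (L := L) (T := M) (S := G × G)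
      (p := fun t z => (z.1 ∈ X ∩ K ∧ z.2 ∈ Y ∩ K) ∧ z.1 + z.2 = γ t) (by fun_prop)
    have hall : ∀ᶠ t in 𝓝[>] 0, ((f t).1 ∈ X ∩ K ∧ (f t).2 ∈ Y ∩ K) ∧ (f t).1 + (f t).2 = γ t := by
      filter_upwards [hγW] with t ht
      obtain ⟨x, hx, y, hy, hxy⟩ := ht
      exact hfp t ⟨(x, y), ⟨hx, hy⟩, hxy⟩
    obtain ⟨a, ha, hfa⟩ := hKc (fun t => (f t).1) (by fun_prop) (hall.mono fun t ht => ht.1.1.2)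
    obtain ⟨b, hb, hfb⟩ := hKc (fun t => (f t).2) (by fun_prop) (hall.mono fun t ht => ht.1.2.2)
    refine ⟨_, _, a, ⟨hcl₁ a (hKU ha).1 ?_, ha⟩, b, ⟨hcl₂ b (hKU hb).2 ?_, hb⟩, hfa, hfb, hall⟩
    · exact mem_closure_of_tendsto hfa (hall.mono fun t ht => ht.1.1.1)
    · exact mem_closure_of_tendsto hfb (hall.mono fun t ht => ht.1.2.1)
  have hclosed : ∀ u, u ∈ closure (X ∩ K + Y ∩ K) → u ∈ X ∩ K + Y ∩ K := by
    intro u hu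
    obtain ⟨ν, hν, hνp, hν0⟩ := exists_curve (L := L) (p := fun v => v + u ∈ X ∩ K + Y ∩ K)
      (by fun_prop) fun hcon => by
        have h1 : Tendsto (fun v => v - u) (𝓝 u) (𝓝 0) := by
          simpa using (continuous_sub_right u).tendsto u
        obtain ⟨v, hv1, hv2⟩ := (mem_closure_iff_frequently.mp hu).and_eventually
          (h1.eventually hcon) |>.exists
        exact hv2 (by simpa using hv1)
    obtain ⟨α, β, a, ha, b, hb, hαa, hβb, hall⟩ := hlim (fun t => ν t + u) (by fun_prop) hνp
    have h1 : Tendsto (fun t => ν t + u) (𝓝[>] 0) (𝓝 u) := by simpa using hν0.add_const u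
    have h2 : Tendsto (fun t => ν t + u) (𝓝[>] 0) (𝓝 (a + b)) :=
      (hαa.add hβb).congr' (hall.mono fun t ht => ht.2)
    rw [tendsto_nhds_unique h1 h2]
    exact add_mem_add ha hb
  -- A curve ν → 0 in the sum lifts to α → a and β → b with a + b = 0, so ν = (α - a) + (β - b) is a
  -- decomposition into small elements, which stay in X and Y by the local subgroup property.
  have hsplit : ∀ V ∈ 𝓝 (0 : G), ∀ᶠ v in 𝓝 (0 : G), v ∈ X ∩ K + Y ∩ K →
      ∃ x ∈ V, ∃ y ∈ V, x ∈ X ∧ y ∈ Y ∧ x + y = v := by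
    intro V hV
    obtain ⟨V', hV'V, hV'o, h0V', hV'd⟩ := exists_defP_isOpen_subset (L := L) hV
    by_contra hcon
    have hd : DefP L univ fun v => ∃ x y : G,
      (x ∈ V' ∧ y ∈ V') ∧ (x ∈ X ∧ y ∈ Y) ∧ x + y = v := by fun_prop
    obtain ⟨ν, hν, hνp, hν0⟩ := exists_curve (L := L) (p := fun v => v ∈ X ∩ K + Y ∩ K ∧
      ¬ ∃ x y : G, (x ∈ V' ∧ y ∈ V') ∧ (x ∈ X ∧ y ∈ Y) ∧ x + y = v) (by fun_prop)
      fun h => hcon (h.mono fun v hv h1 => by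
        by_contra h2
        refine hv ⟨h1, fun ⟨x, y, ⟨hx, hy⟩, ⟨hx', hy'⟩, hxy⟩ => ?_⟩
        exact h2 ⟨x, hV'V hx, y, hV'V hy, hx', hy', hxy⟩)
    obtain ⟨α, β, a, ha, b, hb, hαa, hβb, hall⟩ := hlim ν hν (hνp.mono fun t ht => ht.1)
    have hab : a + b = 0 := tendsto_nhds_unique
      ((hαa.add hβb).congr' (hall.mono fun t ht => ht.2)) hν0
    have l1 : Tendsto (fun t => α t - a) (𝓝[>] 0) (𝓝 0) := by simpa using hαa.sub_const a
    have l2 : Tendsto (fun t => β t - b) (𝓝[>] 0) (𝓝 0) := by simpa using hβb.sub_const b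
    obtain ⟨t, ht1, ht2, ht3, ht4⟩ := (hνp.and (hall.and
      ((l1.eventually (hV'o.mem_nhds h0V')).and (l2.eventually (hV'o.mem_nhds h0V'))))).exists
    refine ht1.2 ⟨α t - a, β t - b, ⟨ht3, ht4⟩, ⟨?_, ?_⟩, ?_⟩
    · exact hsub₁ _ ht2.1.1.1 (hKU ht2.1.1.2).1 _ ha.1 (hKU ha.2).1
    · exact hsub₂ _ ht2.1.2.1 (hKU ht2.1.2.2).2 _ hb.1 (hKU hb.2).2
    · rw [sub_add_sub_comm, hab, sub_zero, ht2.2]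
  have hK0 : (0 : G) ∈ K := mem_of_mem_nhds hK
  refine ⟨X ∩ K + Y ∩ K, ⟨hWd, ?_, ?_⟩, ?_, ?_, hsplit⟩
  · exact ⟨0, ⟨hX.zero_mem, hK0⟩, 0, ⟨hY.zero_mem, hK0⟩, add_zero 0⟩
  · obtain ⟨V, hV, hVK⟩ := exists_nhds_half_neg hK
    obtain ⟨N, hN, hNo, hN0⟩ := eventually_nhds_iff.mp (hsplit _ (inter_mem hV hK))
    refine ⟨N, hNo, hN0, fun u _ => hclosed u, fun w hw hwN w' hw' hwN' => ?_⟩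
    obtain ⟨x, hxV, y, hyV, hx, hy, rfl⟩ := hN w hwN hw
    obtain ⟨x', hxV', y', hyV', hx', hy', rfl⟩ := hN w' hwN' hw'
    refine ⟨x - x', ⟨hsub₁ _ hx (hKU hxV.2).1 _ hx' (hKU hxV'.2).1, hVK _ hxV.1 _ hxV'.1⟩,
      y - y', ⟨hsub₂ _ hy (hKU hyV.2).2 _ hy' (hKU hyV'.2).2, hVK _ hyV.1 _ hyV'.1⟩, ?_⟩
    exact sub_add_sub_comm _ _ _ _
  · filter_upwards [hK] with v hvK hv
    exact ⟨v, ⟨hv, hvK⟩, 0, ⟨hY.zero_mem, hK0⟩, add_zero v⟩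
  · filter_upwards [hK] with v hvK hv
    exact ⟨0, ⟨hX.zero_mem, hK0⟩, v, ⟨hv, hvK⟩, zero_add v⟩

end Germs

/-! ### Germ relations in terms of neighbourhood filters -/

theorem germEq_iff {G : Type w} [TopologicalSpace G] {a : G} {X Y : Set G} :
    GermEq a X Y ↔ ∀ᶠ v in 𝓝 a, v ∈ X ↔ v ∈ Y := by
  rw [eventually_nhds_iff]
  constructor
  · rintro ⟨U, hU, ha, h⟩
    exact ⟨U, fun v hv => by simpa [hv] using Set.ext_iff.mp h v, hU, ha⟩
  · rintro ⟨U, h, hU, ha⟩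
    exact ⟨U, hU, ha, Set.ext fun v => and_congr_left fun hv => h v hv⟩

theorem germLE_iff {G : Type w} [TopologicalSpace G] {a : G} {X Y : Set G} :
    GermLE a X Y ↔ ∀ᶠ v in 𝓝 a, v ∈ X → v ∈ Y := by
  rw [eventually_nhds_iff]
  constructor
  · rintro ⟨U, hU, ha, h⟩
    exact ⟨U, fun v hv hX => (h ⟨hX, hv⟩).1, hU, ha⟩
  · rintro ⟨U, h, hU, ha⟩
    exact ⟨U, hU, ha, fun v hv => ⟨h v hv.2 hv.1, hv.2⟩⟩

theorem mem_translateBy {G : Type w} [AddCommGroup G] {X : Set G} {g v : G} :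
    v ∈ translateBy X g ↔ v + g ∈ X := by
  simp [translateBy, sub_eq_iff_eq_add]

theorem gEquivalent_iff {G : Type w} [AddCommGroup G] [TopologicalSpace G] {X Y : Set G} :
    GEquivalent X Y ↔ ∀ x ∈ X, ∀ y ∈ Y, ∀ᶠ v in 𝓝 (0 : G), v + x ∈ X ↔ v + y ∈ Y := by
  simp only [GEquivalent, germEq_iff, mem_translateBy]

/-! ### Germs of sums and unions of G-linear sets -/

section SumsAndUnions

variable {L : FirstOrder.Language.{u, v}} {M : Type w} [L.Structure M]
  {G : Type w} [AddCommGroup G] [TopologicalSpace G] [Enc M G]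
  [AddCommGroup M] [LinearOrder M] [hM : Fact (OMinimalGroupExpansion L M)]
  [IsOrderedAddMonoid M] [Nontrivial M] [TopologicalSpace M] [OrderTopology M]
  [IsTopologicalAddGroup G] [DefType L univ G] [DefAtlas L univ G] [DefAdd L univ G]
  [DenselyOrdered M] {X Y : Set G}

theorem locSubgroup_translate (hX : DefP L univ (· ∈ X))
    (h : GEquivalent X X) {x : G} (hx : x ∈ X) : LocSubgroup L {v | v + x ∈ X} := by
  rw [gEquivalent_iff] at h
  refine locSubgroup_of_homogeneous (DefP.comp hX (f := fun v => v + x) (by fun_prop))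
    (by simpa using hx) fun v hv => ?_
  simpa [add_assoc] using h _ hv _ hx

/-- One germ W serves at all points x + y of X + Y. It contains the germ there by `GermIn.add`;
conversely, a small element of W splits into small elements of the germs of X and Y, which may be
added to x and to y. -/
theorem exists_locSubgroup_add (hX : DefP L univ (· ∈ X)) (hY : DefP L univ (· ∈ Y))
    (hXX : GEquivalent X X) (hYY : GEquivalent Y Y) {x₀ y₀ : G} (hx₀ : x₀ ∈ X) (hy₀ : y₀ ∈ Y) :
    ∃ W : Set G, (∀ c ∈ X + Y, ∀ᶠ v in 𝓝 (0 : G), v + c ∈ X + Y ↔ v ∈ W) ∧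
      (∀ᶠ v in 𝓝 (0 : G), v + x₀ ∈ X → v ∈ W) ∧
      ∀ V ∈ 𝓝 (0 : G), ∀ᶠ v in 𝓝 (0 : G), v ∈ W →
        ∃ x ∈ V, ∃ y ∈ V, x + x₀ ∈ X ∧ y + y₀ ∈ Y ∧ x + y = v := by
  obtain ⟨W, hW, hXW, hYW, hsplit⟩ := (locSubgroup_translate hX hXX hx₀).exists_add
    (locSubgroup_translate hY hYY hy₀)
  have hXX' := gEquivalent_iff.mp hXX
  have hYY' := gEquivalent_iff.mp hYY
  refine ⟨W, fun c hc => ?_, hXW, hsplit⟩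
  have h1 : GermIn L (X + Y) W := GermIn.add hW
    ⟨hX, fun x hx => by filter_upwards [hXX' x hx _ hx₀, hXW] with v h1 h2 h3 using h2 (h1.mp h3)⟩
    ⟨hY, fun y hy => by filter_upwards [hYY' y hy _ hy₀, hYW] with v h1 h2 h3 using h2 (h1.mp h3)⟩
  obtain ⟨x, hx, y, hy, rfl⟩ := id hc
  filter_upwards [h1.germ _ hc, hsplit _ (inter_mem (hXX' x hx _ hx₀) (hYY' y hy _ hy₀))]
    with v h2 h3
  refine ⟨h2, fun h4 => ?_⟩
  obtain ⟨a, ha, b, hb, hax, hby, rfl⟩ := h3 h4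
  exact ⟨a + x, ha.1.mpr hax, b + y, hb.2.mpr hby, by simp only; abel⟩

theorem GEquivalent.symm {X Y : Set G} (h : GEquivalent X Y) : GEquivalent Y X := by
  rw [gEquivalent_iff] at *
  exact fun y hy x hx => (h x hx y hy).mono fun v => Iff.symm

theorem gEquivalent_add_add (hX : DefP L univ (· ∈ X)) (hY : DefP L univ (· ∈ Y))
    (hXX : GEquivalent X X) (hYY : GEquivalent Y Y) : GEquivalent (X + Y) (X + Y) := by
  refine gEquivalent_iff.mpr fun c hc c' hc' => ?_
  obtain ⟨x₀, hx₀, y₀, hy₀, -⟩ := id hc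
  obtain ⟨W, h, -, -⟩ := exists_locSubgroup_add hX hY hXX hYY hx₀ hy₀
  filter_upwards [h c hc, h c' hc'] with v h1 h2 using h1.trans h2.symm

/-- Small elements of the germ of `X + Y` are sums of small elements of the germs. -/
theorem exists_add_of_mem_add (hX : DefP L univ (· ∈ X)) (hY : DefP L univ (· ∈ Y))
    (hXX : GEquivalent X X) (hYY : GEquivalent Y Y) {x₀ y₀ : G} (hx₀ : x₀ ∈ X) (hy₀ : y₀ ∈ Y)
    {V : Set G} (hV : V ∈ 𝓝 0) :
    ∀ᶠ v in 𝓝 (0 : G), v + (x₀ + y₀) ∈ X + Y →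
      ∃ x ∈ V, ∃ y ∈ V, x + x₀ ∈ X ∧ y + y₀ ∈ Y ∧ x + y = v := by
  obtain ⟨W, h, -, h'⟩ := exists_locSubgroup_add hX hY hXX hYY hx₀ hy₀
  filter_upwards [h _ (add_mem_add hx₀ hy₀), h' V hV] with v h1 h2 h3 using h2 (h1.mp h3)

/-- If the germs agree, both small summands of an element of W lie in the local subgroup X - x₀,
hence so does their sum. -/
theorem gEquivalent_add_left (hX : DefP L univ (· ∈ X)) (hY : DefP L univ (· ∈ Y))
    (hXX : GEquivalent X X) (hYY : GEquivalent Y Y) (hXY : GEquivalent X Y) :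
    GEquivalent (X + Y) X := by
  rw [gEquivalent_iff] at hXY
  refine gEquivalent_iff.mpr fun c hc x₀ hx₀ => ?_
  obtain ⟨-, -, y₀, hy₀, -⟩ := id hc
  obtain ⟨W, h, hXW, hsplit⟩ := exists_locSubgroup_add hX hY hXX hYY hx₀ hy₀
  obtain ⟨U, hU, h0, -, -, -, hadd⟩ := (locSubgroup_translate hX hXX hx₀).exists_open_symm
  filter_upwards [h c hc, hXW, hsplit _ (inter_mem (hXY x₀ hx₀ y₀ hy₀) (hU.mem_nhds h0))]
    with v h1 h2 h3
  refine h1.trans ⟨fun h4 => ?_, h2⟩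
  obtain ⟨a, ha, b, hb, hax, hby, rfl⟩ := h3 h4
  exact hadd a hax ha.2 b (hb.1.mpr hby) hb.2

theorem gEquivalent_union_left (hX : DefP L univ (· ∈ X)) (hY : DefP L univ (· ∈ Y))
    (hXX : GEquivalent X X) (hXY : GEquivalent X Y) :
    GEquivalent (X ∪ Y) X := by
  rw [gEquivalent_iff] at *
  refine fun c hc x₀ hx₀ => ?_
  have hW := locSubgroup_translate hX (gEquivalent_iff.mpr hXX) hx₀
  have h := GermIn.union hW ⟨hX, fun x hx => (hXX x hx x₀ hx₀).mono fun v hv => hv.mp⟩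
    ⟨hY, fun y hy => (hXY x₀ hx₀ y hy).mono fun v hv => hv.mpr⟩
  rcases id hc with hx | hy
  · filter_upwards [h.germ c hc, hXX c hx x₀ hx₀] with v h1 h2
    exact ⟨h1, fun h3 => Or.inl (h2.mpr h3)⟩
  · filter_upwards [h.germ c hc, hXY x₀ hx₀ c hy] with v h1 h2
    exact ⟨h1, fun h3 => Or.inr (h2.mp h3)⟩

/-- If the germs of `Y` are contained in those of `X`, then an open set that is a projection of
`Y` gives one for `X`. -/
theorem exists_interior_image_nonempty_of_germ {n k : ℕ} {c : G → Fin n → M}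
    (hc : DefF L univ c) (hcinj : Function.Injective c) (hY : DefP L univ (· ∈ Y))
    (h : ∀ y ∈ Y, ∃ x, ∀ᶠ v in 𝓝 (0 : G), v + y ∈ Y → v + x ∈ X) (σ : Fin k ↪ Fin n)
    (hσ : (interior ((fun t : Fin n → M => t ∘ σ) '' (c '' Y))).Nonempty) :
    ∃ τ : Fin k ↪ Fin n, (interior ((fun t : Fin n → M => t ∘ τ) '' (c '' X))).Nonempty := by
  have hcσ : DefF L univ fun g => (fun i => c g (σ i)) := DefF.pi fun i => hc.apply (σ i)
  -- A definable section of the projection, continuous on an open set and followed by the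
  -- translation taking s(o₀) to x, injects a neighbourhood of o₀ into X.
  obtain ⟨s, hs, hsp⟩ := exists_defF_choice (L := L) (T := Fin k → M) (S := G)
    (p := fun o g => g ∈ Y ∧ (fun i => c g (σ i)) = o)
    ((DefP.comp hY (f := fun z : (Fin k → M) × G => z.2) (by fun_prop)).and
      (DefP.comp hcσ (f := fun z : (Fin k → M) × G => (z.2, z.1)) (by fun_prop)))
  obtain ⟨V, hVU, hV, ⟨o₀, ho₀⟩, hVc⟩ := (tame_pi (L := L) (M := M) k).exists_continuousAt_group hs
    isOpen_interior hσ
  have hs' : ∀ o ∈ V, s o ∈ Y ∧ (fun i => c (s o) (σ i)) = o := fun o ho => hsp o (by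
    obtain ⟨_, ⟨g, hg, rfl⟩, h⟩ := interior_subset (hVU ho)
    exact ⟨g, hg, h⟩)
  obtain ⟨x, hx⟩ := h _ (hs' o₀ ho₀).1
  have hlim : Tendsto (fun o => s o - s o₀) (𝓝 o₀) (𝓝 0) := by
    simpa using (hVc o₀ ho₀).tendsto.sub_const (s o₀)
  obtain ⟨N, hN, hNo, hN0⟩ := eventually_nhds_iff.mp
    ((hlim.eventually hx).and (hV.mem_nhds ho₀))
  have hd : DefF L univ fun o => s o - s o₀ + x := by fun_prop
  refine exists_interior_image_nonempty (L := L) (h := fun o => c (s o - s o₀ + x))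
    (DefF.comp hc hd) hNo ⟨o₀, hN0⟩ (fun a ha b hb hab => ?_) fun o ho => ?_
  · have : s a = s b := by simpa using hcinj hab
    rw [← (hs' a (hN a ha).2).2, ← (hs' b (hN b hb).2).2, this]
  · exact mem_image_of_mem c ((hN o ho).1 (by simpa using (hs' o (hN o ho).2).1))

end SumsAndUnions

/-! ### Dimension -/

section Dimension

theorem ominDim_le_ominDim {M : Type w} [TopologicalSpace M] {n m : ℕ} {S : Set (Fin n → M)}
    {S' : Set (Fin m → M)}
    (h : ∀ (k : ℕ) (σ : Fin k ↪ Fin n),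
      (interior ((fun t : Fin n → M => t ∘ σ) '' S)).Nonempty →
      ∃ τ : Fin k ↪ Fin m, (interior ((fun t : Fin m → M => t ∘ τ) '' S')).Nonempty) :
    ominDim S ≤ ominDim S' :=
  iSup₂_le fun k ⟨σ, hσ⟩ => le_iSup₂_of_le k (h k σ hσ) le_rfl

theorem ominDim_mono {M : Type w} [TopologicalSpace M] {n : ℕ} {S S' : Set (Fin n → M)}
    (h : S ⊆ S') : ominDim S ≤ ominDim S' :=
  ominDim_le_ominDim fun _ σ hσ => ⟨σ, hσ.mono (interior_mono (image_mono h))⟩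

theorem ominDim_le {M : Type w} [TopologicalSpace M] {n : ℕ} (S : Set (Fin n → M)) :
    ominDim S ≤ ((n : ℕ∞) : WithBot ℕ∞) :=
  iSup₂_le fun k ⟨σ, _⟩ => by
    have := Fintype.card_le_of_embedding σ
    simp only [Fintype.card_fin] at this
    exact_mod_cast this

/-- A nonempty family of subsets of `Mⁿ` has a member of largest dimension. -/
theorem exists_isGreatest_ominDim {M : Type w} [TopologicalSpace M] {n : ℕ}
    {𝒮 : Set (Set (Fin n → M))} (h : 𝒮.Nonempty) : ∃ S ∈ 𝒮, ∀ S' ∈ 𝒮, ominDim S' ≤ ominDim S := by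
  -- The only possible values are ⊥ and 0, …, n.
  have hfin : (ominDim '' 𝒮).Finite := by
    refine Set.Finite.subset (((Set.finite_le_nat n).image
      (fun k : ℕ => ((k : ℕ∞) : WithBot ℕ∞))).insert ⊥) ?_
    rintro _ ⟨S, -, rfl⟩
    have h1 := ominDim_le S
    generalize ominDim S = d at h1 ⊢
    induction d using WithBot.recBotCoe with
    | bot => exact Or.inl rfl
    | coe d =>
      have h2 : d ≤ (n : ℕ∞) := by exact_mod_cast h1
      obtain ⟨k, rfl⟩ := ENat.ne_top_iff_exists.mp (h2.trans_lt (ENat.natCast_lt_top n)).ne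
      exact Or.inr ⟨k, by exact_mod_cast h2, rfl⟩
  obtain ⟨_, ⟨S, hS, rfl⟩, hmax⟩ := hfin.exists_maximal (h.image _)
  exact ⟨S, hS, fun S' hS' => (le_total _ _).elim id (hmax (mem_image_of_mem _ hS'))⟩

end Dimension

/-! ### Saturation and finite parameter sets -/

section Saturation

variable {L : FirstOrder.Language.{u, v}} {M : Type w} [L.Structure M]

/-- A saturated structure realizes every directed family of satisfiable predicates. -/
theorem IsSaturated.exists_forall {κ : Cardinal.{w}} (h : IsSaturated L M κ) {A : Set M}
    (hA : #A < κ) {T : Type w} [Enc M T] {I : Type*} [Nonempty I] {p : I → T → Prop}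
    (hp : ∀ i, DefP L A (p i)) (hdir : ∀ i j, ∃ k, ∀ t, p k t → p i t ∧ p j t)
    (hne : ∀ i, ∃ t, p i t) : ∃ t, ∀ i, p i t := by
  obtain ⟨m, ⟨e⟩⟩ := Finite.exists_equiv_fin (Enc.ι T)
  let S : I → Set (Fin m → M) := fun i => {x | ∃ t, p i t ∧ Enc.enc t = x ∘ e}
  have hS : ∀ i, A.Definable L (S i) := fun i => by
    have h : A.Definable L (Enc.enc '' {t | p i t}) := hp i
    convert h.preimage_comp e using 1
    rfl
  -- Directedness reduces finite satisfiability to satisfiability of single members.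
  have hdir' : ∀ F : Set (Set (Fin m → M)), F.Finite → F ⊆ range S → ∃ i, S i ⊆ ⋂₀ F := by
    intro F hF
    induction F, hF using Set.Finite.induction_on with
    | empty => exact fun _ => ⟨Classical.arbitrary I, by simp⟩
    | @insert a s _ _ ih =>
      intro hs
      obtain ⟨i, rfl⟩ := hs (mem_insert _ _)
      obtain ⟨j, hj⟩ := ih ((subset_insert _ _).trans hs)
      obtain ⟨k, hk⟩ := hdir i j
      refine ⟨k, ?_⟩
      rw [sInter_insert]
      rintro x ⟨t, ht, hx⟩
      exact ⟨⟨t, (hk t ht).1, hx⟩, hj ⟨t, (hk t ht).2, hx⟩⟩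
  obtain ⟨x, hx⟩ := h A hA m (range S) (by rintro _ ⟨i, rfl⟩; exact hS i) fun F hF hfin => by
    obtain ⟨i, hi⟩ := hdir' F hfin hF
    obtain ⟨t, ht⟩ := hne i
    exact ⟨Enc.enc t ∘ e.symm, hi ⟨t, ht, by funext j; simp⟩⟩
  obtain ⟨t, -, ht⟩ := hx (S (Classical.arbitrary I)) (mem_range_self _)
  refine ⟨t, fun i => ?_⟩
  obtain ⟨t', ht', h'⟩ := hx (S i) (mem_range_self _)
  rwa [Enc.injective (ht.trans h'.symm)]

theorem DefP.exists_finite {T : Type w} [Enc M T] {p : T → Prop} (hp : DefP L univ p) :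
    ∃ A : Set M, A.Finite ∧ DefP L A p := by
  obtain ⟨A, -, hA⟩ := Set.definable_iff_finitely_definable.mp hp
  exact ⟨A, A.finite_toSet, hA⟩

theorem DefP.exists_finite_forall {T : Type w} [Enc M T] {J : Type*} [Finite J] {p : J → T → Prop}
    (hp : ∀ j, DefP L univ (p j)) : ∃ A : Set M, A.Finite ∧ ∀ j, DefP L A (p j) := by
  choose A hA hAp using fun j => (hp j).exists_finite
  exact ⟨⋃ j, A j, finite_iUnion hA, fun j => (hAp j).mono (subset_iUnion A j)⟩

/-- The structure of `G` and a definable subset of `G` are definable over finitely many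
parameters. -/
theorem exists_finite_parameters [TopologicalSpace M] {G : Type w} [AddCommGroup G]
    [TopologicalSpace G] [Enc M G] [hT : DefType L univ G] [hA : DefAtlas L univ G]
    [hD : DefAdd L univ G] {p : Bool → G → Prop} (hp : ∀ i, DefP L univ (p i)) :
    ∃ A : Set M, A.Finite ∧ DefType L A G ∧ DefAtlas L A G ∧ DefAdd L A G ∧
      ∀ i, DefP L A (p i) := by
  obtain ⟨d, k, φ, hcov, hdef, -⟩ := hA.exists_atlas
  obtain ⟨A₁, hA₁, h₁⟩ := DefP.exists_finite_forall hdef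
  obtain ⟨A₂, hA₂, h₂⟩ := DefP.exists_finite (DefP.const (L := L) (A := univ) (T := G) True)
  obtain ⟨A₃, hA₃, h₃⟩ := DefP.exists_finite hD.defF_add
  obtain ⟨A₄, hA₄, h₄⟩ := DefP.exists_finite_forall hp
  -- The chart coordinates of 0, which `DefAtlas` requires to be among the parameters.
  let A₅ : Set M := range fun z : Fin k × Fin d => φ z.1 0 z.2
  have hA₅ : A₅.Finite := finite_range _
  refine ⟨A₁ ∪ A₂ ∪ A₃ ∪ A₄ ∪ A₅, by simp [*], ⟨?_⟩, ⟨d, k, φ, hcov, fun i => (h₁ i).mono ?_, ?_⟩,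
    ⟨DefP.mono h₃ ?_⟩, fun i => (h₄ i).mono ?_⟩
  · have h : Set.Definable (A₁ ∪ A₂ ∪ A₃ ∪ A₄ ∪ A₅) L (Enc.enc '' {_t : G | True}) :=
      Definable.mono h₂ (by grind)
    rwa [ofPred_true, image_univ] at h
  · grind
  · exact fun i _ j => Or.inr ⟨(i, j), rfl⟩
  · grind
  · grind

end Saturation

/-! ### The generated subgroup as a union of iterated differences -/

section GeneratedGroup

/-- The sums of `2ⁿ` elements of `Y ∪ -Y` with alternating signs. -/
def iteratedDiff {G : Type w} [AddCommGroup G] (Y : Set G) : ℕ → Set G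
  | 0 => Y
  | n + 1 => iteratedDiff Y n + -iteratedDiff Y n

theorem zero_mem_iteratedDiff {G : Type w} [AddCommGroup G] {Y : Set G} (h0 : (0 : G) ∈ Y) (n : ℕ) :
    (0 : G) ∈ iteratedDiff Y n := by
  induction n with
  | zero => exact h0
  | succ n ih => exact ⟨0, ih, 0, by simpa using ih, add_zero 0⟩

theorem iteratedDiff_mono {G : Type w} [AddCommGroup G] {Y : Set G} (h0 : (0 : G) ∈ Y) :
    Monotone (iteratedDiff Y) :=
  monotone_nat_of_le_succ fun n z hz =>
    ⟨z, hz, 0, by simpa using zero_mem_iteratedDiff h0 n, add_zero z⟩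

/-- The difference of two members appears one stage after the later of them, so the union is a
subgroup. -/
theorem iUnion_iteratedDiff {G : Type w} [AddCommGroup G] {Y : Set G} (h0 : (0 : G) ∈ Y) :
    ⋃ n, iteratedDiff Y n = (AddSubgroup.closure Y : Set G) := by
  apply subset_antisymm
  · refine iUnion_subset fun n => ?_
    induction n with
    | zero => exact AddSubgroup.subset_closure
    | succ n ih =>
      rintro _ ⟨a, ha, b, hb, rfl⟩
      exact add_mem (ih ha) (neg_mem_iff.mp (ih hb))
  · have hsub : ∀ a b, a ∈ ⋃ n, iteratedDiff Y n → b ∈ ⋃ n, iteratedDiff Y n →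
        a - b ∈ ⋃ n, iteratedDiff Y n := by
      intro a b ha hb
      obtain ⟨i, hi⟩ := mem_iUnion.mp ha
      obtain ⟨j, hj⟩ := mem_iUnion.mp hb
      refine mem_iUnion.mpr ⟨max i j + 1, a, iteratedDiff_mono h0 (le_max_left i j) hi, -b, ?_,
        (sub_eq_add_neg a b).symm⟩
      simpa using iteratedDiff_mono h0 (le_max_right i j) hj
    have h0' : (0 : G) ∈ ⋃ n, iteratedDiff Y n := mem_iUnion.mpr ⟨0, h0⟩
    have : AddSubgroup.closure Y ≤ AddSubgroup.ofSub (⋃ n, iteratedDiff Y n) ⟨0, h0'⟩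
        fun {a} ha {b} hb => by simpa [sub_eq_add_neg] using hsub a b ha hb :=
      (AddSubgroup.closure_le _).mpr fun y hy => mem_iUnion.mpr ⟨0, hy⟩
    exact this

variable {L : FirstOrder.Language.{u, v}} {M : Type w} [L.Structure M]
  {G : Type w} [AddCommGroup G] [TopologicalSpace G] [Enc M G]

theorem DefP.mem_iteratedDiff {A : Set M} [DefType L A G] [DefAdd L A G] {Y : Set G}
    (hY : DefP L A (· ∈ Y)) (n : ℕ) : DefP L A (· ∈ iteratedDiff Y n) := by
  induction n with
  | zero => exact hY
  | succ n ih => exact ih.mem_add (DefP.comp ih (f := fun x : G => -x) (by fun_prop))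

variable [AddCommGroup M] [LinearOrder M] [hM : Fact (OMinimalGroupExpansion L M)]
  [IsOrderedAddMonoid M] [Nontrivial M] [TopologicalSpace M] [OrderTopology M]
  [IsTopologicalAddGroup G] [DefType L univ G] [DefAtlas L univ G] [DefAdd L univ G]
  [DenselyOrdered M] {X Y : Set G}

theorem GermIn.iteratedDiff (hX : LocSubgroup L X) (hY : GermIn L Y X) (n : ℕ) :
    GermIn L (iteratedDiff Y n) X := by
  induction n with
  | zero => exact hY
  | succ n ih => exact GermIn.add hX ih (ih.neg hX)

/-- In an `ω`-saturated structure, the group generated by `Y` has the germ of `X`. -/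
theorem eventually_mem_of_mem_closure (hsat : IsSaturated L M ℵ₀) (hX : LocSubgroup L X)
    (hY : GermIn L Y X) (h0 : (0 : G) ∈ Y) :
    ∀ᶠ v in 𝓝 (0 : G), v ∈ AddSubgroup.closure Y → v ∈ X := by
  obtain ⟨A, hA, hT, hAt, hAdd, hAp⟩ := exists_finite_parameters (L := L)
    (p := fun i v => v ∈ bif i then X else Y) (Bool.rec hY.defP hX.defP)
  have hXd : DefP L A (· ∈ X) := hAp true
  have hYd : DefP L A (· ∈ Y) := hAp false
  obtain ⟨V, hV, hVo, -, hVb⟩ := exists_defP_basis_zero (L := L) (A := A) (G := G)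
  -- Each stage n has a radius t that works, and a radius for a later stage serves the earlier ones.
  -- All conditions use the same finitely many parameters, so ω-saturation gives one radius for all
  -- n.
  obtain ⟨t, ht⟩ := hsat.exists_forall (A := A) (Cardinal.lt_aleph0_iff_set_finite.mpr hA)
    (p := fun (n : ℕ) (t : M) => 0 < t ∧ ∀ g, V t g → g ∈ iteratedDiff Y n → g ∈ X)
    (fun n => by
      have := hYd.mem_iteratedDiff n
      fun_prop)
    (fun i j => ⟨max i j, fun t ht => ⟨⟨ht.1, fun g h1 h2 =>
        ht.2 g h1 (iteratedDiff_mono h0 (le_max_left i j) h2)⟩, ht.1, fun g h1 h2 =>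
        ht.2 g h1 (iteratedDiff_mono h0 (le_max_right i j) h2)⟩⟩)
    fun n => by
      obtain ⟨t, ht, h⟩ := hVb _ ((hY.iteratedDiff hX n).germ 0 (zero_mem_iteratedDiff h0 n))
      exact ⟨t, ht, fun g h1 h2 => h g h1 (by simpa using h2)⟩
  filter_upwards [(hVo t (ht 0).1).1.mem_nhds (hVo t (ht 0).1).2] with v hv hvY
  rw [← SetLike.mem_coe, ← iUnion_iteratedDiff h0] at hvY
  obtain ⟨n, hn⟩ := mem_iUnion.mp hvY
  exact (ht n).2 v hv hn

end GeneratedGroup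

/-! ### Compactness for directed unions -/

section DirectedUnions

variable {L : FirstOrder.Language.{u, v}} {M : Type w} [L.Structure M]
  {G : Type w} [Enc M G] [DefType L univ G] {X : Set G}

theorem DefType.mono {A B : Set M} (h : DefType L A G) (hAB : A ⊆ B) : DefType L B G :=
  ⟨h.definable_range.mono hAB⟩

theorem exists_finite_defType : ∃ A : Set M, A.Finite ∧ DefType L A G := by
  obtain ⟨A, hA, h⟩ := DefP.exists_finite (DefP.const (L := L) (A := univ) (T := G) True)
  refine ⟨A, hA, ⟨?_⟩⟩
  have h : A.Definable L (Enc.enc '' {_t : G | True}) := h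
  rwa [ofPred_true, image_univ] at h

/-- In a `κ`-saturated structure, a definable set contained in a directed union of less than `κ`
definable sets is contained in one of them. -/
theorem exists_subset_of_subset_sUnion {κ : Cardinal.{w}} (hsat : IsSaturated L M κ)
    (hX : DefP L univ (· ∈ X)) {𝒳 : Set (Set G)} (hc : #𝒳 < κ)
    (hd : ∀ Z ∈ 𝒳, DefP L univ (· ∈ Z)) (hdir : DirectedOn (· ⊆ ·) 𝒳) (hne : 𝒳.Nonempty)
    (hsub : X ⊆ ⋃₀ 𝒳) : ∃ Z ∈ 𝒳, X ⊆ Z := by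
  rcases lt_or_ge #𝒳 ℵ₀ with hfin | hinf
  -- A finite directed family has a largest member; this case covers every κ ≤ ℵ₀ and needs no
  -- saturation.
  · obtain ⟨Z, hZ, hmax⟩ := (Cardinal.lt_aleph0_iff_set_finite.mp hfin).exists_maximal hne
    refine ⟨Z, hZ, fun x hx => ?_⟩
    obtain ⟨Z', hZ', hx'⟩ := hsub hx
    obtain ⟨Z'', hZ'', h1, h2⟩ := hdir Z hZ Z' hZ'
    exact hmax hZ'' h1 (h2 hx')
  · by_contra! hcon
    obtain ⟨A₁, hA₁, hT⟩ := exists_finite_defType (L := L) (M := M) (G := G)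
    obtain ⟨A₂, hA₂, hX'⟩ := hX.exists_finite
    choose A₃ hA₃ hd' using fun Z : 𝒳 => (hd Z Z.2).exists_finite
    have hT' := DefType.mono (B := A₁ ∪ A₂ ∪ ⋃ Z, A₃ Z) hT
      (subset_union_left.trans subset_union_left)
    have hX'' := hX'.mono (B := A₁ ∪ A₂ ∪ ⋃ Z, A₃ Z)
      (subset_union_right.trans subset_union_left)
    have hd'' := fun Z => (hd' Z).mono (B := A₁ ∪ A₂ ∪ ⋃ Z, A₃ Z)
      ((subset_iUnion A₃ Z).trans subset_union_right)
    -- Each member contributes finitely many parameters, so there are at most #𝒳 in all.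
    have hcard : #(A₁ ∪ A₂ ∪ ⋃ Z, A₃ Z : Set M) < κ := by
      refine lt_of_le_of_lt ((Cardinal.mk_union_le _ _).trans (?_ : _ ≤ #𝒳)) hc
      refine Cardinal.add_le_of_le hinf
        ((Cardinal.lt_aleph0_iff_set_finite.mpr (hA₁.union hA₂)).le.trans hinf) ?_
      refine (Cardinal.mk_iUnion_le _).trans (Cardinal.mul_le_of_le hinf le_rfl ?_)
      exact ciSup_le' fun Z => (Cardinal.lt_aleph0_iff_set_finite.mpr (hA₃ Z)).le.trans hinf
    have := hne.to_subtype
    obtain ⟨x, hx⟩ := hsat.exists_forall hcard (p := fun (Z : 𝒳) x => x ∈ X ∧ x ∉ (Z : Set G))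
      (fun Z => by
        have := hd'' Z
        fun_prop)
      (fun Z Z' => by
        obtain ⟨Z'', hZ'', h1, h2⟩ := hdir Z Z.2 Z' Z'.2
        exact ⟨⟨Z'', hZ''⟩, fun t ht => ⟨⟨ht.1, fun h => ht.2 (h1 h)⟩, ht.1, fun h => ht.2 (h2 h)⟩⟩)
      fun Z => not_subset.mp (hcon Z Z.2)
    obtain ⟨Z, hZ, hxZ⟩ := hsub (hx (Classical.arbitrary 𝒳)).1
    exact (hx ⟨Z, hZ⟩).2 hxZ

end DirectedUnions

/-! ### Transfer along an elementary embedding -/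

section Transfer

variable {L : FirstOrder.Language.{u, v}} {M N : Type w} [L.Structure M] [L.Structure N]
  {α β : Type}

/-- `p` and `q` are the interpretations in `M` and `N` of one formula with parameters in `M`. -/
def StarPair (f : M ↪ₑ[L] N) (p : (α → M) → Prop) (q : (α → N) → Prop) : Prop :=
  ∃ φ : L.Formula (M ⊕ α), (∀ t, p t ↔ φ.Realize (Sum.elim id t)) ∧
    ∀ y, q y ↔ φ.Realize (Sum.elim f y)

variable {f : M ↪ₑ[L] N} {p p' : (α → M) → Prop} {q q' : (α → N) → Prop}

theorem StarPair.and (h : StarPair f p q) (h' : StarPair f p' q') :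
    StarPair f (fun t => p t ∧ p' t) fun y => q y ∧ q' y := by
  obtain ⟨φ, h1, h2⟩ := h
  obtain ⟨ψ, h3, h4⟩ := h'
  exact ⟨φ ⊓ ψ, by simp [*], by simp [*]⟩

theorem StarPair.imp (h : StarPair f p q) (h' : StarPair f p' q') :
    StarPair f (fun t => p t → p' t) fun y => q y → q' y := by
  obtain ⟨φ, h1, h2⟩ := h
  obtain ⟨ψ, h3, h4⟩ := h'
  exact ⟨φ.imp ψ, by simp [*], by simp [*]⟩

theorem StarPair.subst (h : StarPair f p q) (r : α → M ⊕ β) :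
    StarPair f (fun t : β → M => p (Sum.elim id t ∘ r)) fun y => q (Sum.elim f y ∘ r) := by
  obtain ⟨φ, h1, h2⟩ := h
  refine ⟨φ.relabel (Sum.elim Sum.inl r), fun t => ?_, fun y => ?_⟩
  · beta_reduce
    rw [h1, Language.Formula.realize_relabel, Sum.comp_elim]
    rfl
  · beta_reduce
    rw [h2, Language.Formula.realize_relabel, Sum.comp_elim]
    rfl

theorem StarPair.exists [Finite β] {p : (α ⊕ β → M) → Prop} {q : (α ⊕ β → N) → Prop}
    (h : StarPair f p q) :
    StarPair f (fun t => ∃ s, p (Sum.elim t s)) fun y => ∃ z, q (Sum.elim y z) := by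
  obtain ⟨φ, h1, h2⟩ := h
  have hr : ∀ {K : Type w} (a : M → K) (b : α → K) (c : β → K),
      Sum.elim (Sum.elim a b) c ∘ (Equiv.sumAssoc M α β).symm = Sum.elim a (Sum.elim b c) := by
    intro K a b c
    funext x
    rcases x with x | x | x <;> rfl
  refine ⟨(φ.relabel (Equiv.sumAssoc M α β).symm).iExs β, fun t => ?_, fun y => ?_⟩
  · simp only [Language.Formula.realize_iExs, Language.Formula.realize_relabel, hr, h1]
  · simp only [Language.Formula.realize_iExs, Language.Formula.realize_relabel, hr, h2]

/-- The universal closure is a formula in parameters from M only, which an elementary embedding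
preserves. -/
theorem StarPair.transfer [Finite α] (h : StarPair f p q) (hp : ∀ t, p t) (y : α → N) : q y := by
  obtain ⟨φ, h1, h2⟩ := h
  have h3 : (φ.iAlls α).Realize (id : M → M) :=
    Language.Formula.realize_iAlls.mpr fun t => (h1 t).mp (hp t)
  rw [← f.map_formula] at h3
  exact (h2 y).mpr (Language.Formula.realize_iAlls.mp h3 y)

/-- Two formulas that define S in M are equivalent in N by transfer, so one fixed formula decides
membership in the extension. -/
theorem starPair_extension [Finite α] {S : Set (α → M)} (hS : (univ : Set M).Definable L S) :
    StarPair f (· ∈ S) (· ∈ extension f S) := by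
  obtain ⟨φ, hφ⟩ := definable_iff_exists_formula_sum.mp hS
  let φ' : L.Formula (M ⊕ α) := φ.relabel (Sum.map Subtype.val id)
  have hφ' : ∀ t, t ∈ S ↔ φ'.Realize (Sum.elim id t) := fun t => by
    rw [Language.Formula.realize_relabel, hφ, Sum.elim_comp_map]
    rfl
  refine ⟨φ', hφ', fun y => ⟨?_, fun h => ⟨φ', Set.ext hφ', h⟩⟩⟩
  rintro ⟨ψ, hψ, hy⟩
  have hpair : StarPair f (fun t => t ∈ S → t ∈ S)
      fun y => ψ.Realize (Sum.elim f y) → φ'.Realize (Sum.elim f y) :=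
    StarPair.imp ⟨ψ, fun t => by rw [hψ]; rfl, fun _ => Iff.rfl⟩ ⟨φ', hφ', fun _ => Iff.rfl⟩
  exact hpair.transfer (fun _ => id) y hy

/-- Prepares the use of saturation of N: `r` fixes some variables at elements of `B`, and the
parameters from M are read through `f`. -/
theorem StarPair.definable (h : StarPair f p q) {B : Set N} (hB : range f ⊆ B) (r : α → B ⊕ β) :
    B.Definable L {v : β → N | q (Sum.elim (↑) v ∘ r)} := by
  obtain ⟨φ, -, h2⟩ := h
  refine definable_iff_exists_formula_sum.mpr
    ⟨φ.relabel (Sum.elim (fun m => Sum.inl ⟨f m, hB (mem_range_self m)⟩) r), ?_⟩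
  ext v
  rw [mem_ofPred_eq, mem_ofPred_eq, h2, Language.Formula.realize_relabel, Sum.comp_elim]
  rfl

end Transfer

/-! ### The definable group as an encoded type -/

namespace DefinableGroup

section Instances

variable {L : FirstOrder.Language.{u, v}} {M : Type w} [L.Structure M] [TopologicalSpace M]
  {G : Type w} [AddCommGroup G] [TopologicalSpace G] {n : ℕ} (D : DefinableGroup L M G n)

/-- The encoding of `G` by coordinates. -/
@[reducible]
def enc : Enc M G := ⟨Fin n, inferInstance, D.coord, D.coord_injective⟩

theorem defType : letI := D.enc; DefType L univ G :=
  letI := D.enc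
  ⟨D.definable_carrier⟩

theorem defAdd : letI := D.enc; DefAdd L univ G := by
  letI := D.enc
  refine ⟨?_⟩
  let e : Fin 3 × Fin n → (Fin n ⊕ Fin n) ⊕ Fin n := fun p =>
    ![fun i => Sum.inl (Sum.inl i), fun i => Sum.inl (Sum.inr i), fun i => Sum.inr i] p.1 p.2
  refine (congrArg (Set.Definable univ L) (Set.ext fun x => ?_)).mp
    (D.definable_add.preimage_comp e)
  constructor
  · rintro ⟨a, b, h⟩
    refine ⟨((a, b), a + b), rfl, funext fun i => ?_⟩
    rcases i with (i | i) | i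
    · exact (congrFun h (0, i)).symm
    · exact (congrFun h (1, i)).symm
    · exact (congrFun h (2, i)).symm
  · rintro ⟨⟨⟨a, b⟩, c⟩, hc, rfl⟩
    obtain rfl : a + b = c := hc
    refine ⟨a, b, funext fun p => ?_⟩
    obtain ⟨j, i⟩ := p
    fin_cases j <;> rfl

theorem defAtlas [AddCommGroup M] : letI := D.enc; DefAtlas L univ G := by
  letI := D.enc
  obtain ⟨d, k, φ, hcov, hφ⟩ := D.exists_atlas
  refine ⟨d, k, φ, hcov, fun i => ?_, fun _ _ _ => mem_univ _⟩
  refine (congrArg (Set.Definable univ L) (Set.ext fun x => ?_)).mp (hφ i)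
  constructor
  · rintro ⟨g, hg, rfl⟩
    exact ⟨(g, φ i g), ⟨hg, rfl⟩, rfl⟩
  · rintro ⟨⟨g, z⟩, ⟨hg, hz⟩, rfl⟩
    obtain rfl : φ i g = z := hz
    exact ⟨g, hg, rfl⟩

theorem defF_coord : letI := D.enc; DefF L univ D.coord := by
  letI := D.enc
  have := D.defType
  exact IsCoord.defF ⟨id, fun _ => rfl⟩

end Instances

/-! ### Points of definable subsets of G in the extension -/

section Points

variable {L : FirstOrder.Language.{u, v}} {M : Type w} [L.Structure M] [TopologicalSpace M]
  {G : Type w} [AddCommGroup G] [TopologicalSpace G] {n : ℕ} {D : DefinableGroup L M G n}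
  {N : Type w} [L.Structure N] {f : M ↪ₑ[L] N} {A B C : Set G}

theorem starPair_mem {α : Type} (hA : D.IsDefinable A) (u : Fin n → M ⊕ α) :
    StarPair f (fun t : α → M => Sum.elim id t ∘ u ∈ D.coord '' A)
      fun y => Sum.elim f y ∘ u ∈ D.points f A :=
  (starPair_extension hA).subst u

theorem starPair_addRel {α : Type} (a b c : Fin n → M ⊕ α) :
    StarPair f (fun t : α → M => ∃ x y : G, Sum.elim id t ∘ a = D.coord x ∧
        Sum.elim id t ∘ b = D.coord y ∧ Sum.elim id t ∘ c = D.coord (x + y))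
      fun y => D.AddRel f (Sum.elim f y ∘ a) (Sum.elim f y ∘ b) (Sum.elim f y ∘ c) := by
  have hcomp : ∀ {K : Type w} (g : M ⊕ α → K), (g ∘ fun p : Fin 3 × Fin n => ![a, b, c] p.1 p.2) =
      fun p : Fin 3 × Fin n => ![g ∘ a, g ∘ b, g ∘ c] p.1 p.2 := by
    intro K g
    funext ⟨j, i⟩
    fin_cases j <;> rfl
  obtain ⟨φ, h1, h2⟩ := (starPair_extension (f := f) D.definable_add).subst
    (fun p : Fin 3 × Fin n => ![a, b, c] p.1 p.2)
  refine ⟨φ, fun t => (Iff.trans ?_ (h1 t)), fun y => Iff.trans ?_ (h2 y)⟩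
  · beta_reduce
    rw [hcomp]
    refine exists₂_congr fun x y => ⟨fun ⟨h1, h2, h3⟩ => by rw [h1, h2, h3], fun h => ?_⟩
    exact ⟨funext fun i => congrFun h (0, i), funext fun i => congrFun h (1, i),
      funext fun i => congrFun h (2, i)⟩
  · beta_reduce
    rw [hcomp]
    rfl

theorem mem_points_of_mem (hA : D.IsDefinable A) {x : G} (hx : x ∈ A) :
    f ∘ D.coord x ∈ D.points f A :=
  (starPair_mem (α := Empty) hA (Sum.inl ∘ D.coord x)).transfer (fun _ => ⟨x, hx, rfl⟩)
    (Empty.elim : Empty → N)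

theorem mem_points_of_inter_subset (hA : D.IsDefinable A) (hB : D.IsDefinable B)
    (hC : D.IsDefinable C) (h : A ∩ B ⊆ C) {y : Fin n → N} (hyA : y ∈ D.points f A)
    (hyB : y ∈ D.points f B) : y ∈ D.points f C := by
  refine ((starPair_mem hA Sum.inr).imp ((starPair_mem hB Sum.inr).imp
    (starPair_mem hC Sum.inr))).transfer ?_ y hyA hyB
  rintro t ⟨x, hx, h1⟩ ⟨x', hx', h2⟩
  obtain rfl := D.coord_injective (h1.trans h2.symm)
  exact ⟨x, h ⟨hx, hx'⟩, h1⟩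

theorem points_mono (hA : D.IsDefinable A) (hB : D.IsDefinable B) (h : A ⊆ B) :
    D.points f A ⊆ D.points f B := fun _ hy =>
  mem_points_of_inter_subset hA hA hB (inter_subset_left.trans h) hy hy

theorem AddRel.mem (hA : D.IsDefinable A) (hB : D.IsDefinable B) (hC : D.IsDefinable C)
    (h : ∀ a ∈ A, ∀ b ∈ B, a + b ∈ C) {a b c : Fin n → N} (habc : D.AddRel f a b c)
    (ha : a ∈ D.points f A) (hb : b ∈ D.points f B) : c ∈ D.points f C := by
  have h1 := (starPair_addRel (D := D) (f := f) (α := Fin n ⊕ Fin n ⊕ Fin n) (Sum.inr ∘ Sum.inl)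
    (Sum.inr ∘ Sum.inr ∘ Sum.inl) (Sum.inr ∘ Sum.inr ∘ Sum.inr)).imp
    ((starPair_mem hA (Sum.inr ∘ Sum.inl)).imp ((starPair_mem hB (Sum.inr ∘ Sum.inr ∘ Sum.inl)).imp
      (starPair_mem hC (Sum.inr ∘ Sum.inr ∘ Sum.inr))))
  refine h1.transfer ?_ (Sum.elim a (Sum.elim b c)) habc ha hb
  rintro t ⟨x, y, hx, hy, hxy⟩ ⟨x', hx', hx''⟩ ⟨y', hy', hy''⟩
  obtain rfl := D.coord_injective (hx''.trans hx)
  obtain rfl := D.coord_injective (hy''.trans hy)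
  exact ⟨_, h _ hx' _ hy', hxy.symm⟩

/-- Addition in G(N) is available only as a relation; this replaces subtraction. -/
theorem AddRel.mem_left (hA : D.IsDefinable A) (hB : D.IsDefinable B) (hC : D.IsDefinable C)
    (h : ∀ a, ∀ b ∈ B, a + b ∈ C → a ∈ A) {a b c : Fin n → N} (habc : D.AddRel f a b c)
    (hb : b ∈ D.points f B) (hc : c ∈ D.points f C) : a ∈ D.points f A := by
  have h1 := (starPair_addRel (D := D) (f := f) (α := Fin n ⊕ Fin n ⊕ Fin n) (Sum.inr ∘ Sum.inl)
    (Sum.inr ∘ Sum.inr ∘ Sum.inl) (Sum.inr ∘ Sum.inr ∘ Sum.inr)).imp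
    ((starPair_mem hB (Sum.inr ∘ Sum.inr ∘ Sum.inl)).imp
      ((starPair_mem hC (Sum.inr ∘ Sum.inr ∘ Sum.inr)).imp (starPair_mem hA (Sum.inr ∘ Sum.inl))))
  refine h1.transfer ?_ (Sum.elim a (Sum.elim b c)) habc hb hc
  rintro t ⟨x, y, hx, hy, hxy⟩ ⟨y', hy', hy''⟩ ⟨z, hz, hz'⟩
  obtain rfl := D.coord_injective (hy''.trans hy)
  obtain rfl := D.coord_injective (hz'.trans hxy)
  exact ⟨_, h _ _ hy' hz, hx.symm⟩

theorem exists_addRel_of_subset_add (hA : D.IsDefinable A) (hB : D.IsDefinable B)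
    (hC : D.IsDefinable C) (h : C ⊆ A + B) {c : Fin n → N} (hc : c ∈ D.points f C) :
    ∃ a ∈ D.points f A, ∃ b ∈ D.points f B, D.AddRel f a b c := by
  have h1 := (starPair_mem (f := f) hC Sum.inr).imp (StarPair.exists ((starPair_mem hA
    (Sum.inr ∘ Sum.inr ∘ Sum.inl)).and ((starPair_mem hB (Sum.inr ∘ Sum.inr ∘ Sum.inr)).and
      (starPair_addRel (D := D) (f := f) (α := Fin n ⊕ Fin n ⊕ Fin n) (Sum.inr ∘ Sum.inr ∘ Sum.inl)
        (Sum.inr ∘ Sum.inr ∘ Sum.inr) (Sum.inr ∘ Sum.inl)))))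
  obtain ⟨z, hz1, hz2, hz3⟩ := h1.transfer (by
    rintro t ⟨g, hg, ht⟩
    obtain rfl : D.coord g = t := ht
    obtain ⟨x, hx, y, hy, rfl⟩ := h hg
    exact ⟨Sum.elim (D.coord x) (D.coord y), ⟨x, hx, rfl⟩, ⟨y, hy, rfl⟩, x, y, rfl, rfl, rfl⟩) c hc
  exact ⟨_, hz1, _, hz2, hz3⟩

theorem exists_addRel_const (hA : D.IsDefinable A) (x : G) {a : Fin n → N}
    (ha : a ∈ D.points f A) : ∃ c, D.AddRel f a (f ∘ D.coord x) c := by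
  have h1 := (starPair_mem (f := f) hA Sum.inr).imp (StarPair.exists
    (starPair_addRel (D := D) (f := f) (α := Fin n ⊕ Fin n) (Sum.inr ∘ Sum.inl)
      (Sum.inl ∘ D.coord x) (Sum.inr ∘ Sum.inr)))
  refine h1.transfer ?_ a ha
  rintro t ⟨g, hg, ht⟩
  obtain rfl : D.coord g = t := ht
  exact ⟨D.coord (g + x), g, x, rfl, rfl, rfl⟩

end Points

end DefinableGroup

/-! ### Infinitesimals -/

namespace DefinableGroup

section Infinitesimals

variable {L : FirstOrder.Language.{u, v}} {M : Type w} [L.Structure M]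
  [AddCommGroup M] [LinearOrder M] [hM : Fact (OMinimalGroupExpansion L M)]
  [IsOrderedAddMonoid M] [Nontrivial M] [TopologicalSpace M] [OrderTopology M] [DenselyOrdered M]
  {G : Type w} [AddCommGroup G] [TopologicalSpace G] [IsTopologicalAddGroup G]
  {n : ℕ} {D : DefinableGroup L M G n}
  {N : Type w} [L.Structure N] {f : M ↪ₑ[L] N} {X Y : Set G}

omit [LinearOrder M] hM [IsOrderedAddMonoid M] [Nontrivial M] [OrderTopology M]
  [DenselyOrdered M] [IsTopologicalAddGroup G] [AddCommGroup M] in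
theorem isDefinable_preimage_add (hX : D.IsDefinable X) (x : G) : D.IsDefinable {v | v + x ∈ X} := by
  letI := D.enc
  have := D.defType
  have := D.defAdd
  have hX : DefP L univ (· ∈ X) := hX
  exact DefP.comp hX (f := fun v => v + x) (by fun_prop)

theorem exists_isDefinable_isOpen_subset (D : DefinableGroup L M G n) {x : G} {U : Set G}
    (hU : U ∈ 𝓝 x) : ∃ V ⊆ U, IsOpen V ∧ x ∈ V ∧ D.IsDefinable V := by
  letI := D.enc
  have := D.defType
  have := D.defAdd
  have := D.defAtlas
  exact exists_defP_isOpen_subset hU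

omit [LinearOrder M] hM [IsOrderedAddMonoid M] [Nontrivial M] [OrderTopology M]
  [DenselyOrdered M] [IsTopologicalAddGroup G] [AddCommGroup M] in
theorem isDefinable_singleton (D : DefinableGroup L M G n) (x : G) : D.IsDefinable {x} := by
  letI := D.enc
  have := D.defType
  exact DefP.eq (f := fun v : G => v) (by fun_prop) (DefF.const x)

omit [LinearOrder M] hM [IsOrderedAddMonoid M] [Nontrivial M] [OrderTopology M]
  [DenselyOrdered M] [IsTopologicalAddGroup G] [AddCommGroup M] in
theorem AddRel.mem_translate_iff {x : G} {y z : Fin n → N} (hX : D.IsDefinable X)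
    (hyz : D.AddRel f y (f ∘ D.coord x) z) :
    y ∈ D.points f {v | v + x ∈ X} ↔ z ∈ D.points f X := by
  have hX' := isDefinable_preimage_add hX x
  have hx := D.isDefinable_singleton x
  have hx' : f ∘ D.coord x ∈ D.points f {x} := mem_points_of_mem hx rfl
  exact ⟨fun h => hyz.mem hX' hx hX (by rintro a ha _ rfl; exact ha) h hx',
    fun h => hyz.mem_left hX' hx hX (by rintro a _ rfl ha; exact ha) hx' h⟩

omit [LinearOrder M] hM [IsOrderedAddMonoid M] [Nontrivial M] [OrderTopology M]
  [DenselyOrdered M] [AddCommGroup M] in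
theorem AddRel.mem_infinitesimals_iff {x : G} {y z : Fin n → N}
    (hyz : D.AddRel f y (f ∘ D.coord x) z) :
    y ∈ D.infinitesimals f 0 ↔ z ∈ D.infinitesimals f x := by
  constructor
  · intro h U hU hUd hxU
    refine (hyz.mem_translate_iff hUd).mp (h _ ?_ (isDefinable_preimage_add hUd x) (by simpa))
    exact hU.preimage (continuous_add_const x)
  · intro h U hU hUd h0U
    have h1 := h {v | v + -x ∈ U} (hU.preimage (continuous_add_const (-x)))
      (isDefinable_preimage_add hUd (-x)) (by simpa)
    rw [← hyz.mem_translate_iff (isDefinable_preimage_add hUd (-x))] at h1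
    simpa using h1

/-- The germ inclusion holds on a definable open neighbourhood of x, whose points in N include all
infinitesimals at x. -/
theorem mem_points_of_germ {x : G} (hX : D.IsDefinable X) (hY : D.IsDefinable Y)
    (h : ∀ᶠ v in 𝓝 x, v ∈ X → v ∈ Y) {y : Fin n → N} (hy : y ∈ D.infinitesimals f x)
    (hyX : y ∈ D.points f X) : y ∈ D.points f Y := by
  obtain ⟨U, hU, hUo, h0U, hUd⟩ := D.exists_isDefinable_isOpen_subset h
  exact mem_points_of_inter_subset hUd hX hY (fun v hv => hU hv.1 hv.2) (hy U hUo hUd h0U) hyX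

/-- `ν(X)` is the set of the infinitesimals in `X - x`, for any `x ∈ X`. -/
theorem mem_nu_iff (hX : D.GLinear X) {x : G} (hx : x ∈ X) {y : Fin n → N} :
    y ∈ D.nu f X ↔ y ∈ D.infinitesimals f 0 ∧ y ∈ D.points f {v | v + x ∈ X} := by
  constructor
  · rintro ⟨x', hx', z, ⟨hz, hzX⟩, hyz⟩
    have hy := hyz.mem_infinitesimals_iff.mpr hz
    exact ⟨hy, mem_points_of_germ (isDefinable_preimage_add hX.1 x')
      (isDefinable_preimage_add hX.1 x)
      ((gEquivalent_iff.mp hX.2 x' hx' x hx).mono fun v => Iff.mp) hy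
      ((hyz.mem_translate_iff hX.1).mpr hzX)⟩
  · rintro ⟨hy, hyX⟩
    obtain ⟨z, hz⟩ := exists_addRel_const (isDefinable_preimage_add hX.1 x) x hyX
    exact ⟨x, hx, z, ⟨hz.mem_infinitesimals_iff.mp hy, (hz.mem_translate_iff hX.1).mp hyX⟩, hz⟩

theorem mem_nu_iff_of_zero_mem (hX : D.GLinear X) (h0 : (0 : G) ∈ X) {y : Fin n → N} :
    y ∈ D.nu f X ↔ y ∈ D.infinitesimals f 0 ∧ y ∈ D.points f X := by
  simpa using mem_nu_iff hX h0

theorem GLinear.add (hX : D.GLinear X) (hY : D.GLinear Y) : D.GLinear (X + Y) := by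
  letI := D.enc
  have := D.defType
  have := D.defAdd
  have := D.defAtlas
  exact ⟨DefP.mem_add hX.1 hY.1, gEquivalent_add_add (L := L) hX.1 hY.1 hX.2 hY.2⟩

omit hM [IsOrderedAddMonoid M] [IsTopologicalAddGroup G] [OrderTopology M] [AddCommGroup G]
  [TopologicalSpace G] [TopologicalSpace M] in
theorem mk_range_union_range_lt [NoMaxOrder M] (f : M → N) (c : Fin n → N) :
    #(range f ∪ range c : Set N) < Order.succ #M := by
  have : Infinite M := NoMaxOrder.infinite
  rw [Order.lt_succ_iff]
  refine (Cardinal.mk_union_le _ _).trans (Cardinal.add_le_of_le (Cardinal.aleph0_le_mk M)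
    Cardinal.mk_range_le ?_)
  exact (Cardinal.lt_aleph0_of_finite _).le.trans (Cardinal.aleph0_le_mk M)

/-- By transfer of the splitting into small summands, c has a decomposition inside each M-definable
open neighbourhood V of 0. These conditions form a directed family over M and the coordinates of c,
so saturation finds one decomposition that is good for all V. -/
theorem nu_add_subset (hX : D.GLinear X) (hY : D.GLinear Y)
    (hN : IsSaturated L N (Order.succ #M)) :
    D.nu f (X + Y) ⊆ D.sumSet f (D.nu f X) (D.nu f Y) := by
  intro c hc
  obtain ⟨-, ⟨x, hx, y, hy, rfl⟩, -⟩ := id hc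
  have hXY := hX.add hY
  rw [mem_nu_iff hXY (add_mem_add hx hy)] at hc
  have hXd := isDefinable_preimage_add hX.1 x
  have hYd := isDefinable_preimage_add hY.1 y
  have hXYd := isDefinable_preimage_add hXY.1 (x + y)
  let I := {V : Set G // IsOpen V ∧ (0 : G) ∈ V ∧ D.IsDefinable V}
  have hI : Nonempty I := ⟨univ, isOpen_univ, mem_univ _, by
    simpa [IsDefinable] using D.definable_carrier⟩
  let p : I → (Fin n → N) × (Fin n → N) → Prop := fun V z =>
    (z.1 ∈ D.points f V ∧ z.2 ∈ D.points f V) ∧ (z.1 ∈ D.points f {v | v + x ∈ X} ∧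
      z.2 ∈ D.points f {v | v + y ∈ Y}) ∧ D.AddRel f z.1 z.2 c
  have hp : ∀ V, DefP L (range f ∪ range c) (p V) := by
    intro V
    have hs := ((starPair_mem (f := f) (α := Fin n ⊕ Fin n ⊕ Fin n) V.2.2.2 (Sum.inr ∘ Sum.inl)).and
      (starPair_mem V.2.2.2 (Sum.inr ∘ Sum.inr ∘ Sum.inl))).and
      (((starPair_mem (f := f) (α := Fin n ⊕ Fin n ⊕ Fin n) hXd (Sum.inr ∘ Sum.inl)).and
        (starPair_mem hYd (Sum.inr ∘ Sum.inr ∘ Sum.inl))).and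
      (starPair_addRel (D := D) (f := f) (Sum.inr ∘ Sum.inl) (Sum.inr ∘ Sum.inr ∘ Sum.inl)
        (Sum.inr ∘ Sum.inr ∘ Sum.inr)))
    have hd := hs.definable (β := Fin n ⊕ Fin n) (subset_union_left (t := range c)) (Sum.elim
      (Sum.inr ∘ Sum.inl) (Sum.elim (Sum.inr ∘ Sum.inr)
        fun i => Sum.inl ⟨c i, Or.inr (mem_range_self i)⟩))
    refine (congrArg (Set.Definable _ L) (Set.ext fun v => ?_)).mp hd
    constructor
    · exact fun h => ⟨(v ∘ Sum.inl, v ∘ Sum.inr), h, Sum.elim_comp_inl_inr v⟩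
    · rintro ⟨z, hz, rfl⟩
      exact hz
  have hdir : ∀ V V' : I, ∃ V'' : I, ∀ z, p V'' z → p V z ∧ p V' z := by
    intro V V'
    obtain ⟨W, hW, hWo, h0W, hWd⟩ := D.exists_isDefinable_isOpen_subset
      (inter_mem (V.2.1.mem_nhds V.2.2.1) (V'.2.1.mem_nhds V'.2.2.1))
    have h1 := points_mono (f := f) hWd V.2.2.2 (hW.trans inter_subset_left)
    have h2 := points_mono (f := f) hWd V'.2.2.2 (hW.trans inter_subset_right)
    exact ⟨⟨W, hWo, h0W, hWd⟩, fun z hz => ⟨⟨⟨h1 hz.1.1, h1 hz.1.2⟩, hz.2⟩,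
      ⟨h2 hz.1.1, h2 hz.1.2⟩, hz.2⟩⟩
  have hne : ∀ V, ∃ z, p V z := by
    intro V
    have hsplit : ∀ᶠ v in 𝓝 (0 : G), v + (x + y) ∈ X + Y →
        ∃ a ∈ (V : Set G), ∃ b ∈ (V : Set G), a + x ∈ X ∧ b + y ∈ Y ∧ a + b = v := by
      letI := D.enc
      have := D.defType
      have := D.defAdd
      have := D.defAtlas
      exact exists_add_of_mem_add (L := L) hX.1 hY.1 hX.2 hY.2 hx hy (V.2.1.mem_nhds V.2.2.1)
    have hA : D.IsDefinable (V.1 ∩ {v | v + x ∈ X}) := by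
      letI := D.enc
      exact DefP.and (p := (· ∈ (V : Set G))) V.2.2.2 hXd
    have hB : D.IsDefinable (V.1 ∩ {v | v + y ∈ Y}) := by
      letI := D.enc
      exact DefP.and (p := (· ∈ (V : Set G))) V.2.2.2 hYd
    have hC : D.IsDefinable (V.1 ∩ {v | v + x ∈ X} + V.1 ∩ {v | v + y ∈ Y}) := by
      letI := D.enc
      have := D.defType
      have := D.defAdd
      exact DefP.mem_add hA hB
    obtain ⟨a, ha, b, hb, hab⟩ := exists_addRel_of_subset_add hA hB hC subset_rfl
      (mem_points_of_germ hXYd hC (hsplit.mono fun v hv h => by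
        obtain ⟨a, ha, b, hb, hax, hby, hab⟩ := hv h
        exact ⟨a, ⟨ha, hax⟩, b, ⟨hb, hby⟩, hab⟩) hc.1 hc.2)
    exact ⟨(a, b), ⟨points_mono hA V.2.2.2 inter_subset_left ha,
      points_mono hB V.2.2.2 inter_subset_left hb⟩,
      ⟨points_mono hA hXd inter_subset_right ha, points_mono hB hYd inter_subset_right hb⟩, hab⟩
  obtain ⟨z, hz⟩ := hN.exists_forall (mk_range_union_range_lt f c) hp hdir hne
  obtain ⟨V⟩ := id hI
  exact ⟨z.1, (mem_nu_iff hX hx).mpr ⟨fun U h1 h2 h3 => (hz ⟨U, h1, h3, h2⟩).1.1, (hz V).2.1.1⟩,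
    z.2, (mem_nu_iff hY hy).mpr ⟨fun U h1 h2 h3 => (hz ⟨U, h1, h3, h2⟩).1.2, (hz V).2.1.2⟩,
    (hz V).2.2⟩

/-- Continuity of addition keeps sums infinitesimal, and (X - x) + (Y - y) ⊆ (X + Y) - (x + y)
transfers to N. -/
theorem sumSet_nu_subset (hX : D.GLinear X) (hY : D.GLinear Y) :
    D.sumSet f (D.nu f X) (D.nu f Y) ⊆ D.nu f (X + Y) := by
  rintro c ⟨a, ha, b, hb, hab⟩
  obtain ⟨x, hx, -⟩ := id ha
  obtain ⟨y, hy, -⟩ := id hb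
  rw [mem_nu_iff hX hx] at ha
  rw [mem_nu_iff hY hy] at hb
  refine (mem_nu_iff (hX.add hY) (add_mem_add hx hy)).mpr ⟨fun U hU hUd h0U => ?_, ?_⟩
  · obtain ⟨V, hV, hVU⟩ := exists_nhds_zero_half (hU.mem_nhds h0U)
    obtain ⟨W, hW, hWo, h0W, hWd⟩ := D.exists_isDefinable_isOpen_subset hV
    exact hab.mem hWd hWd hUd (fun a ha b hb => hVU a (hW ha) b (hW hb)) (ha.1 W hWo hWd h0W)
      (hb.1 W hWo hWd h0W)
  · refine hab.mem (isDefinable_preimage_add hX.1 x) (isDefinable_preimage_add hY.1 y)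
      (isDefinable_preimage_add (hX.add hY).1 (x + y)) (fun a ha b hb => ?_) ha.2 hb.2
    exact ⟨_, ha, _, hb, add_add_add_comm a x b y⟩

theorem nuFamily_subset_nu (hX : D.GLinear X) (h0 : (0 : G) ∈ X) {𝒳 : Set (Set G)}
    (hd : ∀ Z ∈ 𝒳, D.IsDefinable Z) (h : ∀ Z ∈ 𝒳, ∀ᶠ v in 𝓝 (0 : G), v ∈ Z → v ∈ X) :
    D.nuFamily f 0 𝒳 ⊆ D.nu f X := by
  rintro y ⟨hy, hyZ⟩
  obtain ⟨Z, hZ, hyZ⟩ := mem_iUnion₂.mp hyZ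
  exact (mem_nu_iff_of_zero_mem hX h0).mpr
    ⟨hy, mem_points_of_germ (hd Z hZ) hX.1 (h Z hZ) hy hyZ⟩

theorem nu_subset_nuFamily (hX : D.GLinear X) (h0 : (0 : G) ∈ X) {𝒳 : Set (Set G)} {Z : Set G}
    (hZ : Z ∈ 𝒳) (hZd : D.IsDefinable Z) (hXZ : X ⊆ Z) : D.nu f X ⊆ D.nuFamily f 0 𝒳 := by
  intro y hy
  rw [mem_nu_iff_of_zero_mem hX h0] at hy
  exact ⟨hy.1, mem_iUnion₂.mpr ⟨Z, hZ, points_mono hX.1 hZd hXZ hy.2⟩⟩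

end Infinitesimals

end DefinableGroup

/-! ### Presentations, dimension and infinitesimals of generated groups -/

namespace DefinableGroup

section Generated

variable {L : FirstOrder.Language.{u, v}} {M : Type w} [L.Structure M]
  [AddCommGroup M] [LinearOrder M] [hM : Fact (OMinimalGroupExpansion L M)]
  [IsOrderedAddMonoid M] [Nontrivial M] [TopologicalSpace M] [OrderTopology M] [DenselyOrdered M]
  {G : Type w} [AddCommGroup G] [TopologicalSpace G] [IsTopologicalAddGroup G]
  {n : ℕ} {D : DefinableGroup L M G n} {X Y : Set G}

theorem GLinear.gEquivalent_add_left (hX : D.GLinear X) (hY : D.GLinear Y)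
    (h : GEquivalent X Y) : GEquivalent (X + Y) X := by
  letI := D.enc
  have := D.defType
  have := D.defAdd
  have := D.defAtlas
  exact _root_.gEquivalent_add_left (L := L) hX.1 hY.1 hX.2 hY.2 h

theorem GLinear.gEquivalent_union_left (hX : D.GLinear X) (hY : D.GLinear Y)
    (h : GEquivalent X Y) : GEquivalent (X ∪ Y) X := by
  letI := D.enc
  have := D.defType
  have := D.defAdd
  have := D.defAtlas
  exact _root_.gEquivalent_union_left (L := L) hX.1 hY.1 hX.2 h

theorem GLinear.union (hX : D.GLinear X) (hY : D.GLinear Y) (h : GEquivalent X Y) :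
    D.GLinear (X ∪ Y) := by
  letI := D.enc
  refine ⟨DefP.or hX.1 hY.1, ?_⟩
  have h1 := gEquivalent_iff.mp (hX.gEquivalent_union_left hY h)
  have h2 := gEquivalent_iff.mp (hY.gEquivalent_union_left hX h.symm)
  rw [union_comm] at h2
  refine gEquivalent_iff.mpr fun a ha b hb => ?_
  rcases id hb with hb' | hb'
  · filter_upwards [h1 a ha b hb', h1 b hb b hb'] with v h3 h4 using h3.trans h4.symm
  · filter_upwards [h2 a ha b hb', h2 b hb b hb'] with v h3 h4 using h3.trans h4.symm

omit [AddCommGroup M] [LinearOrder M] hM [IsOrderedAddMonoid M] [Nontrivial M] [OrderTopology M]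
  [DenselyOrdered M] [IsTopologicalAddGroup G] in
theorem GLinear.isGSubset (hX : D.GLinear X) : D.IsGSubset X X :=
  ⟨hX.1, fun h hh g hg => germLE_iff.mpr
    ((germEq_iff.mp (hX.2 h hh g hg)).mono fun _ => Iff.mp)⟩

theorem dim_le_dim {Z : Set G} (hZ : D.IsDefinable Z)
    (h : ∀ z ∈ Z, ∀ᶠ v in 𝓝 (0 : G), v + z ∈ Z → v ∈ X) : D.dim Z ≤ D.dim X := by
  letI := D.enc
  have := D.defType
  have := D.defAdd
  have := D.defAtlas
  exact ominDim_le_ominDim fun k σ hσ => exists_interior_image_nonempty_of_germ (L := L)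
    D.defF_coord D.coord_injective hZ (fun z hz => ⟨0, by simpa using h z hz⟩) σ hσ

omit [AddCommGroup M] [LinearOrder M] hM [IsOrderedAddMonoid M] [Nontrivial M] [OrderTopology M]
  [DenselyOrdered M] [IsTopologicalAddGroup G] in
theorem isPresentation_iteratedDiff (hY : D.IsDefinable Y) (h0 : (0 : G) ∈ Y) {κ : Cardinal.{w}}
    (hκ : ℵ₀ < κ) : D.IsPresentation κ (AddSubgroup.closure Y) (range (iteratedDiff Y)) where
  card_lt := (Cardinal.le_aleph0_iff_set_countable.mpr (countable_range _)).trans_lt hκ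
  definable := by
    letI := D.enc
    have := D.defType
    have := D.defAdd
    rintro _ ⟨n, rfl⟩
    exact DefP.mem_iteratedDiff hY n
  directed := (iteratedDiff_mono h0).directed_le.directedOn_range
  sUnion_eq := by rw [sUnion_range, iUnion_iteratedDiff h0]

theorem IsGSubset.eventually_mem (hsat : IsSaturated L M ℵ₀) (hX : D.GLinear X)
    (h0X : (0 : G) ∈ X) (hY : D.IsGSubset Y X) (h0Y : (0 : G) ∈ Y) :
    ∀ᶠ v in 𝓝 (0 : G), v ∈ AddSubgroup.closure Y → v ∈ X := by
  letI := D.enc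
  have := D.defType
  have := D.defAdd
  have := D.defAtlas
  have hX' : LocSubgroup L X := by simpa using locSubgroup_translate (L := L) hX.1 hX.2 h0X
  refine eventually_mem_of_mem_closure hsat hX' ⟨hY.1, fun y hy => ?_⟩ h0Y
  simpa [mem_translateBy] using germLE_iff.mp (hY.2 y hy 0 h0X)

/-- Differences of points of Z lie in ⟨Y⟩, so every germ of Z, translated to 0, lies in X. -/
theorem dim_le_dim_of_subset_closure (h : ∀ᶠ v in 𝓝 (0 : G), v ∈ AddSubgroup.closure Y → v ∈ X)
    {Z : Set G} (hZ : D.IsDefinable Z) (hZY : Z ⊆ AddSubgroup.closure Y) : D.dim Z ≤ D.dim X :=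
  dim_le_dim hZ fun z hz => h.mono fun v hv hvZ =>
    hv (by simpa using sub_mem (hZY hvZ) (hZY hz))

omit [AddCommGroup M] [LinearOrder M] hM [IsOrderedAddMonoid M] [Nontrivial M] [OrderTopology M]
  [DenselyOrdered M] [IsTopologicalAddGroup G] in
theorem IsPresentation.subset {κ : Cardinal.{w}} {H : AddSubgroup G} {𝒳 : Set (Set G)}
    (h : D.IsPresentation κ H 𝒳) {Z : Set G} (hZ : Z ∈ 𝒳) : Z ⊆ H :=
  h.sUnion_eq ▸ subset_sUnion_of_mem hZ

omit [AddCommGroup M] [LinearOrder M] hM [IsOrderedAddMonoid M] [Nontrivial M] [OrderTopology M]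
  [DenselyOrdered M] [IsTopologicalAddGroup G] in
theorem IsPresentation.nonempty {κ : Cardinal.{w}} {H : AddSubgroup G} {𝒳 : Set (Set G)}
    (h : D.IsPresentation κ H 𝒳) : 𝒳.Nonempty := by
  have h0 : (0 : G) ∈ ⋃₀ 𝒳 := h.sUnion_eq ▸ H.zero_mem
  obtain ⟨Z, hZ, -⟩ := h0
  exact ⟨Z, hZ⟩

/-- The dimension and the infinitesimals of a presentation of `⟨X⟩` with a member containing
`X`. -/
theorem isGreatest_and_nuFamily_eq (hX : D.GLinear X) (h0 : (0 : G) ∈ X)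
    (h : ∀ᶠ v in 𝓝 (0 : G), v ∈ AddSubgroup.closure X → v ∈ X) {κ : Cardinal.{w}}
    {𝒳 : Set (Set G)} (h𝒳 : D.IsPresentation κ (AddSubgroup.closure X) 𝒳) {Z : Set G} (hZ : Z ∈ 𝒳)
    (hXZ : X ⊆ Z) : IsGreatest (D.dim '' 𝒳) (D.dim X) ∧
      ∀ (N : Type w) [L.Structure N] (f : M ↪ₑ[L] N), D.nuFamily f 0 𝒳 = D.nu f X := by
  have hle : ∀ Z ∈ 𝒳, D.dim Z ≤ D.dim X := fun Z hZ =>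
    dim_le_dim_of_subset_closure h (h𝒳.definable Z hZ) (h𝒳.subset hZ)
  refine ⟨⟨⟨Z, hZ, (hle Z hZ).antisymm (ominDim_mono (image_mono hXZ))⟩, ?_⟩, fun N _ f => ?_⟩
  · rintro _ ⟨Z, hZ, rfl⟩
    exact hle Z hZ
  · exact (nuFamily_subset_nu hX h0 h𝒳.definable
      fun Z hZ => h.mono fun v hv hvZ => hv (h𝒳.subset hZ hvZ)).antisymm
      (nu_subset_nuFamily hX h0 hZ (h𝒳.definable Z hZ) hXZ)

end Generated

end DefinableGroup


/-! ### The theorem -/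

theorem mainTheorem9 {L : FirstOrder.Language.{u, v}} {M : Type w} [L.Structure M]
    [AddCommGroup M] [LinearOrder M] [IsOrderedAddMonoid M] [Nontrivial M]
    [TopologicalSpace M] [OrderTopology M] (hM : OMinimalGroupExpansion L M)
    {G : Type w} [AddCommGroup G] [TopologicalSpace G] {n : ℕ} (D : DefinableGroup L M G n) :
    -- sums and unions of `G`-linear sets
    (∀ X Y : Set G, D.GLinear X → D.GLinear Y →
      D.GLinear (X + Y) ∧
      (∀ (N : Type w) [L.Structure N] (f : M ↪ₑ[L] N), IsSaturated L N (Order.succ #M) →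
        D.nu f (X + Y) = D.sumSet f (D.nu f X) (D.nu f Y)) ∧
      (GEquivalent X Y → GEquivalent (X + Y) X ∧ GEquivalent (X + Y) Y) ∧
      (GEquivalent X Y →
        D.GLinear (X ∪ Y) ∧ GEquivalent (X ∪ Y) X ∧ GEquivalent (X ∪ Y) Y)) ∧
    -- generated groups, in an `ω`-saturated structure
    (IsSaturated L M ℵ₀ → ∀ X : Set G, D.GLinear X → (0 : G) ∈ X →
      -- the group generated by `X`
      ((∀ κ : Cardinal.{w}, ℵ₀ < κ → D.LocallyDefinable κ (AddSubgroup.closure X)) ∧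
        GermEq 0 (AddSubgroup.closure X : Set G) X ∧
        (∀ Z : Set G, Z ⊆ AddSubgroup.closure X → D.IsDefinable Z → D.dim Z ≤ D.dim X) ∧
        (∀ κ : Cardinal.{w}, ℵ₀ < κ → ∃ 𝒳 : Set (Set G),
          D.IsPresentation κ (AddSubgroup.closure X) 𝒳 ∧
          IsGreatest (D.dim '' 𝒳) (D.dim X) ∧
          ∀ (N : Type w) [L.Structure N] (f : M ↪ₑ[L] N), IsSaturated L N (Order.succ #M) →
            D.nuFamily f 0 𝒳 = D.nu f X) ∧
        (∀ κ : Cardinal.{w}, IsSaturated L M κ → ∀ 𝒳 : Set (Set G),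
          D.IsPresentation κ (AddSubgroup.closure X) 𝒳 →
          IsGreatest (D.dim '' 𝒳) (D.dim X) ∧
          ∀ (N : Type w) [L.Structure N] (f : M ↪ₑ[L] N), IsSaturated L N (Order.succ #M) →
            D.nuFamily f 0 𝒳 = D.nu f X)) ∧
      -- the group generated by a `G`-subset `Y` of `X`
      (∀ Y : Set G, D.IsGSubset Y X → (0 : G) ∈ Y →
        (∀ κ : Cardinal.{w}, ℵ₀ < κ → D.LocallyDefinable κ (AddSubgroup.closure Y)) ∧
        GermLE 0 (AddSubgroup.closure Y : Set G) X ∧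
        (∀ Z : Set G, Z ⊆ AddSubgroup.closure Y → D.IsDefinable Z → D.dim Z ≤ D.dim X) ∧
        (∀ (κ : Cardinal.{w}) (𝒳 : Set (Set G)),
          D.IsPresentation κ (AddSubgroup.closure Y) 𝒳 →
          (∃ d ≤ D.dim X, IsGreatest (D.dim '' 𝒳) d) ∧
          ∀ (N : Type w) [L.Structure N] (f : M ↪ₑ[L] N), IsSaturated L N (Order.succ #M) →
            D.nuFamily f 0 𝒳 ⊆ D.nu f X))) := by
  have := Fact.mk hM
  have := denselyOrdered_of_ominimal (M := M) L
  have := D.isTopologicalAddGroup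
  refine ⟨fun X Y hX hY => ⟨hX.add hY, fun N _ f hN => (DefinableGroup.nu_add_subset hX hY
    hN).antisymm (DefinableGroup.sumSet_nu_subset hX hY), fun h => ⟨hX.gEquivalent_add_left hY h,
    add_comm Y X ▸ hY.gEquivalent_add_left hX h.symm⟩, fun h => ⟨hX.union hY h,
    hX.gEquivalent_union_left hY h, union_comm Y X ▸ hY.gEquivalent_union_left hX h.symm⟩⟩,
    fun hsat X hX h0 => ⟨?_, fun Y hY h0Y => ?_⟩⟩
  · have hgerm := hX.isGSubset.eventually_mem hsat hX h0 h0
    refine ⟨fun κ hκ => ⟨_, DefinableGroup.isPresentation_iteratedDiff hX.1 h0 hκ⟩,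
      germEq_iff.mpr (hgerm.mono fun v hv => ⟨hv, fun h => AddSubgroup.subset_closure h⟩),
      fun Z hZ hZd => DefinableGroup.dim_le_dim_of_subset_closure hgerm hZd hZ, fun κ hκ => ?_,
      fun κ hsatκ 𝒳 h𝒳 => ?_⟩
    · have h𝒳 := DefinableGroup.isPresentation_iteratedDiff hX.1 h0 hκ
      -- X itself is the member of index 0 of the presentation by iterated differences.
      obtain ⟨h1, h2⟩ := DefinableGroup.isGreatest_and_nuFamily_eq hX h0 hgerm h𝒳
        (mem_range_self 0) subset_rfl
      exact ⟨_, h𝒳, h1, fun N _ f _ => h2 N f⟩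
    · letI := D.enc
      have := D.defType
      -- Saturation puts X inside a single member of the given presentation.
      obtain ⟨Z, hZ, hXZ⟩ := exists_subset_of_subset_sUnion hsatκ hX.1 h𝒳.card_lt h𝒳.definable
        h𝒳.directed h𝒳.nonempty (h𝒳.sUnion_eq ▸ AddSubgroup.subset_closure)
      obtain ⟨h1, h2⟩ := DefinableGroup.isGreatest_and_nuFamily_eq hX h0 hgerm h𝒳 hZ hXZ
      exact ⟨h1, fun N _ f _ => h2 N f⟩
  · have hgerm := hY.eventually_mem hsat hX h0 h0Y
    refine ⟨fun κ hκ => ⟨_, DefinableGroup.isPresentation_iteratedDiff hY.1 h0Y hκ⟩,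
      germLE_iff.mpr hgerm,
      fun Z hZ hZd => DefinableGroup.dim_le_dim_of_subset_closure hgerm hZd hZ,
      fun κ 𝒳 h𝒳 => ⟨?_, fun N _ f _ => DefinableGroup.nuFamily_subset_nu hX h0 h𝒳.definable
        fun Z hZ => hgerm.mono fun v hv hvZ => hv (h𝒳.subset hZ hvZ)⟩⟩
    obtain ⟨_, ⟨Z, hZ, rfl⟩, hmax⟩ := exists_isGreatest_ominDim (h𝒳.nonempty.image (D.coord '' ·))
    refine ⟨D.dim Z, DefinableGroup.dim_le_dim_of_subset_closure hgerm (h𝒳.definable Z hZ)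
      (h𝒳.subset hZ), ⟨Z, hZ, rfl⟩, ?_⟩
    rintro _ ⟨Z', hZ', rfl⟩
    exact hmax _ ⟨Z', hZ', rfl⟩
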